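/- **Conventions.** Write $z=x+iy$ with $y>0$, $q=e^{2\pi i z}$, $\zeta_n=e^{2\pi i/n}$, $(q;q)_\infty=\prod_{n\ge1}(1-q^n)$; all non-integral powers of complex numbers are principal. For odd $d$ let $\epsilon_d=1$ if $d\equiv1\pmod 4$ and $\epsilon_d=i$ if $d\equiv3\pmod 4$, and let $\left(\frac{\gamma}{d}\right)$ be the Jacobi symbol $\left(\frac{\gamma}{|d|}\right)$, with an extra factor $-1$ when $\gamma<0$ and $d<0$ (and $\left(\frac{0}{\pm1}\right)=1$). A *weight $\frac32$ harmonic weak Maass form* on a finite-index subgroup $\Gamma\subset\Gamma_0(4)$ is a smooth function $g:\mathbb H\to\mathbb C$ such that 1. $g(Az)=\left(\frac{\gamma}{\delta}\right)^{3}\epsilon_\delta^{-3}(\gamma z+\delta)^{3/2}g(z)$ for all $A=\begin{pmatrix}\alpha&\beta\\ \gamma&\delta\end{pmatrix}\in\Gamma$ and all $z\in\mathbb H$; 2. $\Delta_{3/2}\,g=0$, where $\Delta_k=-y^2\left(\frac{\partial^2}{\partial x^2}+\frac{\partial^2}{\partial y^2}\right)+iky\left(\frac{\partial}{\partial x}+i\frac{\partial}{\partial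 y}\right)$; 3. $g$ has at most linear exponential growth at all cusps: for every $A=\begin{pmatrix}\alpha&\beta\\ \gamma&\delta\end{pmatrix}\in SL_2(\mathbb Z)$ there is a real $C$ with $(\gamma z+\delta)^{-3/2}g(Az)=O(e^{Cy})$ as $y\to\infty$, uniformly in $x$. **Theorem.** Let $0<a<c$ be coprime integers and $d_c=\mathrm{lcm}(6,c)$. Put $$R_2\left(\tfrac ac;q\right)=\frac{\zeta_{2c}^{a}}{2(q;q)_\infty}\sum_{n\in\mathbb Z}\frac{(-1)^{n+1}q^{\frac n2(3n+1)}}{1-\zeta_c^aq^n}+\frac{\zeta_{2c}^{3a}}{(q;q)_\infty}\sum_{n\in\mathbb Z}\frac{(-1)^{n+1}q^{\frac{3n}2(n+1)}}{(1-\zeta_c^aq^n)^2},\qquad \mathcal R\left(\tfrac ac;q\right)=q^{-1}R_2\left(\tfrac ac;q^{24}\right),$$ $$\Theta_{a,c}(\tau)=\sum_{\pm}\sum_{k\in\mathbb Z}(-1)^k e^{2\pi i\left(\frac{d_c}6\pm\frac{d_ca}c+d_ck\right)^2\tau},$$ $$\mathcal N_{\frac ac}(z)=\frac{i}{32\sqrt3\,\pi}\int_{-\bar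 z}^{i\infty}\frac{\Theta_{a,c}\left(-\frac1{16d_c^2\tau}\right)(-i\tau)^{-\frac12}}{(-i(\tau+z))^{\frac32}}\,d\tau ,$$ the integral being along the vertical half-line from $-\bar z$ to $i\infty$. Then, for all $z\in\mathbb H$, the two series in $R_2(\frac ac;q^{24})$, the series $\Theta_{a,c}(z)$ and the integral $\mathcal N_{\frac ac}(z)$ converge absolutely, and the function $$\mathcal M_{\frac ac}(z)=\mathcal R\left(\tfrac ac;q\right)+\mathcal N_{\frac ac}(z)$$ is a weight $\frac32$ harmonic weak Maass form on $\Gamma_1(96d_c^2)$. -/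

import Mathlib

open Complex MeasureTheory
open UpperHalfPlane hiding I
open scoped MatrixGroups ContDiff ComplexConjugate

namespace TwistedRank

noncomputable section

/-! ### Half-integral weight harmonic weak Maass forms -/

/-- Partial derivative in the real direction of a function of `z = x + iy`. -/
def partialX (f : ℂ → ℂ) (z : ℂ) : ℂ := fderiv ℝ f z 1

/-- Partial derivative in the imaginary direction of a function of `z = x + iy`. -/
def partialY (f : ℂ → ℂ) (z : ℂ) : ℂ := fderiv ℝ f z I

/-- The weight `k` hyperbolic Laplacian
`-y² (∂²/∂x² + ∂²/∂y²) + i k y (∂/∂x + i ∂/∂y)`. -/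
def hypLaplacian (k : ℂ) (f : ℂ → ℂ) (z : ℂ) : ℂ :=
  -(z.im : ℂ) ^ 2 * (partialX (partialX f) z + partialY (partialY f) z)
    + I * k * (z.im : ℂ) * (partialX f z + I * partialY f z)

/-- `ε_v` for odd `v`: it is `1` if `v ≡ 1 (mod 4)` and `i` if `v ≡ 3 (mod 4)`. -/
def epsilon (v : ℤ) : ℂ := if v % 4 = 1 then 1 else I

/-- Shimura's extended symbol `(c/d)` for odd `d`, possibly negative: the Jacobi symbol `(c/|d|)`,
with an additional sign when both `c` and `d` are negative (so `(0/±1) = 1`). -/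
def shimuraSymbol (c d : ℤ) : ℤ :=
  if c < 0 ∧ d < 0 then -jacobiSym c d.natAbs else jacobiSym c d.natAbs

/-- `IsHarmonicWeakMaassForm κ χ Γ g`: the function `g` on the upper half-plane is a harmonic weak
Maass form of weight `κ/2` (`κ` odd) and Nebentypus `χ` on the finite-index subgroup `Γ` of
`Γ₀(4)`. The half-integral power of `cz+d` is the principal one. -/
structure IsHarmonicWeakMaassForm (κ : ℤ) {M : ℕ} (χ : DirichletCharacter ℂ M)
    (Γ : Subgroup SL(2, ℤ)) (g : ℍ → ℂ) : Prop where
  odd_weight : Odd κ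
  le_Gamma0 : Γ ≤ CongruenceSubgroup.Gamma0 4
  smooth : ContDiffOn ℝ ∞ (g ∘ ofComplex) {z : ℂ | 0 < z.im}
  transform : ∀ A ∈ Γ, ∀ z : ℍ,
    g (A • z) = ((shimuraSymbol (A 1 0) (A 1 1) : ℤ) : ℂ) ^ κ * epsilon (A 1 1) ^ (-κ)
      * χ ((A 1 1 : ℤ) : ZMod M)
      * ((A 1 0 : ℂ) * (z : ℂ) + (A 1 1 : ℂ)) ^ ((κ : ℂ) / 2) * g z
  harmonic : ∀ z : ℍ, hypLaplacian ((κ : ℂ) / 2) (g ∘ ofComplex) z = 0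
  /-- At most linear exponential growth at the cusp `A∞`, for every `A ∈ SL₂(ℤ)`: the function
  `(cz+d)^{-κ/2} g(Az)` is `O(e^{Cy})` as `y → ∞`, uniformly in `x`. -/
  growth : ∀ A : SL(2, ℤ), ∃ C : ℝ,
    (fun z : ℍ => ((A 1 0 : ℂ) * (z : ℂ) + (A 1 1 : ℂ)) ^ (-((κ : ℂ) / 2)) * g (A • z))
      =O[atImInfty] fun z : ℍ => Real.exp (C * z.im)

/-! ### The twisted second rank moment -/

/-- `e(x) = exp(2πix)`; thus `ζ_c^a = e(a/c)`, `ζ_{2c}^a = e(a/(2c))` and `q = e(z)`. -/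
def e (x : ℂ) : ℂ := exp (2 * Real.pi * I * x)

/-- `(q;q)_∞`. -/
def qPoch (q : ℂ) : ℂ := ∏' n : ℕ, (1 - q ^ (n + 1))

/-- Summand of the series with simple poles (the exponent `n(3n+1)/2` is an integer). -/
def simpleTerm (a c : ℕ) (q : ℂ) (n : ℤ) : ℂ :=
  (-1 : ℂ) ^ (n + 1) * q ^ (n * (3 * n + 1) / 2) / (1 - e ((a : ℂ) / c) * q ^ n)

/-- Summand of the series with double poles (the exponent `3n(n+1)/2` is an integer). -/
def doubleTerm (a c : ℕ) (q : ℂ) (n : ℤ) : ℂ :=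
  (-1 : ℂ) ^ (n + 1) * q ^ (3 * n * (n + 1) / 2) / (1 - e ((a : ℂ) / c) * q ^ n) ^ 2

/-- The twisted second rank moment generating function `R₂(a/c; q)`. -/
def R2 (a c : ℕ) (q : ℂ) : ℂ :=
  e ((a : ℂ) / (2 * c)) / (2 * qPoch q) * ∑' n : ℤ, simpleTerm a c q n
    + e (3 * (a : ℂ) / (2 * c)) / qPoch q * ∑' n : ℤ, doubleTerm a c q n

/-- `𝓡(a/c; q) = q⁻¹ R₂(a/c; q²⁴)` at `q = e(z)`. -/
def holPart (a c : ℕ) (z : ℍ) : ℂ := (e z)⁻¹ * R2 a c (e z ^ 24)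

/-! ### The theta integral -/

/-- `d_c = lcm(6, c)`. -/
def dc (c : ℕ) : ℕ := Nat.lcm 6 c

/-- Summand of `Θ_{a,c}`: the two terms `(-1)^k e(m²τ)` with
`m = d_c/6 ± d_c a/c + d_c k` (both quotients are integers). -/
def thetaTerm (a c : ℕ) (τ : ℂ) (k : ℤ) : ℂ :=
  (-1 : ℂ) ^ k *
    (e ((((dc c / 6 : ℕ) : ℂ) + ((dc c / c : ℕ) : ℂ) * a + (dc c : ℂ) * k) ^ 2 * τ)
      + e ((((dc c / 6 : ℕ) : ℂ) - ((dc c / c : ℕ) : ℂ) * a + (dc c : ℂ) * k) ^ 2 * τ))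

/-- The theta function `Θ_{a,c}(τ)`. -/
def Theta (a c : ℕ) (τ : ℂ) : ℂ := ∑' k : ℤ, thetaTerm a c τ k

/-- The integrand of the theta integral, with principal branches of the powers. -/
def thetaIntegrand (a c : ℕ) (z τ : ℂ) : ℂ :=
  Theta a c (-1 / (16 * (dc c : ℂ) ^ 2 * τ)) * (-I * τ) ^ (-(1 / 2) : ℂ)
    / (-I * (τ + z)) ^ (3 / 2 : ℂ)

/-- The non-holomorphic part: `i / (32 √3 π)` times the integral of `thetaIntegrand` from `-z̄` to
`i∞` along the vertical half-line `τ = -z̄ + it`, `t > 0`, on which `dτ = i dt`. -/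
def nonholPart (a c : ℕ) (z : ℍ) : ℂ :=
  I / (32 * (Real.sqrt 3 : ℂ) * (Real.pi : ℂ))
    * ∫ t in Set.Ioi (0 : ℝ), thetaIntegrand a c z (-conj (z : ℂ) + I * t) * I

/-- The completed function `𝓜_{a/c}`. -/
def completed (a c : ℕ) (z : ℍ) : ℂ := holPart a c z + nonholPart a c z

end

end TwistedRank

/-!
Write `e(x) = exp(2πix)`, `u = a/c`, `y = Im z` and `M = R + N` for the completed function. The
proof exhibits `M` as a quotient of two explicitly modular objects: `4 π² η(24 z) M(z) = L(z)`,
where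

  `L(z) = ∑_{λ, μ} (-1)^(λ + μ + λμ) e(-3 λ u / 2) exp(-π |W|² / (16 y)) / W²`,  `W = 24 λ z + μ + u`,

is an absolutely convergent sum over a shifted lattice (`latticeTerm_eq`, `latticeSum_eq`). Apart
from a root of unity, a summand depends on `W` only through `|W|² / y` and `W²`; an element of
`Γ₁(96 d_c²)` permutes the shifted lattice, preserves the roots of unity and divides `W` by the
automorphy factor, so `L` has weight 2 (`latticeSum_moebius`). The function `η(24 z)` has weight
`1/2` with the theta multiplier (`etaTheta_moebius`): it is `e(z) ϑ(1/2 + 12 z, 36 z)`, and the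
two-variable theta function transforms under all of `Γ₀(4)` by Euclid's algorithm on the lower row
of the matrix (`thetaLaw_of_four_dvd`). Dividing gives the weight `3/2` law, since Shimura's
symbol is its own inverse.

The identity comes from summing `L` by rows. The fundamental theorem of calculus in the parameter
of the Gaussian gives `exp(-π W² / (16 y)) / W² = 1 / W² - ∫ (Gaussian in W)`. Summed over `μ`
with signs, the first term is the partial fraction series of `π² cos(π w) / sin²(π w)`, and
Poisson summation turns the second into exponentials weighted by incomplete gamma factors
(`tsum_row`). Summing over `λ`, the trigonometric parts combine to the two Appell–Lerch type
series of `R₂`, whose denominator `(q; q)_∞` is cancelled by `η(24 z) = e(z) ∏ (1 - e(24 n z))`,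
that is by the pentagonal number theorem (`qPoch_eq_tsum`, `hasSum_row_holomorphic`). In the
Gaussian parts, completing the square leaves `∑_l (-1)^l e((6 l + m)² z)` with `m` odd, which is a
multiple of `η(24 z)` depending on `m` modulo 12 (`shiftedEta_of_odd`); what remains is a series
`∑ a_m e(-m² z̄) K_m(y)` with incomplete gamma factors `K_m`. The theta integral is the same
series up to a constant: invert `Θ` by Poisson summation and integrate termwise (`Theta_dual`,
`nonholPart_eq`).

Smoothness and harmonicity are read off from that series: its `∂/∂z̄`-derivative is `y^(-3/2)`
times an antiholomorphic series (`hypLaplacian_hol_add_nonhol`).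

For the growth condition, a lower bound for the Euler product (`exp_le_norm_qPoch`) yields the
crude estimate `|M(z)| ≤ K exp(C (y + 1/y))` on the whole upper half-plane (`norm_completed_le`).
Near the cusp `A∞`, the function `|M(Az)| Im(Az)^(3/4)` is periodic in `x`, because the conjugate
by `A` of a translation by a multiple of the level lies in `Γ₁(96 d_c²)` (`petersson_translate`).
Hence `x` may be taken bounded, where `Im(Az)` lies between constant multiples of `1/y` and `y`,
and the crude estimate suffices (`growth_completed`).
-/

namespace TwistedRank

open scoped Real

/-! ### Square roots of products -/

lemma cpow_half_mul_of_arg_add_le {x y : ℂ} (hx : x ≠ 0) (hy : y ≠ 0)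
    (h₁ : -π < x.arg + y.arg) (h₂ : x.arg + y.arg ≤ π) :
    (x * y) ^ (1 / 2 : ℂ) = x ^ (1 / 2 : ℂ) * y ^ (1 / 2 : ℂ) := by
  rw [cpow_def_of_ne_zero (mul_ne_zero hx hy), cpow_def_of_ne_zero hx, cpow_def_of_ne_zero hy,
    log_mul hx hy ⟨h₁, h₂⟩, ← Complex.exp_add]
  ring_nf

/-- When the arguments add up to more than `π`, the product crosses the branch cut and the principal
root changes sign. -/
lemma cpow_half_mul_of_lt_arg_add {x y : ℂ} (hx : x ≠ 0) (hy : y ≠ 0)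
    (h : π < x.arg + y.arg) :
    (x * y) ^ (1 / 2 : ℂ) = -(x ^ (1 / 2 : ℂ) * y ^ (1 / 2 : ℂ)) := by
  have hlog : log (x * y) = log x + log y - 2 * π * I := by
    have h₁ : cexp (log (x * y)) = cexp (log x + log y) := by
      rw [Complex.exp_add, exp_log hx, exp_log hy, exp_log (mul_ne_zero hx hy)]
    obtain ⟨n, hn⟩ := Complex.exp_eq_exp_iff_exists_int.1 h₁
    have him := congrArg Complex.im hn
    simp only [log_im, add_im, mul_im, mul_re, intCast_re, intCast_im, ofReal_re, ofReal_im,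
      Complex.I_re, Complex.I_im, re_ofNat, im_ofNat] at him
    ring_nf at him
    have hπ := Real.pi_pos
    have b₁ := Complex.neg_pi_lt_arg (x * y)
    have b₂ := Complex.arg_le_pi (x * y)
    have b₃ := Complex.arg_le_pi x
    have b₄ := Complex.arg_le_pi y
    have n_lt : (n : ℝ) < 0 := by
      by_contra hc
      push Not at hc
      nlinarith
    have n_gt : (-2 : ℝ) < n := by
      by_contra hc
      push Not at hc
      nlinarith
    have n_eq : n = -1 := by
      have h1 : n < 0 := by exact_mod_cast n_lt
      have h2 : -2 < n := by exact_mod_cast n_gt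
      omega
    rw [hn, n_eq]
    push_cast
    ring
  rw [cpow_def_of_ne_zero (mul_ne_zero hx hy), cpow_def_of_ne_zero hx, cpow_def_of_ne_zero hy,
    hlog, ← Complex.exp_add,
    show (log x + log y - 2 * π * I) * (1 / 2 : ℂ)
      = log x * (1 / 2) + log y * (1 / 2) - π * I by ring, Complex.exp_sub, exp_pi_mul_I]
  ring

lemma im_mul_eq_norm_mul_sin (x y : ℂ) :
    (x * y).im = ‖x‖ * ‖y‖ * Real.sin (x.arg + y.arg) := by
  rw [Real.sin_add]
  have h1 := Complex.norm_mul_cos_arg x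
  have h2 := Complex.norm_mul_sin_arg x
  have h3 := Complex.norm_mul_cos_arg y
  have h4 := Complex.norm_mul_sin_arg y
  rw [mul_im, ← h1, ← h2, ← h3, ← h4]
  ring

/-- The square root is multiplicative on a pair whose first factor and whose product lie in the
right half-plane and whose second factor lies in the upper half-plane; this is the case needed for
the theta inversion. -/
lemma cpow_half_mul_of_re_pos {x y : ℂ} (hx : 0 < x.re) (hy : 0 < y.im)
    (hxy : 0 < (x * y).re) :
    (x * y) ^ (1 / 2 : ℂ) = x ^ (1 / 2 : ℂ) * y ^ (1 / 2 : ℂ) := by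
  have hx0 : x ≠ 0 := by rintro rfl; simp at hx
  have hy0 : y ≠ 0 := by rintro rfl; simp at hy
  have h1 := (Complex.abs_arg_lt_pi_div_two_iff).2 (Or.inl hx)
  rw [abs_lt] at h1
  have h2 : 0 < y.arg := by
    have := Complex.arg_nonneg_iff.2 hy.le
    rcases this.lt_or_eq with h | h
    · exact h
    · exact absurd (Complex.arg_eq_zero_iff.1 h.symm).2 hy.ne'
  refine cpow_half_mul_of_arg_add_le hx0 hy0 (by linarith [Real.pi_pos]) ?_
  by_contra hc
  push Not at hc
  have h3 := Complex.arg_le_pi y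
  have hcos : (x * y).re = ‖x‖ * ‖y‖ * Real.cos (x.arg + y.arg) := by
    rw [Real.cos_add]
    have h1 := Complex.norm_mul_cos_arg x
    have h2 := Complex.norm_mul_sin_arg x
    have h3 := Complex.norm_mul_cos_arg y
    have h4 := Complex.norm_mul_sin_arg y
    rw [mul_re, ← h1, ← h2, ← h3, ← h4]
    ring
  have hneg : Real.cos (x.arg + y.arg) < 0 :=
    Real.cos_neg_of_pi_div_two_lt_of_lt (by linarith) (by linarith)
  rw [hcos] at hxy
  have := norm_pos_iff.2 hx0
  have := norm_pos_iff.2 hy0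
  have : ‖x‖ * ‖y‖ * Real.cos (x.arg + y.arg) < 0 := mul_neg_of_pos_of_neg (by positivity) hneg
  linarith

/-! ### The theta multiplier -/

/-- The Jacobi symbol `(c/·)` with `4 ∣ c` is periodic modulo `|c|`. -/
lemma jacobiSym_add_natAbs {c : ℤ} (hc : 4 ∣ c) {n : ℕ} (hn : Odd n) :
    jacobiSym c (n + c.natAbs) = jacobiSym c n := by
  obtain ⟨k, rfl⟩ := hc
  have h2 : ∀ m : ℕ, Odd m → jacobiSym (4 * k) m = jacobiSym k m := by
    intro m hm
    rw [show (4 : ℤ) * k = 2 ^ 2 * k by ring, jacobiSym.mul_left, jacobiSym.pow_left]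
    have : jacobiSym 2 m ^ 2 = 1 := by
      apply jacobiSym.sq_one
      rw [Int.gcd_comm]
      simpa [Int.gcd, Nat.coprime_comm] using hm.coprime_two_right
    rw [this, one_mul]
  have hodd : Odd (n + (4 * k).natAbs) := by
    rw [Int.natAbs_mul]
    exact hn.add_even (Even.mul_right (by decide) _)
  rw [h2 _ hodd, h2 _ hn, jacobiSym.mod_right _ hodd, jacobiSym.mod_right _ hn, Int.natAbs_mul]
  simp

/-- Evenness of the character `(c/·)` for `c > 0` divisible by `4`. -/
lemma jacobiSym_eq_of_add_eq {c : ℤ} (hc : 4 ∣ c) {m n : ℕ} (hm : Odd m) (hn : Odd n)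
    (h : (m : ℤ) + n = c) : jacobiSym c m = jacobiSym c n := by
  have h1 : jacobiSym c m = jacobiSym n m := by
    apply jacobiSym.mod_left'
    rw [← h]; simp
  have h2 : jacobiSym c n = jacobiSym m n := by
    apply jacobiSym.mod_left'
    rw [← h]; simp
  rw [h1, h2]
  have h4 : m % 4 = 1 ∨ n % 4 = 1 := by
    rcases hm with ⟨i, rfl⟩
    rcases hn with ⟨j, rfl⟩
    omega
  rcases h4 with h4 | h4
  · exact (jacobiSym.quadratic_reciprocity_one_mod_four h4 hn).symm
  · exact jacobiSym.quadratic_reciprocity_one_mod_four h4 hm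

lemma jacobiSym_neg_eq_of_add_eq {c : ℤ} (hc : 4 ∣ c) {m n : ℕ} (hm : Odd m) (hn : Odd n)
    (h : (m : ℤ) + n = c) : jacobiSym (-c) m = -jacobiSym (-c) n := by
  rw [jacobiSym.neg _ hm, jacobiSym.neg _ hn, jacobiSym_eq_of_add_eq hc hm hn h]
  have h4 : (m % 4 = 1 ∧ n % 4 = 3) ∨ (m % 4 = 3 ∧ n % 4 = 1) := by
    rcases hm with ⟨i, rfl⟩
    rcases hn with ⟨j, rfl⟩
    omega
  rcases h4 with ⟨h, h'⟩ | ⟨h, h'⟩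
  · rw [ZMod.χ₄_nat_one_mod_four h, ZMod.χ₄_nat_three_mod_four h']; ring
  · rw [ZMod.χ₄_nat_one_mod_four h', ZMod.χ₄_nat_three_mod_four h]; ring

lemma shimuraSymbol_add_right {c d : ℤ} (hc : 4 ∣ c) (hd : Odd d) :
    shimuraSymbol c (d + c) = shimuraSymbol c d := by
  have hce : Even c := (by decide : Even (4 : ℤ)).trans_dvd hc
  have hd' : Odd (d + c) := hd.add_even hce
  have hn : Odd d.natAbs := Int.natAbs_odd.2 hd
  have hn' : Odd (d + c).natAbs := Int.natAbs_odd.2 hd'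
  unfold shimuraSymbol
  rcases lt_trichotomy c 0 with hc0 | hc0 | hc0
  · obtain ⟨b, rfl⟩ : ∃ b, c = -b := ⟨-c, by ring⟩
    have hb : 4 ∣ b := by simpa using hc
    rcases lt_or_ge d 0 with hd0 | hd0
    · rw [if_pos ⟨hc0, by omega⟩, if_pos ⟨hc0, hd0⟩,
        show (d + -b).natAbs = d.natAbs + (-b).natAbs by omega, jacobiSym_add_natAbs hc hn]
    · rcases lt_or_ge (d + -b) 0 with hs | hs
      · rw [if_pos ⟨hc0, hs⟩, if_neg (by omega),
          jacobiSym_neg_eq_of_add_eq hb hn hn' (by omega)]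
      · rw [if_neg (by omega), if_neg (by omega)]
        conv_rhs => rw [show d.natAbs = (d + -b).natAbs + (-b).natAbs by omega,
          jacobiSym_add_natAbs hc hn']
  · subst hc0; simp
  · rw [if_neg (by omega), if_neg (by omega)]
    rcases lt_or_ge d 0 with hd0 | hd0
    · rcases lt_or_ge (d + c) 0 with hs | hs
      · conv_rhs => rw [show d.natAbs = (d + c).natAbs + c.natAbs by omega,
          jacobiSym_add_natAbs hc hn']
      · exact jacobiSym_eq_of_add_eq hc hn' hn (by omega)
    · rw [show (d + c).natAbs = d.natAbs + c.natAbs by omega, jacobiSym_add_natAbs hc hn]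

/-- The multiplier `(c/d) ε_d⁻¹` of the weight `1/2` theta function. -/
noncomputable def thetaMultiplier (c d : ℤ) : ℂ := (shimuraSymbol c d : ℂ) * (epsilon d)⁻¹

lemma thetaMultiplier_add_right {c d : ℤ} (hc : 4 ∣ c) (hd : Odd d) :
    thetaMultiplier c (d + c) = thetaMultiplier c d := by
  unfold thetaMultiplier epsilon
  rw [shimuraSymbol_add_right hc hd, show (d + c) % 4 = d % 4 by omega]

lemma jacobiSym_add_four_mul_left (c d : ℤ) :
    jacobiSym (c + 4 * d) d.natAbs = jacobiSym c d.natAbs := by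
  apply jacobiSym.mod_left'
  refine Int.modEq_iff_dvd.2 ?_
  rw [Int.natCast_natAbs, abs_dvd]
  exact ⟨-4, by ring⟩

/-- The compatibility of the multiplier with right multiplication by the matrix `(1, 0; 4, 1)`:
the change of sign of Shimura's symbol is the one of the principal square root. -/
lemma thetaMultiplier_mul_cpow {c d : ℤ} (hdc : c = 0 → d = 1 ∨ d = -1) {w y : ℂ}
    (hw : 0 < w.im) (hy : 0 < y.im) (hprod : ((c * w + d) * y).im = (c + 4 * d) * (y.im / 4))
    (hx0 : (c : ℂ) * w + d ≠ 0) :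
    thetaMultiplier (c + 4 * d) d * ((c * w + d) * y) ^ (1 / 2 : ℂ)
      = thetaMultiplier c d * ((c * w + d) ^ (1 / 2 : ℂ) * y ^ (1 / 2 : ℂ)) := by
  have hy0 : y ≠ 0 := by rintro rfl; simp at hy
  have hya : 0 < y.arg := by
    rcases (Complex.arg_nonneg_iff.2 hy.le).lt_or_eq with h | h
    · exact h
    · exact absurd (Complex.arg_eq_zero_iff.1 h.symm).2 hy.ne'
  have hyπ : y.arg < π := Complex.arg_lt_pi_iff.2 (Or.inr hy.ne')
  set x : ℂ := c * w + d with hx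
  have hxim : x.im = c * w.im := by simp [hx]
  have hxπ := Complex.arg_le_pi x
  have hxπ' := Complex.neg_pi_lt_arg x
  have hnx := norm_pos_iff.2 hx0
  have hny := norm_pos_iff.2 hy0
  have hsym : ∀ s : ℤ, shimuraSymbol (c + 4 * d) d = s * shimuraSymbol c d →
      thetaMultiplier (c + 4 * d) d = s * thetaMultiplier c d := by
    intro s hs
    unfold thetaMultiplier
    rw [hs]; push_cast; ring
  have plus : x.arg + y.arg ≤ π → shimuraSymbol (c + 4 * d) d = shimuraSymbol c d →
      thetaMultiplier (c + 4 * d) d * (x * y) ^ (1 / 2 : ℂ)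
      = thetaMultiplier c d * (x ^ (1 / 2 : ℂ) * y ^ (1 / 2 : ℂ)) := by
    intro h hs
    rw [cpow_half_mul_of_arg_add_le hx0 hy0 (by linarith) h, hsym 1 (by simpa using hs)]
    simp
  have minus : π < x.arg + y.arg → shimuraSymbol (c + 4 * d) d = -shimuraSymbol c d →
      thetaMultiplier (c + 4 * d) d * (x * y) ^ (1 / 2 : ℂ)
      = thetaMultiplier c d * (x ^ (1 / 2 : ℂ) * y ^ (1 / 2 : ℂ)) := by
    intro h hs
    rw [cpow_half_mul_of_lt_arg_add hx0 hy0 h, hsym (-1) (by simpa using hs)]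
    push_cast
    ring
  have him := im_mul_eq_norm_mul_sin x y
  have hJ := jacobiSym_add_four_mul_left c d
  rcases lt_trichotomy c 0 with hc0 | hc0 | hc0
  · have : x.arg < 0 := Complex.arg_neg_iff.2 (by
      rw [hxim]; exact mul_neg_of_neg_of_pos (by exact_mod_cast hc0) hw)
    apply plus (by linarith)
    unfold shimuraSymbol
    rw [hJ]
    by_cases hd0 : d < 0
    · rw [if_pos ⟨by omega, hd0⟩, if_pos ⟨hc0, hd0⟩]
    · rw [if_neg (by omega), if_neg (by omega)]
  · subst hc0
    rcases hdc rfl with rfl | rfl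
    · have hx1 : x = 1 := by simp [hx]
      apply plus
      · rw [hx1, Complex.arg_one]; linarith
      · unfold shimuraSymbol
        rw [hJ]; simp
    · have hx1 : x = -1 := by simp [hx]
      apply minus
      · rw [hx1, Complex.arg_neg_one]; linarith
      · unfold shimuraSymbol
        rw [hJ]; simp
  · have hxa : 0 < x.arg := by
      have hpos : 0 < x.im := by
        rw [hxim]; exact mul_pos (by exact_mod_cast hc0) hw
      rcases (Complex.arg_nonneg_iff.2 hpos.le).lt_or_eq with h | h
      · exact h
      · exact absurd (Complex.arg_eq_zero_iff.1 h.symm).2 hpos.ne'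
    have hxπ'' : x.arg < π := by
      refine Complex.arg_lt_pi_iff.2 (Or.inr ?_)
      rw [hxim]
      exact (mul_pos (by exact_mod_cast hc0) hw).ne'
    rcases lt_or_ge (c + 4 * d) 0 with hs | hs
    · apply minus
      · by_contra hcon
        push Not at hcon
        have hsin : 0 ≤ Real.sin (x.arg + y.arg) :=
          Real.sin_nonneg_of_nonneg_of_le_pi (by linarith) hcon
        have : (x * y).im < 0 := by
          rw [hprod]
          exact mul_neg_of_neg_of_pos (by exact_mod_cast hs) (by linarith)
        rw [him] at this
        have := mul_nonneg (mul_pos hnx hny).le hsin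
        linarith
      · unfold shimuraSymbol
        rw [hJ, if_pos ⟨hs, by omega⟩, if_neg (by omega)]
    · apply plus
      · by_contra hcon
        push Not at hcon
        have hsin : Real.sin (x.arg + y.arg) < 0 := by
          have := Real.sin_pos_of_pos_of_lt_pi (x := x.arg + y.arg - π) (by linarith) (by linarith)
          rw [Real.sin_sub_pi] at this
          linarith
        have h1 : 0 ≤ (x * y).im := by
          rw [hprod]
          exact mul_nonneg (by exact_mod_cast hs) (by linarith)
        rw [him] at h1
        have := mul_neg_of_pos_of_neg (mul_pos hnx hny) hsin
        linarith
      · unfold shimuraSymbol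
        rw [hJ, if_neg (by omega), if_neg (by omega)]

/-! ### The Jacobi theta function under `Γ₀(4)` -/

/-- The transformation law of `ϑ(u, z) = ∑ e(n² z + n u)` under the Möbius transformation with
integral coefficients `a, b, c, d`. -/
def ThetaLaw (a b c d : ℤ) : Prop :=
  ∀ z : ℂ, 0 < z.im → ∀ u : ℂ,
    jacobiTheta₂ (u / (c * z + d)) (2 * ((a * z + b) / (c * z + d)))
      = thetaMultiplier c d * (c * z + d) ^ (1 / 2 : ℂ)
        * cexp (π * I * (c / 2) * u ^ 2 / (c * z + d)) * jacobiTheta₂ u (2 * z)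

lemma linear_ne_zero {c d : ℤ} (h : c ≠ 0 ∨ d ≠ 0) {z : ℂ} (hz : 0 < z.im) :
    (c : ℂ) * z + d ≠ 0 := by
  intro h0
  have him := congrArg Complex.im h0
  simp only [add_im, mul_im, intCast_re, intCast_im, zero_mul, add_zero, zero_im] at him
  have hc : c = 0 := by
    rcases mul_eq_zero.1 him with h | h
    · exact_mod_cast h
    · exact absurd h hz.ne'
  subst hc
  rcases h with h | h
  · exact h rfl
  · apply h
    simpa using h0

lemma im_moebius {a b c d : ℤ} (hdet : a * d - b * c = 1) (z : ℂ) :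
    ((a * z + b) / (c * z + d) : ℂ).im = z.im / normSq (c * z + d) := by
  have hdet' : (a : ℝ) * d - b * c = 1 := by exact_mod_cast hdet
  rw [div_im, div_sub_div_same]
  congr 1
  simp
  linear_combination z.im * hdet'

lemma im_moebius_pos {a b c d : ℤ} (hdet : a * d - b * c = 1) {z : ℂ} (hz : 0 < z.im) :
    0 < ((a * z + b) / (c * z + d) : ℂ).im := by
  rw [im_moebius hdet]
  refine div_pos hz (normSq_pos.2 (linear_ne_zero ?_ hz))
  by_contra h
  push Not at h
  rw [h.1, h.2] at hdet
  simp at hdet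

/-- Two applications of the functional equation give the transformation under
`z ↦ z / (4 z + 1)`. -/
lemma jacobiTheta₂_div_four_mul_add_one {z : ℂ} (hz : 0 < z.im) (u : ℂ) :
    jacobiTheta₂ (u / (4 * z + 1)) (2 * (z / (4 * z + 1)))
      = (4 * z + 1) ^ (1 / 2 : ℂ) * cexp (π * I * 2 * u ^ 2 / (4 * z + 1))
        * jacobiTheta₂ u (2 * z) := by
  have hz0 : z ≠ 0 := by rintro rfl; simp at hz
  have hj : 4 * z + 1 ≠ 0 := by
    have := linear_ne_zero (c := 4) (d := 1) (Or.inl (by norm_num)) hz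
    simpa using this
  have hj' : z * 4 + 1 ≠ 0 := by rwa [mul_comm]
  rw [jacobiTheta₂_functional_equation u (2 * z),
    jacobiTheta₂_functional_equation (u / (4 * z + 1))]
  have e1 : u / (4 * z + 1) / (2 * (z / (4 * z + 1))) = u / (2 * z) := by
    field_simp
  have e2 : -1 / (2 * z) = -1 / (2 * (z / (4 * z + 1))) + 2 := by
    field_simp; ring
  rw [e1, e2, jacobiTheta₂_add_right]
  have himpos : 0 < (z / (4 * z + 1)).im := by
    have := im_moebius_pos (a := 1) (b := 0) (c := 4) (d := 1) (by norm_num) hz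
    simpa using this
  have hs : (-I * (2 * z)) ^ (1 / 2 : ℂ)
      = (-I * (2 * (z / (4 * z + 1)))) ^ (1 / 2 : ℂ) * (4 * z + 1) ^ (1 / 2 : ℂ) := by
    have hmul : -I * (2 * z) = (-I * (2 * (z / (4 * z + 1)))) * (4 * z + 1) := by
      field_simp
    rw [hmul]
    refine cpow_half_mul_of_re_pos (by simpa using himpos) (by simpa using hz) ?_
    rw [← hmul]
    simpa using hz
  have h1 : (-I * (2 * (z / (4 * z + 1)))) ^ (1 / 2 : ℂ) ≠ 0 := by
    rw [Ne, cpow_eq_zero_iff]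
    have : -I * (2 * (z / (4 * z + 1))) ≠ 0 := by
      simp [hz0, hj]
    tauto
  have h2 : (4 * z + 1) ^ (1 / 2 : ℂ) ≠ 0 := by
    rw [Ne, cpow_eq_zero_iff]; tauto
  rw [hs]
  have hexp : cexp (-π * I * (u / (4 * z + 1)) ^ 2 / (2 * (z / (4 * z + 1))))
      = cexp (π * I * 2 * u ^ 2 / (4 * z + 1)) * cexp (-π * I * u ^ 2 / (2 * z)) := by
    rw [← Complex.exp_add]
    congr 1
    field_simp
    ring
  rw [hexp]
  generalize (-I * (2 * (z / (4 * z + 1)))) ^ (1 / 2 : ℂ) = A at h1 ⊢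
  generalize (4 * z + 1) ^ (1 / 2 : ℂ) = B at h2 ⊢
  generalize jacobiTheta₂ (u / (2 * z)) _ = C
  field_simp

lemma jacobiTheta₂_add_two_mul_int (u τ : ℂ) (n : ℤ) :
    jacobiTheta₂ u (τ + 2 * n) = jacobiTheta₂ u τ := by
  have h : Function.Periodic (fun τ => jacobiTheta₂ u τ) 2 := fun τ => jacobiTheta₂_add_right u τ
  have := h.int_mul n τ
  rw [← this]; ring_nf

lemma thetaLaw_of_lower_left_eq_zero {a b d : ℤ} (hdet : a * d - b * 0 = 1) :
    ThetaLaw a b 0 d := by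
  intro z hz u
  have had : a * d = 1 := by simpa using hdet
  rcases Int.mul_eq_one_iff_eq_one_or_neg_one.1 had with ⟨rfl, rfl⟩ | ⟨rfl, rfl⟩
  · have : thetaMultiplier 0 1 = 1 := by
      simp [thetaMultiplier, shimuraSymbol, epsilon]
    simp only [this]
    have h := jacobiTheta₂_add_two_mul_int u (2 * z) b
    simp only [Int.cast_zero, Int.cast_one, zero_mul, zero_add, div_one, one_mul, one_cpow,
      mul_zero, zero_div, Complex.exp_zero]
    rw [← h]; ring_nf
  · have h1 : thetaMultiplier 0 (-1) = I⁻¹ := by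
      simp [thetaMultiplier, shimuraSymbol, epsilon]
    have h2 : (-1 : ℂ) ^ (1 / 2 : ℂ) = I := by
      rw [cpow_def_of_ne_zero (by norm_num), log_neg_one,
        show (π : ℂ) * I * (1 / 2) = (π / 2 : ℂ) * I by ring, exp_pi_div_two_mul_I]
    have h := jacobiTheta₂_add_two_mul_int u (2 * z) (-b)
    have e1 : (2 : ℂ) * ((((-1 : ℤ) : ℂ) * z + b) / (((0 : ℤ) : ℂ) * z + ((-1 : ℤ) : ℂ)))
        = 2 * z + 2 * ((-b : ℤ) : ℂ) := by
      push_cast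
      ring
    have e2 : u / (((0 : ℤ) : ℂ) * z + ((-1 : ℤ) : ℂ)) = -u := by
      push_cast; ring
    rw [e1, e2, jacobiTheta₂_neg_left, h, h1]
    have e3 : ((0 : ℤ) : ℂ) * z + ((-1 : ℤ) : ℂ) = -1 := by push_cast; ring
    rw [e3, h2]
    simp

lemma odd_of_det {a b c d : ℤ} (hdet : a * d - b * c = 1) (hc : 4 ∣ c) : Odd d := by
  obtain ⟨k, rfl⟩ := hc
  by_contra hd
  rw [Int.not_odd_iff_even] at hd
  obtain ⟨l, rfl⟩ := hd
  have : 2 * (a * l - b * (2 * k)) = 1 := by linear_combination hdet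
  omega

lemma thetaLaw_mul_translate {a b c d : ℤ} (hdet : a * d - b * c = 1) (hc : 4 ∣ c) :
    ThetaLaw a (b + a) c (d + c) ↔ ThetaLaw a b c d := by
  have hm := thetaMultiplier_add_right hc (odd_of_det hdet hc)
  have key : ∀ z u : ℂ, jacobiTheta₂ u (2 * (z + 1)) = jacobiTheta₂ u (2 * z) := by
    intro z u
    rw [mul_add, mul_one, jacobiTheta₂_add_right]
  constructor
  · intro h z hz u
    have := h (z - 1) (by simpa using hz) u
    rw [hm] at this
    have k := key (z - 1) u
    rw [sub_add_cancel] at k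
    rw [k]
    push_cast at this
    rw [show (c : ℂ) * (z - 1) + (d + c) = c * z + d by ring,
      show (a : ℂ) * (z - 1) + (b + a) = a * z + b by ring] at this
    exact this
  · intro h z hz u
    have := h (z + 1) (by simpa using hz) u
    rw [key] at this
    rw [hm]
    push_cast
    rw [show (c : ℂ) * z + (d + c) = c * (z + 1) + d by ring,
      show (a : ℂ) * z + (b + a) = a * (z + 1) + b by ring]
    exact this

lemma thetaLaw_mul_lower {a b c d : ℤ} (hdet : a * d - b * c = 1) :
    ThetaLaw (a + 4 * b) b (c + 4 * d) d ↔ ThetaLaw a b c d := by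
  have hdet' : (a + 4 * b) * d - b * (c + 4 * d) = 1 := by linear_combination hdet
  have hcd : ∀ {a b c d : ℤ}, a * d - b * c = 1 → c ≠ 0 ∨ d ≠ 0 := by
    intro a b c d hdet
    by_contra h
    push Not at h
    rw [h.1, h.2] at hdet
    simp at hdet
  have hdc : c = 0 → d = 1 ∨ d = -1 := by
    rintro rfl
    rw [mul_zero, sub_zero] at hdet
    rcases Int.mul_eq_one_iff_eq_one_or_neg_one.1 hdet with h | h <;> simp [h.2]
  -- both laws are the same equation, taken at `z` and at `z / (4 z + 1)`
  have key : ∀ z : ℂ, 0 < z.im → ∀ u : ℂ,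
      (jacobiTheta₂ (u / ((c + 4 * d : ℤ) * z + d))
          (2 * (((a + 4 * b : ℤ) * z + b) / ((c + 4 * d : ℤ) * z + d)))
        = thetaMultiplier (c + 4 * d) d * ((c + 4 * d : ℤ) * z + d) ^ (1 / 2 : ℂ)
          * cexp (π * I * ((c + 4 * d : ℤ) / 2) * u ^ 2 / ((c + 4 * d : ℤ) * z + d))
          * jacobiTheta₂ u (2 * z)) ↔
      (jacobiTheta₂ (u / (4 * z + 1) / (c * (z / (4 * z + 1)) + d))
          (2 * ((a * (z / (4 * z + 1)) + b) / (c * (z / (4 * z + 1)) + d)))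
        = thetaMultiplier c d * (c * (z / (4 * z + 1)) + d) ^ (1 / 2 : ℂ)
          * cexp (π * I * (c / 2) * (u / (4 * z + 1)) ^ 2 / (c * (z / (4 * z + 1)) + d))
          * jacobiTheta₂ (u / (4 * z + 1)) (2 * (z / (4 * z + 1)))) := by
    intro z hz u
    have hj : 4 * z + 1 ≠ 0 := by
      have := linear_ne_zero (c := 4) (d := 1) (Or.inl (by norm_num)) hz
      simpa using this
    have hj2 : z * 4 + 1 ≠ 0 := by rwa [mul_comm]
    have hj' : ((c + 4 * d : ℤ) : ℂ) * z + d ≠ 0 := linear_ne_zero (hcd hdet') hz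
    have himpos : 0 < (z / (4 * z + 1)).im := by
      have := im_moebius_pos (a := 1) (b := 0) (c := 4) (d := 1) (by norm_num) hz
      simpa using this
    have hx0 : (c : ℂ) * (z / (4 * z + 1)) + d ≠ 0 := linear_ne_zero (hcd hdet) himpos
    have hprod : ((c + 4 * d : ℤ) : ℂ) * z + d
        = (c * (z / (4 * z + 1)) + d) * (4 * z + 1) := by
      push_cast
      field_simp
      ring
    have hmul := thetaMultiplier_mul_cpow hdc himpos (y := 4 * z + 1) (by simpa using hz)
      (by rw [← hprod]; simp) hx0
    rw [jacobiTheta₂_div_four_mul_add_one hz]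
    have e1 : u / (4 * z + 1) / (c * (z / (4 * z + 1)) + d)
        = u / ((c + 4 * d : ℤ) * z + d) := by
      rw [hprod, div_div, mul_comm (4 * z + 1)]
    have e2 : ((a : ℂ) * (z / (4 * z + 1)) + b) / (c * (z / (4 * z + 1)) + d)
        = ((a + 4 * b : ℤ) * z + b) / ((c + 4 * d : ℤ) * z + d) := by
      rw [hprod, div_eq_div_iff hx0 (mul_ne_zero hx0 hj)]
      push_cast
      field_simp
      ring
    have e3 : cexp (π * I * ((c + 4 * d : ℤ) / 2) * u ^ 2 / ((c + 4 * d : ℤ) * z + d))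
        = cexp (π * I * (c / 2) * (u / (4 * z + 1)) ^ 2 / (c * (z / (4 * z + 1)) + d))
          * cexp (π * I * 2 * u ^ 2 / (4 * z + 1)) := by
      rw [← Complex.exp_add]
      congr 1
      have hx1 : (c : ℂ) * z + d * (4 * z + 1) ≠ 0 := by
        intro h0
        apply hj'
        push_cast
        linear_combination h0
      have hx2 : ((c : ℂ) + 4 * d) * z + d ≠ 0 := by
        intro h0
        apply hj'
        push_cast
        exact h0
      push_cast
      field_simp
      ring
    rw [e1, e2, e3]
    have e4 : thetaMultiplier (c + 4 * d) d * ((c + 4 * d : ℤ) * z + d) ^ (1 / 2 : ℂ)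
        = thetaMultiplier c d * ((c * (z / (4 * z + 1)) + d) ^ (1 / 2 : ℂ)
          * (4 * z + 1) ^ (1 / 2 : ℂ)) := by
      rw [hprod]; exact hmul
    rw [e4]
    constructor <;> intro h <;> rw [h] <;> ring
  constructor
  · intro h z hz u
    have h4 : 1 - 4 * z ≠ 0 := by
      have := linear_ne_zero (c := -4) (d := 1) (Or.inl (by norm_num)) hz
      push_cast at this
      intro h0
      apply this
      linear_combination h0
    have h4' : 1 - z * 4 ≠ 0 := by rwa [mul_comm]
    have hw : 0 < (z / (1 - 4 * z)).im := by
      have := im_moebius_pos (a := 1) (b := 0) (c := -4) (d := 1) (by norm_num) hz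
      push_cast at this
      simp only [one_mul, add_zero] at this
      rwa [show -4 * z + 1 = 1 - 4 * z by ring] at this
    have hj : 4 * (z / (1 - 4 * z)) + 1 = 1 / (1 - 4 * z) := by
      field_simp; ring
    have := (key _ hw (u / (1 - 4 * z))).1 (h _ hw _)
    rw [hj] at this
    have e1 : u / (1 - 4 * z) / (1 / (1 - 4 * z)) = u := by field_simp
    have e2 : z / (1 - 4 * z) / (1 / (1 - 4 * z)) = z := by field_simp
    rw [e1, e2] at this
    exact this
  · intro h z hz u
    refine (key z hz u).2 (h _ ?_ _)
    have := im_moebius_pos (a := 1) (b := 0) (c := 4) (d := 1) (by norm_num) hz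
    simpa using this

/-- The theta function transforms under `Γ₀(4)` with the multiplier `(c/d) ε_d⁻¹`: Euclid's
algorithm on the lower row, with `c` and `d` reduced modulo `4 d` and `c`, leads to `c = 0`. -/
theorem thetaLaw_of_four_dvd {a b c d : ℤ} (hdet : a * d - b * c = 1) (hc : 4 ∣ c) :
    ThetaLaw a b c d := by
  induction hn : c.natAbs + d.natAbs using Nat.strong_induction_on generalizing a b c d with
  | _ n ih =>
    rcases eq_or_ne c 0 with rfl | hc0
    · exact thetaLaw_of_lower_left_eq_zero (by simpa using hdet)
    have hodd := odd_of_det hdet hc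
    have hne : 2 * d.natAbs ≠ c.natAbs := by
      obtain ⟨k, rfl⟩ := hc
      obtain ⟨l, rfl⟩ := hodd
      omega
    have hd0 : d ≠ 0 := by rintro rfl; simp at hodd
    rcases lt_or_gt_of_ne hne with h | h
    · by_cases hs : 0 < c ↔ 0 < d
      · have hdet' : (a - 4 * b) * d - b * (c - 4 * d) = 1 := by linear_combination hdet
        have := ih _ (by omega) hdet' (by omega) rfl
        have h2 := (thetaLaw_mul_lower hdet').2 this
        simpa using h2
      · have hdet' : (a + 4 * b) * d - b * (c + 4 * d) = 1 := by linear_combination hdet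
        exact (thetaLaw_mul_lower hdet).1 (ih _ (by omega) hdet' (by omega) rfl)
    · by_cases hs : 0 < c ↔ 0 < d
      · have hdet' : a * (d - c) - (b - a) * c = 1 := by linear_combination hdet
        have := ih _ (by omega) hdet' hc rfl
        have h2 := (thetaLaw_mul_translate hdet' hc).2 this
        simpa using h2
      · have hdet' : a * (d + c) - (b + a) * c = 1 := by linear_combination hdet
        exact (thetaLaw_mul_translate hdet hc).1 (ih _ (by omega) hdet' hc rfl)

/-! ### The exponential `e` -/

lemma e_add (x y : ℂ) : e (x + y) = e x * e y := by
  unfold e; rw [← Complex.exp_add]; ring_nf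

lemma e_neg (x : ℂ) : e (-x) = (e x)⁻¹ := by
  unfold e; rw [← Complex.exp_neg]; ring_nf

lemma e_ne_zero (x : ℂ) : e x ≠ 0 := Complex.exp_ne_zero _

lemma e_intCast (n : ℤ) : e n = 1 := by
  unfold e
  rw [mul_comm, exp_int_mul_two_pi_mul_I]

lemma e_add_intCast (x : ℂ) (n : ℤ) : e (x + n) = e x := by
  rw [e_add, e_intCast, mul_one]

lemma e_int_mul (n : ℤ) (x : ℂ) : e (n * x) = e x ^ n := by
  unfold e
  rw [← Complex.exp_int_mul]; ring_nf

lemma e_nat_mul (n : ℕ) (x : ℂ) : e (n * x) = e x ^ n := by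
  unfold e
  rw [← Complex.exp_nat_mul]; ring_nf

lemma norm_e (x : ℂ) : ‖e x‖ = Real.exp (-2 * π * x.im) := by
  unfold e
  rw [Complex.norm_exp]
  congr 1
  simp

lemma e_intCast_div_two (n : ℤ) : e ((n : ℂ) / 2) = (-1) ^ n := by
  have h : e (1 / 2) = -1 := by
    unfold e
    rw [show 2 * (π : ℂ) * I * (1 / 2) = π * I by ring, exp_pi_mul_I]
  rw [← h, ← e_int_mul]
  ring_nf

lemma norm_neg_one_zpow (n : ℤ) : ‖(-1 : ℂ) ^ n‖ = 1 := by
  rw [norm_zpow]; simp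

/-! ### The pentagonal number theorem in the unit disc -/

lemma norm_prod_one_sub_pow_le {x : ℂ} (hx : ‖x‖ < 1) (k n : ℕ) :
    ‖∏ i ∈ Finset.range n, (1 - x ^ (k + i + 1))‖ ≤ Real.exp (1 - ‖x‖)⁻¹ := by
  rw [norm_prod]
  calc ∏ i ∈ Finset.range n, ‖1 - x ^ (k + i + 1)‖
      ≤ ∏ i ∈ Finset.range n, Real.exp (‖x‖ ^ i) := by
        refine Finset.prod_le_prod (fun _ _ => norm_nonneg _) fun i _ => ?_
        calc ‖1 - x ^ (k + i + 1)‖ ≤ 1 + ‖x‖ ^ (k + i + 1) := by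
              refine (norm_sub_le _ _).trans ?_
              rw [norm_one, norm_pow]
          _ ≤ ‖x‖ ^ i + 1 := by
              rw [add_comm]
              gcongr ?_ + _
              exact pow_le_pow_of_le_one (norm_nonneg _) hx.le (by omega)
          _ ≤ _ := Real.add_one_le_exp _
    _ = Real.exp (∑ i ∈ Finset.range n, ‖x‖ ^ i) := (Real.exp_sum _ _).symm
    _ ≤ _ := by
        gcongr
        rw [← tsum_geometric_of_lt_one (norm_nonneg _) hx]
        exact (summable_geometric_of_lt_one (norm_nonneg _) hx).sum_le_tsum _
          fun _ _ => by positivity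

lemma self_le_pentagonal_neg (n : ℕ) : n ≤ pentagonal (-(n : ℤ)) := by
  have := two_mul_natCast_pentagonal_neg n
  nlinarith [sq_nonneg (n : ℤ)]

lemma self_le_pentagonal_add_one (n : ℕ) : n ≤ pentagonal ((n : ℤ) + 1) := by
  have := two_mul_natCast_pentagonal ((n : ℤ) + 1)
  nlinarith [sq_nonneg (n : ℤ)]

lemma tsum_int_alternating_pentagonal {x : ℂ}
    (h₁ : Summable fun n : ℕ => (-1 : ℂ) ^ n * x ^ pentagonal (-(n : ℤ)))
    (h₂ : Summable fun n : ℕ => (-1 : ℂ) ^ n * x ^ pentagonal ((n : ℤ) + 1)) :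
    ∑' k : ℕ, (-1 : ℂ) ^ k * (x ^ pentagonal (-(k : ℤ)) - x ^ pentagonal ((k : ℤ) + 1))
      = ∑' n : ℤ, (-1) ^ n * x ^ pentagonal (-n) := by
  have hs₁ : HasSum (fun n : ℕ => (-1 : ℂ) ^ (n : ℤ) * x ^ pentagonal (-(n : ℤ)))
      (∑' n : ℕ, (-1 : ℂ) ^ n * x ^ pentagonal (-(n : ℤ))) := by
    simp only [zpow_natCast]
    exact h₁.hasSum
  have hs₂ : HasSum (fun n : ℕ => (-1 : ℂ) ^ (-(n + 1 : ℤ)) * x ^ pentagonal (-(-(n + 1 : ℤ))))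
      (-∑' n : ℕ, (-1 : ℂ) ^ n * x ^ pentagonal ((n : ℤ) + 1)) := by
    refine h₂.hasSum.neg.congr_fun ?_
    intro n
    have : (-1 : ℂ) ^ (-(n + 1 : ℤ)) = -(-1) ^ n := by
      rw [zpow_neg, ← inv_zpow, inv_neg, inv_one, zpow_add₀ (by norm_num)]
      simp
    rw [this, neg_neg]
    ring
  have h := HasSum.of_nat_of_neg_add_one (f := fun n : ℤ => (-1 : ℂ) ^ n * x ^ pentagonal (-n))
    hs₁ hs₂
  rw [h.tsum_eq, ← sub_eq_add_neg, ← h₁.tsum_sub h₂]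
  simp_rw [mul_sub]

/-- Euler's pentagonal number theorem on the open unit disc. -/
theorem qPoch_eq_tsum {x : ℂ} (hx : ‖x‖ < 1) :
    qPoch x = ∑' n : ℤ, (-1) ^ n * x ^ pentagonal (-n) := by
  have hgeom := summable_geometric_of_lt_one (norm_nonneg x) hx
  have hx' : ∀ k : ℕ, ‖x‖ ^ k ≤ 1 := fun k => pow_le_one₀ (norm_nonneg _) hx.le
  have hpow : ∀ {a b : ℕ}, a ≤ b → ‖x‖ ^ b ≤ ‖x‖ ^ a := fun h =>
    pow_le_pow_of_le_one (norm_nonneg _) hx.le h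
  set B := Real.exp (1 - ‖x‖)⁻¹ with hB
  have hBpos : 0 < B := Real.exp_pos _
  have hbound : ∀ k n : ℕ,
      ‖x ^ ((k + 1) * n) * ∏ i ∈ Finset.range (n + 1), (1 - x ^ (k + i + 1))‖
        ≤ ‖x‖ ^ n * B := by
    intro k n
    rw [norm_mul, norm_pow]
    exact mul_le_mul (hpow (by nlinarith)) (norm_prod_one_sub_pow_le hx k _) (norm_nonneg _)
      (by positivity)
  have hsum : Summable fun n : ℕ => ‖x‖ ^ n * B := hgeom.mul_right _
  have h₁ : Summable fun n : ℕ => (-1 : ℂ) ^ n * x ^ pentagonal (-(n : ℤ)) := by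
    refine Summable.of_norm_bounded hgeom fun n => ?_
    rw [norm_mul, norm_pow, norm_neg, norm_one, one_pow, one_mul, norm_pow]
    exact hpow (self_le_pentagonal_neg n)
  have h₂ : Summable fun n : ℕ => (-1 : ℂ) ^ n * x ^ pentagonal ((n : ℤ) + 1) := by
    refine Summable.of_norm_bounded hgeom fun n => ?_
    rw [norm_mul, norm_pow, norm_neg, norm_one, one_pow, one_mul, norm_pow]
    exact hpow (self_le_pentagonal_add_one n)
  have hmain := Pentagonal.tprod_one_sub_pow (x := x)
    (tendsto_pow_atTop_nhds_zero_of_norm_lt_one hx)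
    (fun k => Summable.of_norm_bounded hsum (hbound k))
    (fun k => by
      apply multipliable_one_add_of_summable (f := fun n => -x ^ (n + k + 1))
      simpa [add_assoc] using (summable_nat_add_iff (k + 1)).mpr hgeom)
    (by simpa [mul_sub] using h₁.sub h₂)
    (by
      have hlim : Filter.Tendsto (fun k : ℕ => ‖x‖ ^ k * ∑' n : ℕ, ‖x‖ ^ n * B)
          Filter.atTop (nhds 0) := by
        simpa using (tendsto_pow_atTop_nhds_zero_of_lt_one (norm_nonneg _) hx).mul_const
          (∑' n : ℕ, ‖x‖ ^ n * B)
      refine squeeze_zero_norm (fun k => ?_) hlim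
      rw [norm_mul, norm_mul, norm_pow, norm_neg, norm_one, one_pow, one_mul, norm_pow]
      refine mul_le_mul (hpow ?_) (tsum_of_norm_bounded hsum.hasSum (hbound k)) (norm_nonneg _)
        (by positivity)
      rw [Nat.le_div_iff_mul_le (by norm_num)]
      nlinarith)
  unfold qPoch
  rw [hmain, tsum_int_alternating_pentagonal h₁ h₂]

/-! ### The theta series of `η(24 z)` -/

/-- The theta series `∑ (-1)ⁿ e((6 n + m)² z)`. -/
noncomputable def shiftedEta (m : ℤ) (z : ℂ) : ℂ :=
  ∑' n : ℤ, (-1) ^ n * e ((6 * n + m) ^ 2 * z)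

/-- The theta series `∑ (-1)ⁿ e((6 n + 1)² z)` of `η(24 z)`. -/
noncomputable def etaTheta (z : ℂ) : ℂ := shiftedEta 1 z

lemma etaTheta_eq_mul_qPoch {z : ℂ} (hz : 0 < z.im) :
    etaTheta z = e z * qPoch (e z ^ 24) := by
  have hq : ‖e z ^ 24‖ < 1 := by
    rw [norm_pow]
    refine pow_lt_one₀ (norm_nonneg _) ?_ (by norm_num)
    rw [norm_e, Real.exp_lt_one_iff]
    nlinarith [Real.pi_pos]
  rw [qPoch_eq_tsum hq, ← tsum_mul_left]
  refine tsum_congr fun n => ?_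
  have h2 := two_mul_natCast_pentagonal_neg n
  have : ((6 * n + (1 : ℤ) : ℂ)) ^ 2 = 1 + ((24 * pentagonal (-n) : ℕ) : ℂ) := by
    have h3 : (2 * (pentagonal (-n) : ℤ) : ℂ) = n * (3 * n + 1) := by exact_mod_cast h2
    push_cast at h3 ⊢
    linear_combination (-12) * h3
  rw [this, add_mul, one_mul, e_add, e_nat_mul, pow_mul]
  ring

lemma shiftedEta_add_six (m : ℤ) (z : ℂ) : shiftedEta (m + 6) z = -shiftedEta m z := by
  unfold shiftedEta
  rw [← (Equiv.subRight (1 : ℤ)).tsum_eq, ← tsum_neg]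
  refine tsum_congr fun n => ?_
  simp only [Equiv.subRight_apply]
  rw [zpow_sub₀ (by norm_num)]
  push_cast
  ring_nf

lemma shiftedEta_neg (m : ℤ) (z : ℂ) : shiftedEta (-m) z = shiftedEta m z := by
  unfold shiftedEta
  rw [← (Equiv.neg ℤ).tsum_eq]
  refine tsum_congr fun n => ?_
  simp only [Equiv.neg_apply]
  rw [zpow_neg, ← inv_zpow, inv_neg, inv_one]
  push_cast
  ring_nf

lemma shiftedEta_add_six_mul (m k : ℤ) (z : ℂ) :
    shiftedEta (m + 6 * k) z = (-1) ^ k * shiftedEta m z := by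
  induction k using Int.induction_on with
  | zero => simp
  | succ i ih =>
    rw [mul_add, mul_one, ← add_assoc, shiftedEta_add_six, ih, zpow_add₀ (by norm_num)]
    simp
  | pred i ih =>
    have h := shiftedEta_add_six (m + 6 * (-(i : ℤ) - 1)) z
    rw [show m + 6 * (-(i : ℤ) - 1) + 6 = m + 6 * (-(i : ℤ)) by ring, ih] at h
    have h' : (-1 : ℂ) ^ (-(i : ℤ) - 1) = -(-1) ^ (-(i : ℤ)) := by
      rw [zpow_sub₀ (by norm_num), zpow_one, div_neg, div_one]
    rw [h', neg_mul, h, neg_neg]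

/-- For odd `m` the shifted theta series is `χ₁₂(m) η(24 z)`; the character is written as
`(2/√3) cos(π m / 6)`. -/
lemma shiftedEta_of_odd {m : ℤ} (hm : Odd m) (z : ℂ) :
    shiftedEta m z = 2 / (Real.sqrt 3 : ℂ) * Complex.cos (π * m / 6) * etaTheta z := by
  have h3 : (Real.sqrt 3 : ℂ) ≠ 0 := by
    rw [Ne, ofReal_eq_zero]; positivity
  have hcos : ∀ r k : ℤ, Complex.cos (π * ((r + 6 * k : ℤ) : ℂ) / 6)
      = (-1) ^ k * Complex.cos (π * r / 6) := by
    intro r k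
    rw [show (π * ((r + 6 * k : ℤ) : ℂ) / 6 : ℂ) = π * r / 6 + k * π by push_cast; ring,
      Complex.cos_antiperiodic.add_int_mul_eq]
    rcases Int.even_or_odd k with h | h
    · simp [(Int.natAbs_even.2 h).neg_one_pow, h.neg_one_zpow]
    · simp [(Int.natAbs_odd.2 h).neg_one_pow, h.neg_one_zpow]
  have hsix : Complex.cos (π / 6) = Real.sqrt 3 / 2 := by
    rw [show (π / 6 : ℂ) = ((π / 6 : ℝ) : ℂ) by push_cast; ring, ← Complex.ofReal_cos,
      Real.cos_pi_div_six]
    push_cast; ring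
  obtain ⟨k, hk⟩ : ∃ k, m = 1 + 6 * k ∨ m = 3 + 6 * k ∨ m = -1 + 6 * k := by
    obtain ⟨l, rfl⟩ := hm
    have : l % 3 = 0 ∨ l % 3 = 1 ∨ l % 3 = 2 := by omega
    rcases this with h | h | h
    · exact ⟨l / 3, by omega⟩
    · exact ⟨l / 3, by omega⟩
    · exact ⟨l / 3 + 1, by omega⟩
  rcases hk with rfl | rfl | rfl
  · rw [shiftedEta_add_six_mul, hcos]
    simp only [Int.cast_one, mul_one, hsix, etaTheta]
    field_simp
  · have h0 : shiftedEta 3 z = 0 := by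
      have h := shiftedEta_add_six (-3) z
      rw [shiftedEta_neg] at h
      norm_num at h
      linear_combination h / 2
    rw [shiftedEta_add_six_mul, hcos, h0]
    have : Complex.cos (π * ((3 : ℤ) : ℂ) / 6) = 0 := by
      rw [show (π * ((3 : ℤ) : ℂ) / 6 : ℂ) = π / 2 by push_cast; ring, Complex.cos_pi_div_two]
    rw [this]; simp
  · rw [shiftedEta_add_six_mul, hcos, shiftedEta_neg]
    have : Complex.cos (π * ((-1 : ℤ) : ℂ) / 6) = Real.sqrt 3 / 2 := by
      rw [show (π * ((-1 : ℤ) : ℂ) / 6 : ℂ) = -(π / 6) by push_cast; ring, Complex.cos_neg, hsix]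
    rw [this, etaTheta]
    field_simp

lemma etaTheta_eq_jacobiTheta₂ (z : ℂ) :
    etaTheta z = e z * jacobiTheta₂ (1 / 2 + 12 * z) (2 * (36 * z)) := by
  unfold etaTheta shiftedEta jacobiTheta₂ jacobiTheta₂_term
  rw [← tsum_mul_left]
  refine tsum_congr fun n => ?_
  rw [← e_intCast_div_two]
  unfold e
  rw [← Complex.exp_add, ← Complex.exp_add]
  congr 1
  push_cast
  ring

lemma jacobiTheta₂_add_int (u τ : ℂ) (n : ℤ) : jacobiTheta₂ (u + n) τ = jacobiTheta₂ u τ := by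
  have h : Function.Periodic (fun u => jacobiTheta₂ u τ) 1 := fun u => jacobiTheta₂_add_left u τ
  have := h.int_mul n u
  rw [← this]; simp

lemma jacobiTheta₂_add_int_mul (u τ : ℂ) (l : ℤ) :
    jacobiTheta₂ (u + l * τ) τ = cexp (-π * I * (l ^ 2 * τ + 2 * l * u)) * jacobiTheta₂ u τ := by
  unfold jacobiTheta₂ jacobiTheta₂_term
  rw [← tsum_mul_left, ← (Equiv.subRight l).tsum_eq]
  refine tsum_congr fun n => ?_
  rw [← Complex.exp_add]
  simp only [Equiv.subRight_apply]
  congr 1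
  push_cast
  ring

lemma shimuraSymbol_mul_sq {c d : ℤ} (k : ℤ) (hk : k ≠ 0) (hkd : IsCoprime k d) :
    shimuraSymbol (k ^ 2 * c) d = shimuraSymbol c d := by
  have hJ : jacobiSym (k ^ 2 * c) d.natAbs = jacobiSym c d.natAbs := by
    rw [jacobiSym.mul_left, jacobiSym.pow_left, jacobiSym.sq_one, one_mul]
    simpa [Int.gcd, Int.natAbs_abs] using Int.isCoprime_iff_gcd_eq_one.1 hkd
  unfold shimuraSymbol
  rw [hJ]
  have : k ^ 2 * c < 0 ↔ c < 0 := by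
    have : 0 < k ^ 2 := by positivity
    constructor
    · intro h; by_contra hc; push Not at hc; nlinarith
    · intro h; nlinarith
  simp only [this]

/-- `η(24 z)` has the theta multiplier on the matrices whose diagonal is `1` and whose lower left
entry is `0` modulo `3456`; there `ε_d = 1`. The law of `ϑ` is applied at the point `36 z`, for
the matrix `(a, 36 b; c / 36, d)`. -/
theorem etaTheta_moebius {a b c d : ℤ} (hdet : a * d - b * c = 1) (hc : 3456 ∣ c)
    (ha : 3456 ∣ a - 1) (hd : 3456 ∣ d - 1) {z : ℂ} (hz : 0 < z.im) :
    etaTheta ((a * z + b) / (c * z + d))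
      = shimuraSymbol c d * (c * z + d) ^ (1 / 2 : ℂ) * etaTheta z := by
  obtain ⟨t, rfl⟩ := hc
  obtain ⟨s, hs⟩ := ha
  obtain ⟨r, hr⟩ := hd
  have ha' : a = 1 + 3456 * s := by omega
  have hd' : d = 1 + 3456 * r := by omega
  have hj : ((3456 * t : ℤ) : ℂ) * z + d ≠ 0 := linear_ne_zero (Or.inr (by omega)) hz
  -- the elliptic variable is `j (1/2 + 12 w)`, where `w` is the transformed point; it differs from
  -- `1/2 + 12 z` by a period, see `e3`
  have hlaw := thetaLaw_of_four_dvd (a := a) (b := 36 * b) (c := 96 * t) (d := d)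
    (by linear_combination hdet) ⟨24 * t, by ring⟩ (36 * z) (by simpa using hz)
    ((3456 * t + 24 * a) / 2 * z + d / 2 + 12 * b)
  have hj1 : ((96 * t : ℤ) : ℂ) * (36 * z) + d = (3456 * t : ℤ) * z + d := by
    push_cast; ring
  have hm : thetaMultiplier (96 * t) d = shimuraSymbol (3456 * t) d := by
    unfold thetaMultiplier epsilon
    rw [if_pos (by omega), inv_one, mul_one, show 3456 * t = 6 ^ 2 * (96 * t) by ring,
      shimuraSymbol_mul_sq 6 (by norm_num) ⟨-576 * r, 1, by rw [hd']; ring⟩]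
  rw [hj1, hm] at hlaw
  rw [etaTheta_eq_jacobiTheta₂, etaTheta_eq_jacobiTheta₂]
  set j : ℂ := ((3456 * t : ℤ) : ℂ) * z + d with hjdef
  have e1 : ((3456 * t + 24 * a) / 2 * z + d / 2 + 12 * b : ℂ) / j
      = 1 / 2 + 12 * ((a * z + b) / j) := by
    field_simp
    rw [hjdef]
    push_cast
    ring
  have e2 : (2 : ℂ) * ((a * (36 * z) + (36 * b : ℤ)) / j) = 2 * (36 * ((a * z + b) / j)) := by
    push_cast; ring
  have e3 : ((3456 * t + 24 * a) / 2 * z + d / 2 + 12 * b : ℂ)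
      = (1 / 2 + 12 * z) + ((24 * t + 576 * s : ℤ) : ℂ) * (2 * (36 * z))
        + ((1728 * r + 12 * b : ℤ) : ℂ) := by
    rw [ha', hd']
    push_cast
    ring
  rw [e1, e2] at hlaw
  rw [hlaw]
  conv_lhs => rw [e3, jacobiTheta₂_add_int, jacobiTheta₂_add_int_mul]
  have hexp : e ((a * z + b) / j)
      * (cexp (π * I * ((96 * t : ℤ) / 2)
          * ((1 / 2 + 12 * z) + ((24 * t + 576 * s : ℤ) : ℂ) * (2 * (36 * z))
            + ((1728 * r + 12 * b : ℤ) : ℂ)) ^ 2 / j)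
        * cexp (-π * I * (((24 * t + 576 * s : ℤ) : ℂ) ^ 2 * (2 * (36 * z))
            + 2 * ((24 * t + 576 * s : ℤ) : ℂ) * (1 / 2 + 12 * z)))) = e z := by
    rw [← e3]
    unfold e
    rw [← Complex.exp_add, ← Complex.exp_add, Complex.exp_eq_exp_iff_exists_int]
    refine ⟨a * b + 6 * t * d + 288 * t * b - 12 * t - 288 * s, ?_⟩
    have hdet' : (a : ℂ) * d - b * (3456 * t) = 1 := by exact_mod_cast hdet
    have hj' : j = 3456 * t * z + d := by rw [hjdef]; push_cast; ring
    field_simp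
    rw [hj', ha']
    push_cast
    rw [ha'] at hdet'
    push_cast at hdet'
    linear_combination (-16) * ((1 + 3456 * (s : ℂ)) * z + b) * hdet'
  generalize jacobiTheta₂ (1 / 2 + 12 * z) (2 * (36 * z)) = J
  rw [← hexp]
  ring

/-! ### Partial fractions -/

open integerComplement in
/-- The partial fraction expansion `∑ 1/(w+n)² = π²/sin²(πw)` off the integers. -/
lemma hasSum_one_div_add_int_sq {w : ℂ} (hw : w ∈ integerComplement) :
    HasSum (fun n : ℤ => 1 / (w + n) ^ 2) (π ^ 2 / Complex.sin (π * w) ^ 2) := by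
  have hne : ∀ x ∈ integerComplement, ∀ n : ℤ, x + n ≠ 0 := fun x hx n =>
    integerComplement_add_ne_zero hx n
  obtain ⟨ε, hε, hball⟩ := Metric.isOpen_iff.1 Complex.isOpen_compl_range_intCast w hw
  have hlow : ∀ n : ℤ, ε ≤ ‖w + n‖ := by
    intro n
    by_contra hlt
    push Not at hlt
    have : ((-n : ℤ) : ℂ) ∈ Metric.ball w ε := by
      rw [Metric.mem_ball, dist_comm, dist_eq_norm]
      push_cast
      simpa using hlt
    exact hball this ⟨-n, rfl⟩
  have hs : Summable fun n : ℤ => 1 / ‖w + n‖ ^ 2 := by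
    have h1 := (Real.summable_one_div_int_add_rpow 0 2).2 (by norm_num)
    have h1 : Summable fun n : ℤ => 1 / |(n : ℝ)| ^ 2 := by
      convert h1 using 2 with n
      norm_cast
      simp
    have h2 : Summable fun n : ℤ => (1 + ‖w‖ / ε) ^ 2 * (1 / |(n : ℝ)| ^ 2) := h1.mul_left _
    refine Summable.of_norm_bounded_eventually h2 ?_
    have hfin : Set.Finite
        {n : ℤ | ¬ ‖1 / ‖w + n‖ ^ 2‖ ≤ (1 + ‖w‖ / ε) ^ 2 * (1 / |(n : ℝ)| ^ 2)} := by
      refine (Set.finite_singleton (0 : ℤ)).subset fun n hn => ?_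
      by_contra hn0
      apply hn
      have hn0' : 0 < |(n : ℝ)| := abs_pos.2 (by exact_mod_cast hn0)
      have hpos : 0 < ‖w + n‖ := hε.trans_le (hlow n)
      have hle : |(n : ℝ)| ≤ (1 + ‖w‖ / ε) * ‖w + n‖ := by
        have h3 : |(n : ℝ)| ≤ ‖w + n‖ + ‖w‖ := by
          have h4 := norm_sub_le (w + n) w
          rw [add_sub_cancel_left, Complex.norm_intCast] at h4
          exact h4
        have h4 : ‖w‖ ≤ ‖w‖ / ε * ‖w + n‖ := by
          rw [div_mul_eq_mul_div, le_div_iff₀ hε]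
          exact mul_le_mul_of_nonneg_left (hlow n) (norm_nonneg _)
        linarith
      rw [Real.norm_of_nonneg (by positivity), ← div_eq_mul_one_div,
        div_le_div_iff₀ (by positivity) (by positivity), one_mul, ← mul_pow]
      exact pow_le_pow_left₀ hn0'.le hle 2
    exact hfin
  have hsN₁ : Summable fun n : ℕ => 1 / ‖w + (n + 1 : ℕ)‖ ^ 2 :=
    (hs.comp_injective (i := fun n : ℕ => ((n + 1 : ℕ) : ℤ)) fun a b h => by simpa using h).congr
      fun n => by simp
  have hsN₂ : Summable fun n : ℕ => 1 / ‖w - (n + 1 : ℕ)‖ ^ 2 :=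
    (hs.comp_injective (i := fun n : ℕ => -((n + 1 : ℕ) : ℤ)) fun a b h => by simpa using h).congr
      fun n => by simp [sub_eq_add_neg]
  -- termwise differentiation of the cotangent series on a small ball
  set B := Metric.ball w (ε / 2) with hB
  have hBsub : B ⊆ integerComplement := (Metric.ball_subset_ball (by linarith)).trans hball
  have hlow' : ∀ x ∈ B, ∀ n : ℤ, ‖w + n‖ / 2 ≤ ‖x + n‖ := by
    intro x hx n
    rw [hB, Metric.mem_ball, dist_comm, dist_eq_norm] at hx
    have := norm_sub_le (w + n - (x + n)) (-(x + n))
    have h2 : ‖w + n‖ ≤ ‖w - x‖ + ‖x + n‖ := by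
      calc ‖w + n‖ = ‖(w - x) + (x + n)‖ := by ring_nf
        _ ≤ _ := norm_add_le _ _
    linarith [hlow n]
  have hbd : ∀ x ∈ B, ∀ n : ℤ, ‖1 / (x + n) ^ 2‖ ≤ 4 * (1 / ‖w + n‖ ^ 2) := by
    intro x hx n
    have h1 := hlow' x hx n
    have hpos : 0 < ‖w + n‖ := hε.trans_le (hlow n)
    have hpos' : 0 < ‖x + n‖ := by linarith
    rw [norm_div, norm_one, norm_pow, ← div_eq_mul_one_div,
      div_le_div_iff₀ (by positivity) (by positivity)]
    nlinarith
  have hderiv := hasDerivAt_tsum_of_isPreconnected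
    (g := fun (n : ℕ) (x : ℂ) => 1 / (x - (n + 1)) + 1 / (x + (n + 1)))
    (g' := fun (n : ℕ) (x : ℂ) => -(1 / (x - (n + 1)) ^ 2) + -(1 / (x + (n + 1)) ^ 2))
    (u := fun n : ℕ => 4 * (1 / ‖w - (n + 1 : ℕ)‖ ^ 2) + 4 * (1 / ‖w + (n + 1 : ℕ)‖ ^ 2))
    (t := B) (y₀ := w) (y := w) ((hsN₂.mul_left 4).add (hsN₁.mul_left 4)) Metric.isOpen_ball
    (convex_ball _ _).isPreconnected
    (by
      intro n x hx
      have h1 := hne x (hBsub hx) (-(n + 1))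
      have h2 := hne x (hBsub hx) (n + 1)
      push_cast at h1 h2
      rw [← sub_eq_add_neg] at h1
      refine HasDerivAt.add ?_ ?_
      · simpa [one_div, neg_div] using ((hasDerivAt_id x).sub_const ((n : ℂ) + 1)).fun_inv h1
      · simpa [one_div, neg_div] using ((hasDerivAt_id x).add_const ((n : ℂ) + 1)).fun_inv h2)
    (by
      intro n x hx
      refine (norm_add_le _ _).trans (add_le_add ?_ ?_)
      · have := hbd x hx (-(n + 1 : ℕ))
        rw [norm_neg]
        push_cast at this ⊢
        rwa [← sub_eq_add_neg, ← sub_eq_add_neg] at this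
      · have := hbd x hx (n + 1 : ℕ)
        rw [norm_neg]
        push_cast at this ⊢
        exact this)
    (Metric.mem_ball_self (by linarith))
    (by
      have := summable_cotTerm hw
      simpa [cotTerm] using this)
    (Metric.mem_ball_self (by linarith))
  have hsin : Complex.sin (π * w) ≠ 0 := sin_pi_mul_ne_zero hw
  have hw0 : w ≠ 0 := by simpa using hne w hw 0
  have hcot : HasDerivAt (fun x : ℂ => π * Complex.cot (π * x) - 1 / x)
      (-(π ^ 2 / Complex.sin (π * w) ^ 2) + 1 / w ^ 2) w := by
    have hlin : HasDerivAt (fun x : ℂ => π * x) π w := by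
      simpa using (hasDerivAt_id w).const_mul (π : ℂ)
    have hc := (hlin.ccos.div hlin.csin hsin).const_mul (π : ℂ)
    have hi : HasDerivAt (fun x : ℂ => 1 / x) (-(1 / w ^ 2)) w := by
      simpa [one_div] using hasDerivAt_inv hw0
    refine (hc.sub hi).congr_deriv ?_
    have := Complex.sin_sq_add_cos_sq (π * w)
    field_simp
    linear_combination (-(π : ℂ) ^ 2 * w ^ 2) * this
  have heq : (fun x : ℂ => ∑' n : ℕ, (1 / (x - (n + 1)) + 1 / (x + (n + 1))))
      =ᶠ[nhds w] fun x : ℂ => π * Complex.cot (π * x) - 1 / x := by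
    filter_upwards [Complex.isOpen_compl_range_intCast.mem_nhds hw] with x hx
    exact (cot_series_rep' hx).symm
  have hval := (hderiv.congr_of_eventuallyEq heq.symm).unique hcot
  have hsC₁ : Summable fun n : ℕ => 1 / (w + ((n : ℂ) + 1)) ^ 2 := by
    refine Summable.of_norm ?_
    simpa using hsN₁
  have hsC₂ : Summable fun n : ℕ => 1 / (w - ((n : ℂ) + 1)) ^ 2 := by
    refine Summable.of_norm ?_
    simpa using hsN₂
  rw [hsC₂.neg.tsum_add hsC₁.neg, tsum_neg, tsum_neg] at hval
  have hpos : HasSum (fun n : ℕ => 1 / (w + ((n : ℤ) : ℂ)) ^ 2)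
      (1 / w ^ 2 + ∑' n : ℕ, 1 / (w + ((n : ℂ) + 1)) ^ 2) := by
    have h := hsC₁.hasSum
    have h2 := (hasSum_nat_add_iff (f := fun n : ℕ => 1 / (w + ((n : ℤ) : ℂ)) ^ 2)
      (g := ∑' n : ℕ, 1 / (w + ((n : ℂ) + 1)) ^ 2) 1).1 (by simpa using h)
    simpa [add_comm] using h2
  have hneg : HasSum (fun n : ℕ => 1 / (w + ((-(n + 1 : ℤ) : ℤ) : ℂ)) ^ 2)
      (∑' n : ℕ, 1 / (w - ((n : ℂ) + 1)) ^ 2) := by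
    refine hsC₂.hasSum.congr_fun fun n => ?_
    push_cast
    ring
  have h := HasSum.of_nat_of_neg_add_one (f := fun n : ℤ => 1 / (w + n) ^ 2) hpos hneg
  convert h using 1
  linear_combination hval

lemma hasSum_int_even_add_odd {f : ℤ → ℂ} {a b : ℂ} (he : HasSum (fun n : ℤ => f (2 * n)) a)
    (ho : HasSum (fun n : ℤ => f (2 * n + 1)) b) : HasSum f (a + b) := by
  have hinj : Function.Injective fun n : ℤ => 2 * n := mul_right_injective₀ two_ne_zero
  have ho' := ((add_left_injective (1 : ℤ)).comp hinj).hasSum_range_iff.2 ho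
  refine (hinj.hasSum_range_iff.2 he).add_isCompl ?_ ho'
  have h₁ : Set.range (fun n : ℤ => 2 * n) = {n | Even n} := by
    ext n
    simp only [Set.mem_range, Set.mem_ofPred_eq, even_iff_exists_two_mul, eq_comm]
  have h₂ : Set.range ((fun x : ℤ => x + 1) ∘ fun n : ℤ => 2 * n) = {n | Odd n} := by
    ext n
    simp only [Set.mem_range, Set.mem_ofPred_eq, Odd, Function.comp, eq_comm]
  rw [h₁, h₂]
  exact Int.isCompl_even_odd

/-- The alternating partial fraction expansion. -/
lemma hasSum_neg_one_pow_div_add_int_sq {w : ℂ} (hw : w ∈ integerComplement) :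
    HasSum (fun n : ℤ => (-1 : ℂ) ^ n * (1 / (w + n) ^ 2))
      (π ^ 2 * Complex.cos (π * w) / Complex.sin (π * w) ^ 2) := by
  have h1 : w / 2 ∈ integerComplement := by
    rintro ⟨n, hn⟩
    exact hw ⟨2 * n, by push_cast; rw [hn]; ring⟩
  have h2 : (w + 1) / 2 ∈ integerComplement := by
    rintro ⟨n, hn⟩
    exact hw ⟨2 * n - 1, by push_cast; rw [hn]; ring⟩
  have heven : HasSum (fun n : ℤ => (-1 : ℂ) ^ (2 * n) * (1 / (w + (2 * n : ℤ)) ^ 2))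
      (1 / 4 * (π ^ 2 / Complex.sin (π * (w / 2)) ^ 2)) := by
    refine ((hasSum_one_div_add_int_sq h1).mul_left (1 / 4)).congr_fun fun n => ?_
    rw [zpow_mul]
    rw [show w + ((2 * n : ℤ) : ℂ) = 2 * (w / 2 + n) by push_cast; ring, mul_pow]
    norm_num
    ring
  have hodd : HasSum (fun n : ℤ => (-1 : ℂ) ^ (2 * n + 1) * (1 / (w + (2 * n + 1 : ℤ)) ^ 2))
      (-(1 / 4 * (π ^ 2 / Complex.sin (π * ((w + 1) / 2)) ^ 2))) := by
    refine ((hasSum_one_div_add_int_sq h2).mul_left (1 / 4)).neg.congr_fun fun n => ?_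
    rw [zpow_add₀ (by norm_num), zpow_mul]
    rw [show w + ((2 * n + 1 : ℤ) : ℂ) = 2 * ((w + 1) / 2 + n) by push_cast; ring, mul_pow]
    norm_num
    ring
  have h := hasSum_int_even_add_odd (f := fun n : ℤ => (-1 : ℂ) ^ n * (1 / (w + n) ^ 2))
    heven hodd
  convert h using 1
  have hs1 : Complex.sin (π * (w / 2)) ≠ 0 := sin_pi_mul_ne_zero h1
  have hs2 : Complex.sin (π * ((w + 1) / 2)) ≠ 0 := sin_pi_mul_ne_zero h2
  have e1 : Complex.sin (π * ((w + 1) / 2)) = Complex.cos (π * (w / 2)) := by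
    rw [show (π * ((w + 1) / 2) : ℂ) = π * (w / 2) + π / 2 by ring, Complex.sin_add_pi_div_two]
  rw [e1] at hs2 ⊢
  rw [show (π * w : ℂ) = 2 * (π * (w / 2)) by ring, Complex.sin_two_mul, Complex.cos_two_mul]
  have h1 := Complex.sin_sq_add_cos_sq (π * (w / 2))
  generalize Complex.sin (π * (w / 2)) = S at hs1 h1 ⊢
  generalize Complex.cos (π * (w / 2)) = C at hs2 h1 ⊢
  field_simp
  linear_combination 4 * h1

/-! ### Poisson summation -/

/-- Poisson summation for the alternating Gaussian sum; the dual frequencies are half-integral. -/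
lemma tsum_neg_one_pow_gaussian {r : ℂ} (hr : 0 < r.re) (w : ℂ) :
    ∑' n : ℤ, (-1 : ℂ) ^ n * cexp (-π * (w + n) ^ 2 / (8 * r))
      = (8 * r) ^ (1 / 2 : ℂ)
        * ∑' k : ℤ, cexp (-2 * π * (2 * k + 1) ^ 2 * r) * e ((2 * k + 1) * w / 2) := by
  have hr0 : r ≠ 0 := by rintro rfl; simp at hr
  have h := Complex.tsum_exp_neg_quadratic (a := 8 * r) (by simpa using hr) (I * w - 4 * r)
  have hL : ∀ k : ℤ, cexp (-2 * π * (2 * k + 1) ^ 2 * r) * e ((2 * k + 1) * w / 2)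
      = cexp (π * I * w - 2 * π * r)
        * cexp (-π * (8 * r) * k ^ 2 + 2 * π * (I * w - 4 * r) * k) := by
    intro k
    unfold e
    rw [← Complex.exp_add, ← Complex.exp_add]
    congr 1
    ring
  have hR : ∀ n : ℤ, cexp (-π / (8 * r) * ((-n : ℤ) + I * (I * w - 4 * r)) ^ 2)
      = cexp (2 * π * r - π * I * w) * ((-1) ^ n * cexp (-π * (w + n) ^ 2 / (8 * r))) := by
    intro n
    have h1 : ((-1 : ℂ) ^ n) = cexp (-(n * (π * I))) := by
      rw [Complex.exp_neg, Complex.exp_int_mul, exp_pi_mul_I, ← inv_zpow, inv_neg, inv_one]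
    rw [h1, ← Complex.exp_add, ← Complex.exp_add]
    congr 1
    have hI : I ^ 2 = -1 := Complex.I_sq
    have hI3 : I * (I * w - 4 * r) = -w - 4 * I * r := by linear_combination w * hI
    rw [hI3]
    field_simp
    push_cast
    linear_combination (-16 * r ^ 2) * hI
  simp_rw [hL]
  rw [tsum_mul_left, h, ← (Equiv.neg ℤ).tsum_eq
    (fun n : ℤ => cexp (-π / (8 * r) * (n + I * (I * w - 4 * r)) ^ 2))]
  simp only [Equiv.neg_apply]
  simp_rw [hR]
  rw [tsum_mul_left]
  have h8 : (8 * r) ^ (1 / 2 : ℂ) ≠ 0 := by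
    rw [Ne, cpow_eq_zero_iff]
    have : 8 * r ≠ 0 := by simpa using hr0
    tauto
  have hcancel : cexp (π * I * w - 2 * π * r) * cexp (2 * π * r - π * I * w) = 1 := by
    rw [← Complex.exp_add]; simp
  generalize (∑' n : ℤ, (-1 : ℂ) ^ n * cexp (-π * (w + n) ^ 2 / (8 * r))) = S
  generalize cexp (π * I * w - 2 * π * r) = E₁ at hcancel ⊢
  generalize cexp (2 * π * r - π * I * w) = E₂ at hcancel ⊢
  rw [one_div ((8 * r) ^ (1 / 2 : ℂ))]
  linear_combination (-(E₁ * E₂ * S)) * mul_inv_cancel₀ h8 - S * hcancel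

/-! ### The incomplete gamma factor -/

/-- `∫₀^∞ exp(-2 π m² t) (2 y + t)^(-3/2) dt`, which is `exp(4 π m² y)` times an incomplete gamma
function `Γ(-1/2, 4 π m² y)`, up to a power of `m`. -/
noncomputable def gammaFactor (m : ℤ) (y : ℝ) : ℝ :=
  ∫ t in Set.Ioi (0 : ℝ), Real.exp (-2 * π * m ^ 2 * t) * (2 * y + t) ^ (-(3 / 2) : ℝ)

lemma integrableOn_add_rpow {y : ℝ} (hy : 0 < y) {s : ℝ} (hs : s < -1) :
    IntegrableOn (fun t : ℝ => (2 * y + t) ^ s) (Set.Ioi 0) := by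
  have h := integrableOn_add_rpow_Ioi_of_lt (c := 0) (m := 2 * y) hs (by linarith)
  simpa [add_comm] using h

lemma integrableOn_gammaFactor (m : ℤ) {y : ℝ} (hy : 0 < y) :
    IntegrableOn (fun t : ℝ => Real.exp (-2 * π * m ^ 2 * t) * (2 * y + t) ^ (-(3 / 2) : ℝ))
      (Set.Ioi 0) := by
  refine Integrable.mono' (integrableOn_add_rpow hy (by norm_num : (-(3 / 2) : ℝ) < -1)) ?_ ?_
  · refine ContinuousOn.aestronglyMeasurable ?_ measurableSet_Ioi
    refine ContinuousOn.mul (by fun_prop) ?_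
    refine ContinuousOn.rpow_const (by fun_prop) fun t ht => Or.inl ?_
    have : (0 : ℝ) < t := ht
    positivity
  · refine (ae_restrict_iff' measurableSet_Ioi).2 (Filter.Eventually.of_forall fun t ht => ?_)
    have ht : (0 : ℝ) < t := ht
    rw [Real.norm_of_nonneg (by positivity)]
    refine mul_le_of_le_one_left (by positivity) ?_
    rw [Real.exp_le_one_iff]
    have : 0 ≤ 2 * π * (m : ℝ) ^ 2 * t := by positivity
    linarith

lemma gammaFactor_nonneg (m : ℤ) {y : ℝ} (hy : 0 < y) : 0 ≤ gammaFactor m y := by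
  refine setIntegral_nonneg measurableSet_Ioi fun t ht => ?_
  have ht : (0 : ℝ) < t := ht
  positivity

lemma gammaFactor_le (m : ℤ) {y : ℝ} (hy : 0 < y) :
    gammaFactor m y ≤ 2 * (2 * y) ^ (-(1 / 2) : ℝ) := by
  have h1 : ∫ t in Set.Ioi (0 : ℝ), (2 * y + t) ^ (-(3 / 2) : ℝ)
      = 2 * (2 * y) ^ (-(1 / 2) : ℝ) := by
    have h := integral_Ioi_of_hasDerivAt_of_tendsto' (a := (0 : ℝ)) (m := 0)
      (f := fun t : ℝ => -2 * (2 * y + t) ^ (-(1 / 2) : ℝ))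
      (f' := fun t : ℝ => (2 * y + t) ^ (-(3 / 2) : ℝ))
      (fun t ht => by
        have ht : (0 : ℝ) ≤ t := ht
        have h1 : HasDerivAt (fun t : ℝ => 2 * y + t) 1 t := by
          simpa using (hasDerivAt_id t).const_add (2 * y)
        have h2 := (h1.rpow_const (p := -(1 / 2)) (Or.inl (by positivity))).const_mul (-2)
        refine h2.congr_deriv ?_
        norm_num
        ring)
      (integrableOn_add_rpow hy (by norm_num))
      (by
        have h1 := (tendsto_rpow_neg_atTop (y := 1 / 2) (by norm_num)).comp
          (Filter.tendsto_atTop_add_const_left Filter.atTop (2 * y) Filter.tendsto_id)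
        simpa using h1.const_mul (-2))
    rw [h]
    simp
  rw [← h1]
  refine setIntegral_mono_on (integrableOn_gammaFactor m hy)
    (integrableOn_add_rpow hy (by norm_num)) measurableSet_Ioi fun t ht => ?_
  have ht : (0 : ℝ) < t := ht
  refine mul_le_of_le_one_left (by positivity) ?_
  rw [Real.exp_le_one_iff]
  have : 0 ≤ 2 * π * (m : ℝ) ^ 2 * t := by positivity
  linarith

/-! ### Summability of Gaussians over the integers -/

lemma summable_exp_neg_mul_abs {α : ℝ} (hα : 0 < α) :
    Summable fun n : ℤ => Real.exp (-α * |(n : ℝ)|) := by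
  have h : Summable fun n : ℕ => Real.exp (-α * n) := by
    have := Real.summable_exp_nat_mul_iff (a := -α) |>.2 (by linarith)
    simpa [mul_comm] using this
  refine Summable.of_nat_of_neg ?_ ?_
  · simpa using h
  · simpa using h

/-- A Gaussian dominates a linear exponential. -/
lemma summable_exp_linear_sub_sq {α : ℝ} (hα : 0 < α) (β : ℝ) :
    Summable fun n : ℤ => Real.exp (β * |(n : ℝ)| - α * (n : ℝ) ^ 2) := by
  refine Summable.of_nonneg_of_le (fun n => (Real.exp_pos _).le) (fun n => ?_)
    ((summable_exp_neg_mul_abs one_pos).mul_left (Real.exp ((β + 1) ^ 2 / (4 * α))))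
  rw [← Real.exp_add]
  apply Real.exp_le_exp.2
  have : (β + 1) * |(n : ℝ)| - α * |(n : ℝ)| ^ 2 ≤ (β + 1) ^ 2 / (4 * α) := by
    rw [le_div_iff₀ (by positivity)]
    nlinarith [sq_nonneg (2 * α * |(n : ℝ)| - (β + 1))]
  rw [sq_abs] at this
  linarith

/-! ### The row sums -/

/-- The integrand `(π / (8 r²)) exp(-π W² / (8 r))` at `r = 2 y + t`, whose primitive is
`exp(-π W² / (8 r)) / W²`. -/
noncomputable def gaussianKernel (y : ℝ) (W : ℂ) (t : ℝ) : ℂ :=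
  (π / (8 * (2 * y + t) ^ 2) : ℝ) * cexp (-π * W ^ 2 / (8 * ((2 * y + t : ℝ) : ℂ)))

lemma norm_gaussianKernel {y t : ℝ} (W : ℂ) :
    ‖gaussianKernel y W t‖ = π / (8 * (2 * y + t) ^ 2)
      * Real.exp (-π * (W.re ^ 2 - W.im ^ 2) / (8 * (2 * y + t))) := by
  unfold gaussianKernel
  rw [norm_mul, Complex.norm_real, Real.norm_of_nonneg (by positivity), Complex.norm_exp]
  congr 2
  have : -(π : ℂ) * W ^ 2 / (8 * ((2 * y + t : ℝ) : ℂ))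
      = ((-π / (8 * (2 * y + t)) : ℝ) : ℂ) * W ^ 2 := by
    push_cast; ring
  rw [this, re_ofReal_mul, pow_two, mul_re]
  ring

lemma continuousOn_gaussianKernel {y : ℝ} (hy : 0 < y) (W : ℂ) :
    ContinuousOn (gaussianKernel y W) (Set.Ioi 0) := by
  unfold gaussianKernel
  have h1 : ∀ t ∈ Set.Ioi (0 : ℝ), 8 * (2 * y + t) ^ 2 ≠ 0 := fun t ht => by
    have ht : (0 : ℝ) < t := ht
    positivity
  have h2 : ∀ t ∈ Set.Ioi (0 : ℝ), (8 : ℂ) * ((2 * y + t : ℝ) : ℂ) ≠ 0 := fun t ht => by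
    have ht : (0 : ℝ) < t := ht
    have : 8 * (2 * y + t) ≠ 0 := by positivity
    exact_mod_cast this
  refine ContinuousOn.mul ?_ ?_
  · exact Complex.continuous_ofReal.comp_continuousOn
      (ContinuousOn.div continuousOn_const (by fun_prop) h1)
  · exact Complex.continuous_exp.comp_continuousOn
      (ContinuousOn.div continuousOn_const (by fun_prop) h2)

lemma norm_gaussianKernel_le {y t : ℝ} (hy : 0 < y) (ht : 0 < t) (W : ℂ) :
    ‖gaussianKernel y W t‖ ≤ Real.exp (π * W.im ^ 2 / (16 * y)) *
      (π / (8 * (2 * y + t) ^ 2) * Real.exp (-π * W.re ^ 2 / (8 * (2 * y + t)))) := by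
  rw [norm_gaussianKernel, mul_left_comm]
  refine mul_le_mul_of_nonneg_left ?_ (by positivity)
  rw [← Real.exp_add]
  apply Real.exp_le_exp.2
  have h1 : π * W.im ^ 2 / (8 * (2 * y + t)) ≤ π * W.im ^ 2 / (16 * y) := by
    apply div_le_div_of_nonneg_left (by positivity) (by positivity) (by linarith)
  have h2 : -π * (W.re ^ 2 - W.im ^ 2) / (8 * (2 * y + t))
      = -π * W.re ^ 2 / (8 * (2 * y + t)) + π * W.im ^ 2 / (8 * (2 * y + t)) := by ring
  linarith

lemma integrableOn_const_div_sq {y : ℝ} (hy : 0 < y) :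
    IntegrableOn (fun t : ℝ => π / (8 * (2 * y + t) ^ 2)) (Set.Ioi 0) := by
  have h := (integrableOn_add_rpow hy (s := -2) (by norm_num)).const_mul (π / 8)
  refine IntegrableOn.congr_fun h (fun t ht => ?_) measurableSet_Ioi
  have ht : (0 : ℝ) < t := ht
  have h2 : (2 * y + t) ^ (-2 : ℝ) = ((2 * y + t) ^ 2)⁻¹ := by
    rw [Real.rpow_neg (by positivity)]
    norm_cast
  simp only [h2]
  field_simp

lemma integrableOn_gaussianKernel {y : ℝ} (hy : 0 < y) (W : ℂ) :
    IntegrableOn (gaussianKernel y W) (Set.Ioi 0) := by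
  refine Integrable.mono' ((integrableOn_const_div_sq hy).const_mul
    (Real.exp (π * W.im ^ 2 / (16 * y))))
    ((continuousOn_gaussianKernel hy W).aestronglyMeasurable measurableSet_Ioi) ?_
  refine (ae_restrict_iff' measurableSet_Ioi).2 (Filter.Eventually.of_forall fun t ht => ?_)
  have ht : (0 : ℝ) < t := ht
  refine (norm_gaussianKernel_le hy ht W).trans ?_
  refine mul_le_mul_of_nonneg_left (mul_le_of_le_one_right (by positivity) ?_) (by positivity)
  rw [Real.exp_le_one_iff, neg_mul, neg_div, neg_nonpos]
  positivity

lemma integral_gaussianKernel {y : ℝ} (hy : 0 < y) {W : ℂ} (hW : W ≠ 0) :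
    ∫ t in Set.Ioi (0 : ℝ), gaussianKernel y W t
      = 1 / W ^ 2 - cexp (-π * W ^ 2 / (16 * y)) / W ^ 2 := by
  have h := integral_Ioi_of_hasDerivAt_of_tendsto' (a := (0 : ℝ)) (m := 1 / W ^ 2)
    (f := fun t : ℝ => cexp (-π * W ^ 2 / (8 * ((2 * y + t : ℝ) : ℂ))) / W ^ 2)
    (f' := gaussianKernel y W)
    (fun t ht => by
      have ht : (0 : ℝ) ≤ t := ht
      have hr : ((2 * y + t : ℝ) : ℂ) ≠ 0 := by
        have : 2 * y + t ≠ 0 := by positivity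
        exact_mod_cast this
      have h1 : HasDerivAt (fun t : ℝ => ((2 * y + t : ℝ) : ℂ)) 1 t := by
        have := ((hasDerivAt_id t).const_add (2 * y)).ofReal_comp
        simpa using this
      have h2 := ((((h1.const_mul 8).fun_inv (by simpa using hr)).const_mul
        (-π * W ^ 2)).cexp).div_const (W ^ 2)
      simp only [← div_eq_mul_inv] at h2
      refine h2.congr_deriv ?_
      unfold gaussianKernel
      push_cast at hr ⊢
      field_simp)
    (integrableOn_gaussianKernel hy W)
    (by
      have h1 : Filter.Tendsto (fun t : ℝ => ((2 * y + t : ℝ)⁻¹ : ℝ)) Filter.atTop (nhds 0) :=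
        tendsto_inv_atTop_zero.comp
          (Filter.tendsto_atTop_add_const_left Filter.atTop (2 * y) Filter.tendsto_id)
      have h2 : Filter.Tendsto (fun t : ℝ => -π * W ^ 2 / 8 * (((2 * y + t : ℝ)⁻¹ : ℝ) : ℂ))
          Filter.atTop (nhds (-π * W ^ 2 / 8 * ((0 : ℝ) : ℂ))) :=
        ((Complex.continuous_ofReal.tendsto 0).comp h1).const_mul _
      rw [ofReal_zero, mul_zero] at h2
      have h3 := ((Complex.continuous_exp.tendsto 0).comp h2).div_const (W ^ 2)
      rw [Complex.exp_zero] at h3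
      refine h3.congr fun t => ?_
      simp only [Function.comp]
      congr 2
      push_cast
      rw [div_mul_eq_mul_div, ← div_eq_mul_inv, div_div]
      ring_nf)
  rw [h]
  simp only [add_zero]
  congr 3
  push_cast
  ring

lemma integral_norm_gaussianKernel_le {y : ℝ} (hy : 0 < y) {W : ℂ} (hW : W.re ≠ 0) :
    ∫ t in Set.Ioi (0 : ℝ), ‖gaussianKernel y W t‖
      ≤ Real.exp (π * W.im ^ 2 / (16 * y)) * (1 / W.re ^ 2) := by
  have hreal : ∀ t : ℝ, gaussianKernel y (W.re : ℂ) t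
      = ((π / (8 * (2 * y + t) ^ 2) * Real.exp (-π * W.re ^ 2 / (8 * (2 * y + t))) : ℝ) : ℂ) := by
    intro t
    unfold gaussianKernel
    push_cast
    rfl
  have h1 := integral_gaussianKernel hy (W := (W.re : ℂ)) (by exact_mod_cast hW)
  have h2 := integrableOn_gaussianKernel hy (W.re : ℂ)
  simp_rw [hreal] at h1
  rw [integral_complex_ofReal] at h1
  have h3 : ∫ t in Set.Ioi (0 : ℝ),
      π / (8 * (2 * y + t) ^ 2) * Real.exp (-π * W.re ^ 2 / (8 * (2 * y + t)))
      = 1 / W.re ^ 2 - Real.exp (-π * W.re ^ 2 / (16 * y)) / W.re ^ 2 := by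
    exact_mod_cast h1
  have hint : IntegrableOn (fun t : ℝ =>
      π / (8 * (2 * y + t) ^ 2) * Real.exp (-π * W.re ^ 2 / (8 * (2 * y + t)))) (Set.Ioi 0) := by
    have := h2.norm
    refine IntegrableOn.congr_fun this (fun t ht => ?_) measurableSet_Ioi
    have ht : (0 : ℝ) < t := ht
    simp only [hreal]
    rw [Complex.norm_real, Real.norm_of_nonneg (by positivity)]
  calc ∫ t in Set.Ioi (0 : ℝ), ‖gaussianKernel y W t‖
      ≤ ∫ t in Set.Ioi (0 : ℝ), Real.exp (π * W.im ^ 2 / (16 * y)) *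
        (π / (8 * (2 * y + t) ^ 2) * Real.exp (-π * W.re ^ 2 / (8 * (2 * y + t)))) :=
        setIntegral_mono_on (integrableOn_gaussianKernel hy W).norm (hint.const_mul _)
          measurableSet_Ioi fun t ht => norm_gaussianKernel_le hy ht W
    _ = Real.exp (π * W.im ^ 2 / (16 * y)) *
        (1 / W.re ^ 2 - Real.exp (-π * W.re ^ 2 / (16 * y)) / W.re ^ 2) := by
        rw [integral_const_mul, h3]
    _ ≤ _ := by
        refine mul_le_mul_of_nonneg_left ?_ (by positivity)
        have : 0 ≤ Real.exp (-π * W.re ^ 2 / (16 * y)) / W.re ^ 2 := by positivity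
        linarith

lemma summable_integral_norm_gaussianKernel {y : ℝ} (hy : 0 < y) (w : ℂ) :
    Summable fun n : ℤ => ∫ t in Set.Ioi (0 : ℝ), ‖gaussianKernel y (w + n) t‖ := by
  have h1 := (Real.summable_one_div_int_add_rpow w.re 2).2 (by norm_num)
  have h2 := h1.mul_left (Real.exp (π * w.im ^ 2 / (16 * y)))
  refine Summable.of_norm_bounded_eventually h2 ?_
  have hfin : Set.Finite {n : ℤ | ¬ ‖∫ t in Set.Ioi (0 : ℝ), ‖gaussianKernel y (w + n) t‖‖
      ≤ Real.exp (π * w.im ^ 2 / (16 * y)) * (1 / |(n : ℝ) + w.re| ^ (2 : ℝ))} := by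
    refine (Set.finite_singleton ⌊-w.re⌋).subset fun n hn => ?_
    by_contra hne
    apply hn
    have hre : (w + n).re ≠ 0 := by
      intro h0
      apply hne
      have : -w.re = n := by
        simp at h0
        linarith
      rw [Set.mem_singleton_iff, this, Int.floor_intCast]
    have h3 := integral_norm_gaussianKernel_le hy hre
    rw [Real.norm_of_nonneg (integral_nonneg fun _ => norm_nonneg _)]
    refine h3.trans (le_of_eq ?_)
    have : |(n : ℝ) + w.re| ^ (2 : ℝ) = (w + n).re ^ 2 := by
      norm_cast
      rw [sq_abs]
      simp
      ring
    rw [this]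
    simp
  exact hfin

lemma cpow_half_eight_mul {r : ℝ} (hr : 0 < r) :
    (8 * (r : ℂ)) ^ (1 / 2 : ℂ) = ((Real.sqrt 8 * Real.sqrt r : ℝ) : ℂ) := by
  have h : (8 * (r : ℂ)) = ((8 * r : ℝ) : ℂ) := by push_cast; ring
  have h2 : (1 / 2 : ℂ) = ((1 / 2 : ℝ) : ℂ) := by push_cast; ring
  rw [h, h2, ← Complex.ofReal_cpow (by positivity), ← Real.sqrt_eq_rpow,
    Real.sqrt_mul (by norm_num)]

/-- The row sums of the lattice sum: subtracting the Gaussian tail turns it into a partial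
fraction, and Poisson summation under the integral sign evaluates the tail. -/
theorem tsum_row {y : ℝ} (hy : 0 < y) {w : ℂ} (hw : w ∈ integerComplement) :
    ∑' n : ℤ, (-1 : ℂ) ^ n * (cexp (-π * (w + n) ^ 2 / (16 * y)) / (w + n) ^ 2)
      = π ^ 2 * Complex.cos (π * w) / Complex.sin (π * w) ^ 2
        - π / Real.sqrt 8 * ∑' k : ℤ, e ((2 * k + 1) * w / 2)
          * (Real.exp (-4 * π * (2 * k + 1) ^ 2 * y) * gammaFactor (2 * k + 1) y : ℝ) := by
  have hne : ∀ n : ℤ, w + n ≠ 0 := fun n => integerComplement_add_ne_zero hw n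
  have hA := hasSum_neg_one_pow_div_add_int_sq hw
  have hB := hasSum_integral_of_summable_integral_norm (μ := volume.restrict (Set.Ioi (0 : ℝ)))
    (F := fun (n : ℤ) (t : ℝ) => (-1 : ℂ) ^ n * gaussianKernel y (w + n) t)
    (fun n => (integrableOn_gaussianKernel hy (w + n)).const_mul _)
    (by
      simp_rw [norm_mul, norm_neg_one_zpow, one_mul]
      exact summable_integral_norm_gaussianKernel hy w)
  have hAB := hA.sub hB
  have hterm : ∀ n : ℤ, (-1 : ℂ) ^ n * (1 / (w + n) ^ 2)
      - ∫ t in Set.Ioi (0 : ℝ), (-1 : ℂ) ^ n * gaussianKernel y (w + n) t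
      = (-1 : ℂ) ^ n * (cexp (-π * (w + n) ^ 2 / (16 * y)) / (w + n) ^ 2) := by
    intro n
    rw [integral_const_mul, integral_gaussianKernel hy (hne n)]
    ring
  simp_rw [hterm] at hAB
  rw [hAB.tsum_eq]
  congr 1
  -- the dual expansion of the integrand
  set c : ℤ → ℝ → ℝ := fun k t =>
    Real.exp (-4 * π * (2 * k + 1) ^ 2 * y)
      * (Real.exp (-2 * π * ((2 * k + 1 : ℤ) : ℝ) ^ 2 * t) * (2 * y + t) ^ (-(3 / 2) : ℝ)) with hc
  have hpois : ∀ t ∈ Set.Ioi (0 : ℝ), ∑' n : ℤ, (-1 : ℂ) ^ n * gaussianKernel y (w + n) t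
      = ∑' k : ℤ, π / Real.sqrt 8 * (e ((2 * k + 1) * w / 2) * (c k t : ℝ)) := by
    intro t ht
    have ht : (0 : ℝ) < t := ht
    have hr : 0 < 2 * y + t := by positivity
    have h := tsum_neg_one_pow_gaussian (r := ((2 * y + t : ℝ) : ℂ)) (by simpa using hr) w
    have hk : ∀ n : ℤ, (-1 : ℂ) ^ n * gaussianKernel y (w + n) t
        = (π / (8 * (2 * y + t) ^ 2) : ℝ) * ((-1 : ℂ) ^ n
          * cexp (-π * (w + n) ^ 2 / (8 * ((2 * y + t : ℝ) : ℂ)))) := by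
      intro n
      rw [gaussianKernel, mul_left_comm]
    simp_rw [hk]
    rw [tsum_mul_left, h, ← tsum_mul_left, ← tsum_mul_left, cpow_half_eight_mul hr]
    refine tsum_congr fun k => ?_
    have hexp : cexp (-2 * π * (2 * k + 1) ^ 2 * ((2 * y + t : ℝ) : ℂ))
        = ((Real.exp (-4 * π * (2 * k + 1) ^ 2 * y)
          * Real.exp (-2 * π * ((2 * k + 1 : ℤ) : ℝ) ^ 2 * t) : ℝ) : ℂ) := by
      rw [← Real.exp_add]
      push_cast
      congr 1
      ring
    have hreal : π / (8 * (2 * y + t) ^ 2) * (Real.sqrt 8 * Real.sqrt (2 * y + t))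
        = π / Real.sqrt 8 * (2 * y + t) ^ (-(3 / 2) : ℝ) := by
      have h8 : Real.sqrt 8 * Real.sqrt 8 = 8 := Real.mul_self_sqrt (by norm_num)
      have hpow : (2 * y + t) ^ (-(3 / 2) : ℝ) = Real.sqrt (2 * y + t) / (2 * y + t) ^ 2 := by
        rw [Real.sqrt_eq_rpow, ← Real.rpow_natCast (2 * y + t) 2, ← Real.rpow_sub hr]
        norm_num
      rw [hpow]
      field_simp
      rw [pow_two, h8]
    rw [hexp, hc]
    have hreal' : ((π / (8 * (2 * y + t) ^ 2) : ℝ) : ℂ)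
        * ((Real.sqrt 8 * Real.sqrt (2 * y + t) : ℝ) : ℂ)
        = π / Real.sqrt 8 * (((2 * y + t) ^ (-(3 / 2) : ℝ) : ℝ) : ℂ) := by
      rw [← ofReal_mul, hreal]
      push_cast
      rfl
    rw [← mul_assoc, hreal']
    push_cast
    ring
  rw [setIntegral_congr_fun measurableSet_Ioi hpois]
  have hcint : ∀ k : ℤ, IntegrableOn (c k) (Set.Ioi 0) := fun k =>
    (integrableOn_gammaFactor (2 * k + 1) hy).const_mul _
  have hcval : ∀ k : ℤ, ∫ t in Set.Ioi (0 : ℝ), c k t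
      = Real.exp (-4 * π * (2 * k + 1) ^ 2 * y) * gammaFactor (2 * k + 1) y := by
    intro k
    simp only [hc, gammaFactor, integral_const_mul]
  have hcnn : ∀ k : ℤ, ∀ t ∈ Set.Ioi (0 : ℝ), 0 ≤ c k t := by
    intro k t ht
    have ht : (0 : ℝ) < t := ht
    simp only [hc]
    positivity
  have hD := hasSum_integral_of_summable_integral_norm (μ := volume.restrict (Set.Ioi (0 : ℝ)))
    (F := fun (k : ℤ) (t : ℝ) =>
      (π / Real.sqrt 8 * (e ((2 * k + 1) * w / 2) * (c k t : ℝ)) : ℂ))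
    (fun k => ((hcint k).ofReal.const_mul _).const_mul _)
    (by
      have hval : ∀ k : ℤ, ∫ t in Set.Ioi (0 : ℝ),
          ‖(π / Real.sqrt 8 * (e ((2 * k + 1) * w / 2) * (c k t : ℝ)) : ℂ)‖
          = π / Real.sqrt 8 * (Real.exp (-π * (2 * k + 1) * w.im) *
            (Real.exp (-4 * π * (2 * k + 1) ^ 2 * y) * gammaFactor (2 * k + 1) y)) := by
        intro k
        rw [← hcval, ← integral_const_mul, ← integral_const_mul]
        refine setIntegral_congr_fun measurableSet_Ioi fun t ht => ?_
        simp only [norm_mul, norm_div, Complex.norm_real, norm_e]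
        rw [Real.norm_of_nonneg (hcnn k t ht), Real.norm_of_nonneg Real.pi_pos.le,
          Real.norm_of_nonneg (Real.sqrt_nonneg _)]
        congr 3
        have : ((2 * (k : ℂ) + 1) * w / 2).im = (2 * k + 1) * w.im / 2 := by
          rw [show (2 * (k : ℂ) + 1) * w / 2 = (((2 * k + 1) / 2 : ℝ) : ℂ) * w by push_cast; ring,
            im_ofReal_mul]
          ring
        rw [this]
        ring
      simp_rw [hval]
      refine Summable.mul_left _ ?_
      have hdom := (summable_exp_linear_sub_sq (α := 16 * π * y) (by positivity)
        (2 * π * |w.im| + 16 * π * y)).mul_left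
          (Real.exp (π * |w.im|) * (2 * (2 * y) ^ (-(1 / 2) : ℝ)))
      refine Summable.of_nonneg_of_le (fun k => ?_) (fun k => ?_) hdom
      · have := gammaFactor_nonneg (2 * k + 1) hy
        positivity
      · rw [← mul_assoc, ← Real.exp_add,
          mul_right_comm (Real.exp (π * |w.im|)) (2 * (2 * y) ^ (-(1 / 2) : ℝ)),
          ← Real.exp_add]
        refine mul_le_mul (Real.exp_le_exp.2 ?_) (gammaFactor_le _ hy) (gammaFactor_nonneg _ hy)
          (Real.exp_pos _).le
        have a1 : -((k : ℝ) * w.im) ≤ |(k : ℝ)| * |w.im| := by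
          rw [← abs_mul]; exact neg_le_abs _
        have a2 : -w.im ≤ |w.im| := neg_le_abs _
        have a3 : -(k : ℝ) ≤ |(k : ℝ)| := neg_le_abs _
        have hπ := Real.pi_pos
        have a4 : π * y * (-(k : ℝ)) ≤ π * y * |(k : ℝ)| :=
          mul_le_mul_of_nonneg_left a3 (by positivity)
        have a5 := mul_le_mul_of_nonneg_left a1 hπ.le
        have a6 := mul_le_mul_of_nonneg_left a2 hπ.le
        have a7 : 0 < π * y := by positivity
        nlinarith)
  rw [← hD.tsum_eq, ← tsum_mul_left]
  refine tsum_congr fun k => ?_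
  rw [integral_const_mul, integral_const_mul, integral_complex_ofReal, hcval]

/-! ### A lower bound for the Euler product -/

lemma geom_tail_le {r : ℝ} (hr0 : 0 ≤ r) (hr1 : r < 1) (k : ℕ) :
    r ^ (k + 1) / (1 - r ^ (k + 1)) ≤ 1 / ((k : ℝ) + 1) * (r / (1 - r)) := by
  have h1 : 0 < 1 - r := by linarith
  have h2 : r ^ (k + 1) < 1 := pow_lt_one₀ hr0 hr1 (by omega)
  have h3 : ((k : ℝ) + 1) * r ^ k * (1 - r) ≤ 1 - r ^ (k + 1) := by
    have hg := geom_sum_mul_neg r (k + 1)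
    have hs : ((k : ℝ) + 1) * r ^ k ≤ ∑ i ∈ Finset.range (k + 1), r ^ i := by
      calc ((k : ℝ) + 1) * r ^ k = ∑ i ∈ Finset.range (k + 1), r ^ k := by simp
        _ ≤ _ := Finset.sum_le_sum fun i hi => by
            refine pow_le_pow_of_le_one hr0 hr1.le ?_
            have := Finset.mem_range.1 hi
            omega
    rw [← hg]
    exact mul_le_mul_of_nonneg_right hs h1.le
  rw [div_mul_div_comm, div_le_div_iff₀ (by linarith) (by positivity)]
  calc r ^ (k + 1) * (((k : ℝ) + 1) * (1 - r)) = r * (((k : ℝ) + 1) * r ^ k * (1 - r)) := by ring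
    _ ≤ r * (1 - r ^ (k + 1)) := mul_le_mul_of_nonneg_left h3 hr0
    _ = _ := by ring

lemma summable_one_div_add_one_sq : Summable fun k : ℕ => 1 / ((k : ℝ) + 1) ^ 2 := by
  have := (summable_nat_add_iff 1).2 (Real.summable_one_div_nat_pow (p := 2) |>.2 (by norm_num))
  simpa using this

lemma sum_neg_log_one_sub_pow_le {r : ℝ} (hr0 : 0 ≤ r) (hr1 : r < 1) (n : ℕ) :
    ∑ i ∈ Finset.range n, -Real.log (1 - r ^ (i + 1))
      ≤ (∑' k : ℕ, 1 / ((k : ℝ) + 1) ^ 2) * (r / (1 - r)) := by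
  have h1 : 0 < 1 - r := by linarith
  have hs : ∀ i : ℕ, HasSum (fun k : ℕ => (r ^ (i + 1)) ^ (k + 1) / ((k : ℝ) + 1))
      (-Real.log (1 - r ^ (i + 1))) := fun i => by
    refine Real.hasSum_pow_div_log_of_abs_lt_one ?_
    rw [abs_of_nonneg (by positivity)]
    exact pow_lt_one₀ hr0 hr1 (by omega)
  have hsum := hasSum_sum (s := Finset.range n) fun i _ => hs i
  have hb := summable_one_div_add_one_sq.hasSum.mul_right (r / (1 - r))
  refine hasSum_le (fun k => ?_) hsum hb
  have h2 : r ^ (k + 1) < 1 := pow_lt_one₀ hr0 hr1 (by omega)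
  have h3 : 0 ≤ r ^ (k + 1) := by positivity
  calc ∑ i ∈ Finset.range n, (r ^ (i + 1)) ^ (k + 1) / ((k : ℝ) + 1)
      = (r ^ (k + 1) * ∑ i ∈ Finset.range n, (r ^ (k + 1)) ^ i) / ((k : ℝ) + 1) := by
        rw [Finset.mul_sum, Finset.sum_div]
        refine Finset.sum_congr rfl fun i _ => ?_
        rw [← pow_mul, ← pow_mul, ← pow_add]
        ring_nf
    _ ≤ (r ^ (k + 1) / (1 - r ^ (k + 1))) / ((k : ℝ) + 1) := by
        refine div_le_div_of_nonneg_right ?_ (by positivity)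
        rw [div_eq_mul_inv]
        refine mul_le_mul_of_nonneg_left ?_ h3
        rw [← tsum_geometric_of_lt_one h3 h2]
        exact (summable_geometric_of_lt_one h3 h2).sum_le_tsum _ fun _ _ => by positivity
    _ ≤ (1 / ((k : ℝ) + 1) * (r / (1 - r))) / ((k : ℝ) + 1) :=
        div_le_div_of_nonneg_right (geom_tail_le hr0 hr1 k) (by positivity)
    _ = _ := by
        field_simp

/-- The Euler product is bounded below by `exp (-C r / (1 - r))` on `|q| = r`. The exponent has a
simple pole at `r = 1`, which is what linear exponential growth at the cusps requires. -/
lemma exp_le_norm_qPoch {q : ℂ} (hq : ‖q‖ < 1) :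
    Real.exp (-((∑' k : ℕ, 1 / ((k : ℝ) + 1) ^ 2) * (‖q‖ / (1 - ‖q‖)))) ≤ ‖qPoch q‖ := by
  have ht := (ModularForm.multipliable_one_sub_pow hq).hasProd.tendsto_prod_nat.norm
  refine ge_of_tendsto ht (Filter.Eventually.of_forall fun n => ?_)
  have hpos : ∀ i : ℕ, 0 < 1 - ‖q‖ ^ (i + 1) := fun i => by
    have := pow_lt_one₀ (norm_nonneg q) hq (by omega : i + 1 ≠ 0)
    linarith
  calc _ ≤ Real.exp (∑ i ∈ Finset.range n, Real.log (1 - ‖q‖ ^ (i + 1))) := by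
        refine Real.exp_le_exp.2 ?_
        have := sum_neg_log_one_sub_pow_le (norm_nonneg q) hq n
        rw [Finset.sum_neg_distrib] at this
        linarith
    _ = ∏ i ∈ Finset.range n, (1 - ‖q‖ ^ (i + 1)) := by
        rw [Real.exp_sum]
        exact Finset.prod_congr rfl fun i _ => Real.exp_log (hpos i)
    _ ≤ ∏ i ∈ Finset.range n, ‖1 - q ^ (i + 1)‖ := by
        refine Finset.prod_le_prod (fun i _ => (hpos i).le) fun i _ => ?_
        have := norm_sub_norm_le (1 : ℂ) (q ^ (i + 1))
        simpa using this
    _ = _ := by rw [norm_prod]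

lemma qPoch_ne_zero {q : ℂ} (hq : ‖q‖ < 1) : qPoch q ≠ 0 :=
  norm_pos_iff.1 ((Real.exp_pos _).trans_le (exp_le_norm_qPoch hq))

/-! ### Convergence of the Appell–Lerch type series -/

lemma norm_e_ratCast (a c : ℕ) : ‖e ((a : ℂ) / c)‖ = 1 := by
  rw [norm_e]
  have : ((a : ℂ) / c).im = 0 := by
    rw [show (a : ℂ) / c = (((a : ℝ) / c : ℝ) : ℂ) by push_cast; rfl, ofReal_im]
  simp [this]

lemma e_ratCast_ne_one {a c : ℕ} (ha : 0 < a) (hac : a < c) : e ((a : ℂ) / c) ≠ 1 := by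
  have hc : (c : ℂ) ≠ 0 := by
    have : c ≠ 0 := by omega
    exact_mod_cast this
  unfold e
  intro h
  obtain ⟨n, hn⟩ := Complex.exp_eq_one_iff.1 h
  have h2 : (a : ℂ) / c = n := by
    have h2π := Complex.two_pi_I_ne_zero
    have : 2 * π * I * ((a : ℂ) / c) = 2 * π * I * n := by rw [hn]; ring
    exact mul_left_cancel₀ h2π this
  rw [div_eq_iff hc] at h2
  have h3 : (a : ℤ) = n * c := by exact_mod_cast h2
  have : (a : ℤ) < c := by exact_mod_cast hac
  have ha' : (0 : ℤ) < a := by exact_mod_cast ha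
  rcases le_or_gt n 0 with h | h
  · nlinarith
  · nlinarith

/-- Distance of `x` from `1`, truncated at `1`. -/
noncomputable def gap (x : ℂ) : ℝ := min ‖1 - x‖ 1

lemma gap_pos {x : ℂ} (hx : x ≠ 1) : 0 < gap x :=
  lt_min (norm_pos_iff.2 (sub_ne_zero.2 hx.symm)) one_pos

lemma gap_le_one (x : ℂ) : gap x ≤ 1 := min_le_right _ _

/-- The denominators `1 - x Q^n` are bounded away from zero uniformly in `n`: `gap` handles `n = 0`,
and for `n ≠ 0` the number `|Q^n|` is at most `r` or at least `1 / r`. -/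
lemma gap_mul_le_norm {x Q : ℂ} {r : ℝ} (hx : ‖x‖ = 1) (hQ0 : Q ≠ 0) (hQ : ‖Q‖ ≤ r)
    (hr : r < 1) (n : ℤ) : gap x * (1 - r) ≤ ‖1 - x * Q ^ n‖ := by
  have hQpos : 0 < ‖Q‖ := norm_pos_iff.2 hQ0
  have hr0 : 0 < r := hQpos.trans_le hQ
  have hg0 : 0 ≤ gap x := le_min (norm_nonneg _) zero_le_one
  have hle : gap x * (1 - r) ≤ 1 - r := mul_le_of_le_one_left (by linarith) (gap_le_one x)
  have hn : ‖x * Q ^ n‖ = ‖Q‖ ^ n := by rw [norm_mul, hx, one_mul, norm_zpow]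
  rcases lt_trichotomy n 0 with h | h | h
  · have h1 : r⁻¹ ≤ ‖Q‖ ^ n := by
      obtain ⟨k, rfl⟩ : ∃ k : ℕ, n = -((k : ℤ) + 1) := ⟨(-n - 1).toNat, by omega⟩
      rw [zpow_neg]
      refine inv_anti₀ (by positivity) ?_
      have : ‖Q‖ ^ ((k : ℤ) + 1) = ‖Q‖ ^ (k + 1) := by norm_cast
      rw [this, pow_succ]
      exact (mul_le_of_le_one_left hQpos.le
        (pow_le_one₀ hQpos.le (hQ.trans hr.le))).trans hQ
    have h2 := norm_sub_norm_le (x * Q ^ n) 1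
    rw [norm_sub_rev, hn, norm_one] at h2
    have h3 : 2 - r ≤ r⁻¹ := by
      rw [le_inv_comm₀ (by linarith) hr0, inv_eq_one_div, le_div_iff₀ (by linarith)]
      nlinarith [sq_nonneg (r - 1)]
    linarith
  · subst h
    rw [zpow_zero, mul_one]
    refine (mul_le_of_le_one_right hg0 (by linarith)).trans (min_le_left _ _)
  · have h1 : ‖Q‖ ^ n ≤ r := by
      obtain ⟨k, rfl⟩ : ∃ k : ℕ, n = (k : ℤ) + 1 := ⟨(n - 1).toNat, by omega⟩
      have : ‖Q‖ ^ ((k : ℤ) + 1) = ‖Q‖ ^ (k + 1) := by norm_cast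
      rw [this, pow_succ]
      exact (mul_le_of_le_one_left hQpos.le
        (pow_le_one₀ hQpos.le (hQ.trans hr.le))).trans hQ
    have h2 := norm_sub_norm_le 1 (x * Q ^ n)
    rw [hn, norm_one] at h2
    linarith

lemma norm_zpow_le_of_natAbs_le {Q : ℂ} {r : ℝ} (hQ0 : Q ≠ 0) (hQ : ‖Q‖ ≤ r) (hr : r < 1)
    {n E : ℤ} (hE : 0 ≤ E) (hn : (n.natAbs : ℤ) ≤ E + 1) : ‖Q ^ E‖ ≤ r⁻¹ * r ^ n.natAbs := by
  have hr0 : 0 < r := (norm_pos_iff.2 hQ0).trans_le hQ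
  lift E to ℕ using hE
  rw [zpow_natCast, norm_pow]
  refine (pow_le_pow_left₀ (norm_nonneg _) hQ E).trans ?_
  rw [le_inv_mul_iff₀ hr0, ← pow_succ']
  exact pow_le_pow_of_le_one hr0.le hr.le (by omega)

lemma simple_exponent_bound (n : ℤ) :
    0 ≤ n * (3 * n + 1) / 2 ∧ (n.natAbs : ℤ) ≤ n * (3 * n + 1) / 2 + 1 := by
  have h : 2 * (n.natAbs : ℤ) ≤ n * (3 * n + 1) + 2 ∧ 0 ≤ n * (3 * n + 1) := by
    rcases le_or_gt 0 n with h | h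
    · rw [Int.natAbs_of_nonneg h]; constructor <;> nlinarith [sq_nonneg (n - 1)]
    · rw [Int.ofNat_natAbs_of_nonpos h.le]; constructor <;> nlinarith
  omega

lemma double_exponent_bound (n : ℤ) :
    0 ≤ 3 * n * (n + 1) / 2 ∧ (n.natAbs : ℤ) ≤ 3 * n * (n + 1) / 2 + 1 := by
  have h : 2 * (n.natAbs : ℤ) ≤ 3 * n * (n + 1) + 2 ∧ 0 ≤ 3 * n * (n + 1) := by
    rcases le_or_gt 0 n with h | h
    · rw [Int.natAbs_of_nonneg h]; constructor <;> nlinarith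
    · rw [Int.ofNat_natAbs_of_nonpos h.le]; constructor <;> nlinarith
  omega

lemma norm_simpleTerm_le {a c : ℕ} (ha : 0 < a) (hac : a < c) {Q : ℂ} {r : ℝ} (hQ0 : Q ≠ 0)
    (hQ : ‖Q‖ ≤ r) (hr : r < 1) (n : ℤ) :
    ‖simpleTerm a c Q n‖
      ≤ r⁻¹ * r ^ n.natAbs / (gap (e ((a : ℂ) / c)) * (1 - r)) ^ 2 := by
  have hr0 : 0 < r := (norm_pos_iff.2 hQ0).trans_le hQ
  have hg := gap_pos (e_ratCast_ne_one ha hac)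
  have hδ : 0 < gap (e ((a : ℂ) / c)) * (1 - r) := mul_pos hg (by linarith)
  have hδ1 : gap (e ((a : ℂ) / c)) * (1 - r) ≤ 1 :=
    mul_le_one₀ (gap_le_one _) (by linarith) (by linarith)
  have hd := gap_mul_le_norm (norm_e_ratCast a c) hQ0 hQ hr n
  rw [simpleTerm, norm_div, norm_mul, norm_neg_one_zpow, one_mul]
  refine div_le_div₀ (by positivity) (norm_zpow_le_of_natAbs_le hQ0 hQ hr
    (simple_exponent_bound n).1 (simple_exponent_bound n).2) (by positivity) ?_
  refine le_trans ?_ hd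
  rw [pow_two]
  exact mul_le_of_le_one_left hδ.le hδ1

lemma norm_doubleTerm_le {a c : ℕ} (ha : 0 < a) (hac : a < c) {Q : ℂ} {r : ℝ} (hQ0 : Q ≠ 0)
    (hQ : ‖Q‖ ≤ r) (hr : r < 1) (n : ℤ) :
    ‖doubleTerm a c Q n‖
      ≤ r⁻¹ * r ^ n.natAbs / (gap (e ((a : ℂ) / c)) * (1 - r)) ^ 2 := by
  have hr0 : 0 < r := (norm_pos_iff.2 hQ0).trans_le hQ
  have hg := gap_pos (e_ratCast_ne_one ha hac)
  have hδ : 0 < gap (e ((a : ℂ) / c)) * (1 - r) := mul_pos hg (by linarith)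
  have hd := gap_mul_le_norm (norm_e_ratCast a c) hQ0 hQ hr n
  rw [doubleTerm, norm_div, norm_mul, norm_neg_one_zpow, one_mul, norm_pow]
  exact div_le_div₀ (by positivity) (norm_zpow_le_of_natAbs_le hQ0 hQ hr
    (double_exponent_bound n).1 (double_exponent_bound n).2) (by positivity)
    (pow_le_pow_left₀ hδ.le hd 2)

lemma hasSum_pow_natAbs {r : ℝ} (hr0 : 0 ≤ r) (hr : r < 1) :
    HasSum (fun n : ℤ => r ^ n.natAbs) ((1 + r) / (1 - r)) := by
  have h := hasSum_geometric_of_lt_one hr0 hr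
  have h2 := HasSum.of_nat_of_neg_add_one (f := fun n : ℤ => r ^ n.natAbs) (m := (1 - r)⁻¹)
    (m' := r * (1 - r)⁻¹) (by simpa using h) (by
      refine (h.mul_left r).congr_fun fun n => ?_
      rw [← pow_succ']
      congr 1)
  convert h2 using 1
  have : 1 - r ≠ 0 := by linarith
  field_simp

lemma summable_simpleTerm {a c : ℕ} (ha : 0 < a) (hac : a < c) {Q : ℂ} (hQ0 : Q ≠ 0)
    (hQ : ‖Q‖ < 1) : Summable (simpleTerm a c Q) :=
  .of_norm_bounded (((hasSum_pow_natAbs (norm_nonneg _) hQ).summable.mul_left _).div_const _)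
    (norm_simpleTerm_le ha hac hQ0 le_rfl hQ)

lemma summable_doubleTerm {a c : ℕ} (ha : 0 < a) (hac : a < c) {Q : ℂ} (hQ0 : Q ≠ 0)
    (hQ : ‖Q‖ < 1) : Summable (doubleTerm a c Q) :=
  .of_norm_bounded (((hasSum_pow_natAbs (norm_nonneg _) hQ).summable.mul_left _).div_const _)
    (norm_doubleTerm_le ha hac hQ0 le_rfl hQ)

lemma norm_R2_le {a c : ℕ} (ha : 0 < a) (hac : a < c) {Q : ℂ} (hQ0 : Q ≠ 0) (hQ : ‖Q‖ < 1) :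
    ‖R2 a c Q‖ ≤ 2 * ‖qPoch Q‖⁻¹ * (‖Q‖⁻¹ * (2 / (1 - ‖Q‖))
      / (gap (e ((a : ℂ) / c)) * (1 - ‖Q‖)) ^ 2) := by
  have hr0 : 0 < ‖Q‖ := norm_pos_iff.2 hQ0
  have hS := ((hasSum_pow_natAbs (norm_nonneg _) hQ).mul_left ‖Q‖⁻¹).div_const
    ((gap (e ((a : ℂ) / c)) * (1 - ‖Q‖)) ^ 2)
  have h1 := tsum_of_norm_bounded hS (norm_simpleTerm_le ha hac hQ0 le_rfl hQ)
  have h2 := tsum_of_norm_bounded hS (norm_doubleTerm_le ha hac hQ0 le_rfl hQ)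
  set B := ‖Q‖⁻¹ * ((1 + ‖Q‖) / (1 - ‖Q‖)) / (gap (e ((a : ℂ) / c)) * (1 - ‖Q‖)) ^ 2 with hB
  have hB' : B ≤ ‖Q‖⁻¹ * (2 / (1 - ‖Q‖)) / (gap (e ((a : ℂ) / c)) * (1 - ‖Q‖)) ^ 2 := by
    rw [hB]
    have : 0 < 1 - ‖Q‖ := by linarith
    gcongr
    linarith
  have hre : ∀ x : ℝ, ‖e (x : ℂ)‖ = 1 := fun x => by rw [norm_e]; simp
  have e1 : ‖e ((a : ℂ) / (2 * c))‖ = 1 := by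
    have := hre ((a : ℝ) / (2 * c)); push_cast at this; exact this
  have e2 : ‖e (3 * (a : ℂ) / (2 * c))‖ = 1 := by
    have := hre (3 * (a : ℝ) / (2 * c)); push_cast at this; exact this
  have hP : 0 ≤ ‖qPoch Q‖⁻¹ := by positivity
  have hB0 : 0 ≤ B := (norm_nonneg _).trans h1
  calc ‖R2 a c Q‖ ≤ ‖qPoch Q‖⁻¹ / 2 * B + ‖qPoch Q‖⁻¹ * B := by
        unfold R2
        refine (norm_add_le _ _).trans (add_le_add ?_ ?_)
        · rw [norm_mul, norm_div, e1, norm_mul]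
          refine mul_le_mul (le_of_eq ?_) h1 (norm_nonneg _) (by positivity)
          simp
          ring
        · rw [norm_mul, norm_div, e2, one_div]
          exact mul_le_mul_of_nonneg_left h2 hP
    _ ≤ 2 * ‖qPoch Q‖⁻¹ * B := by nlinarith
    _ ≤ _ := mul_le_mul_of_nonneg_left hB' (by positivity)

lemma differentiableOn_R2 {a c : ℕ} (ha : 0 < a) (hac : a < c) :
    DifferentiableOn ℂ (R2 a c) {Q | Q ≠ 0 ∧ ‖Q‖ < 1} := by
  intro Q₀ hQ₀
  obtain ⟨h0, h1⟩ := hQ₀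
  obtain ⟨r, hr, hr1⟩ := exists_between h1
  have hr0 : 0 ≤ r := (norm_nonneg _).trans hr.le
  set U : Set ℂ := {Q | Q ≠ 0 ∧ ‖Q‖ < r} with hU
  have hUo : IsOpen U := isOpen_ne.inter (isOpen_lt continuous_norm continuous_const)
  have hd : ∀ n : ℤ, ∀ Q ∈ U, 1 - e ((a : ℂ) / c) * Q ^ n ≠ 0 := by
    intro n Q hQ
    have := gap_mul_le_norm (norm_e_ratCast a c) hQ.1 hQ.2.le hr1 n
    have hg := mul_pos (gap_pos (e_ratCast_ne_one ha hac)) (sub_pos.2 hr1)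
    exact norm_pos_iff.1 (hg.trans_le this)
  have hz : ∀ n : ℤ, DifferentiableOn ℂ (fun Q : ℂ => Q ^ n) U := fun n Q hQ =>
    (differentiableAt_zpow.2 (Or.inl hQ.1)).differentiableWithinAt
  have hbound := ((hasSum_pow_natAbs hr0 hr1).summable.mul_left r⁻¹).div_const
    ((gap (e ((a : ℂ) / c)) * (1 - r)) ^ 2)
  have hs := differentiableOn_tsum_of_summable_norm (F := fun n Q => simpleTerm a c Q n) hbound
    (fun n => DifferentiableOn.div ((hz _).const_mul _) (((hz n).const_mul _).const_sub _)
      (hd n)) hUo (fun n Q hQ => norm_simpleTerm_le ha hac hQ.1 hQ.2.le hr1 n)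
  have hs2 := differentiableOn_tsum_of_summable_norm (F := fun n Q => doubleTerm a c Q n) hbound
    (fun n => DifferentiableOn.div ((hz _).const_mul _) ((((hz n).const_mul _).const_sub _).pow 2)
      (fun Q hQ => pow_ne_zero 2 (hd n Q hQ))) hUo
    (fun n Q hQ => norm_doubleTerm_le ha hac hQ.1 hQ.2.le hr1 n)
  have hP : DifferentiableOn ℂ qPoch U := ModularForm.differentiableOn_tprod_one_sub_pow.mono
    fun Q hQ => by simpa using hQ.2.trans hr1
  have hP0 : ∀ Q ∈ U, qPoch Q ≠ 0 := fun Q hQ => qPoch_ne_zero (hQ.2.trans hr1)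
  have hall : DifferentiableOn ℂ (R2 a c) U := by
    unfold R2
    refine DifferentiableOn.add (DifferentiableOn.mul ?_ hs) (DifferentiableOn.mul ?_ hs2)
    · exact (differentiableOn_const _).div (hP.const_mul 2) fun Q hQ =>
        mul_ne_zero two_ne_zero (hP0 Q hQ)
    · exact (differentiableOn_const _).div hP hP0
  exact (hall.differentiableAt (hUo.mem_nhds ⟨h0, hr⟩)).differentiableWithinAt

lemma norm_e_lt_one {z : ℂ} (hz : 0 < z.im) : ‖e z‖ < 1 := by
  rw [norm_e, Real.exp_lt_one_iff]
  have := mul_pos (mul_pos two_pos Real.pi_pos) hz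
  linarith

lemma norm_e_pow_lt_one {z : ℂ} (hz : 0 < z.im) : ‖e z ^ 24‖ < 1 := by
  rw [norm_pow]
  exact pow_lt_one₀ (norm_nonneg _) (norm_e_lt_one hz) (by norm_num)

lemma differentiable_e : Differentiable ℂ e := by
  unfold e
  fun_prop

lemma differentiableOn_holPart {a c : ℕ} (ha : 0 < a) (hac : a < c) :
    DifferentiableOn ℂ (fun z => (e z)⁻¹ * R2 a c (e z ^ 24)) {z : ℂ | 0 < z.im} := by
  refine DifferentiableOn.mul (differentiable_e.differentiableOn.inv fun z _ => e_ne_zero z) ?_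
  exact (differentiableOn_R2 ha hac).comp (differentiable_e.pow 24).differentiableOn
    fun z hz => ⟨pow_ne_zero _ (e_ne_zero z), norm_e_pow_lt_one hz⟩

/-! ### The theta integral as a series of incomplete Gamma factors -/

lemma norm_e_ofReal_mul (p : ℝ) (τ : ℂ) : ‖e ((p : ℂ) * τ)‖ = Real.exp (-2 * π * p * τ.im) := by
  rw [norm_e, im_ofReal_mul]
  ring_nf

lemma norm_e_ofReal (p : ℝ) : ‖e (p : ℂ)‖ = 1 := by
  rw [norm_e]
  simp

lemma summable_norm_e_quadratic (p : ℝ) {d : ℝ} (hd : d ≠ 0) {τ : ℂ} (hτ : 0 < τ.im) :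
    Summable fun k : ℤ => ‖e (((p : ℂ) + d * k) ^ 2 * τ)‖ := by
  have hdd : 0 < d ^ 2 := by positivity
  have h := (summable_exp_linear_sub_sq (α := 2 * π * τ.im * d ^ 2)
    (by have := Real.pi_pos; positivity) (4 * π * τ.im * |p * d|)).mul_left
      (Real.exp (-2 * π * τ.im * p ^ 2))
  refine Summable.of_nonneg_of_le (fun _ => norm_nonneg _) (fun k => ?_) h
  rw [show ((p : ℂ) + d * k) ^ 2 * τ = (((p + d * k) ^ 2 : ℝ) : ℂ) * τ by push_cast; ring,
    norm_e_ofReal_mul, ← Real.exp_add]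
  refine Real.exp_le_exp.2 ?_
  have h1 : -(p * d * k) ≤ |p * d| * |(k : ℝ)| := by
    rw [← abs_mul]; exact neg_le_abs _
  have h2 := mul_le_mul_of_nonneg_left h1 (by have := Real.pi_pos; positivity : 0 ≤ 4 * π * τ.im)
  nlinarith

lemma six_dvd_dc (c : ℕ) : 6 ∣ dc c := Nat.dvd_lcm_left _ _

lemma dvd_dc (c : ℕ) : c ∣ dc c := Nat.dvd_lcm_right _ _

lemma dc_pos {c : ℕ} (hc : 0 < c) : 0 < dc c := Nat.lcm_pos (by norm_num) hc

lemma dc_div_six (c : ℕ) : ((dc c / 6 : ℕ) : ℂ) = dc c / 6 := by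
  rw [Nat.cast_div (six_dvd_dc c) (by norm_num)]
  norm_num

lemma dc_div_self {c : ℕ} (hc : 0 < c) : ((dc c / c : ℕ) : ℂ) = dc c / c := by
  rw [Nat.cast_div (dvd_dc c) (by exact_mod_cast hc.ne')]

lemma thetaTerm_eq (a : ℕ) {c : ℕ} (hc : 0 < c) (τ : ℂ) (k : ℤ) :
    thetaTerm a c τ k =
      (-1) ^ k * e (((dc c * (1 / 6 + a / c) : ℝ) + (dc c : ℝ) * k) ^ 2 * τ)
        + (-1) ^ k * e (((dc c * (1 / 6 - a / c) : ℝ) + (dc c : ℝ) * k) ^ 2 * τ) := by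
  rw [thetaTerm, dc_div_six, dc_div_self hc, mul_add]
  push_cast
  congr 4 <;> ring

lemma summable_thetaPiece {c : ℕ} (hc : 0 < c) (p : ℝ) {τ : ℂ} (hτ : 0 < τ.im) :
    Summable fun k : ℤ => (-1 : ℂ) ^ k * e (((p : ℂ) + (dc c : ℝ) * k) ^ 2 * τ) := by
  refine Summable.of_norm ?_
  simp_rw [norm_mul, norm_neg_one_zpow, one_mul]
  exact summable_norm_e_quadratic p (by exact_mod_cast (dc_pos hc).ne') hτ

lemma summable_thetaTerm (a : ℕ) {c : ℕ} (hc : 0 < c) {τ : ℂ} (hτ : 0 < τ.im) :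
    Summable (thetaTerm a c τ) := by
  rw [funext (thetaTerm_eq a hc τ)]
  exact (summable_thetaPiece hc _ hτ).add (summable_thetaPiece hc _ hτ)

/-- Coefficients of the theta function dual to `Θ_{a,c}`, attached to the odd integer
`m = 2k + 1`: up to the symmetry `m ↦ -m`, this is `2 cos(πm/6) cos(πma/c)`. -/
noncomputable def dualCoeff (a c : ℕ) (k : ℤ) : ℂ :=
  e ((2 * k + 1) / 12)
    * (e ((2 * k + 1) * ((a : ℂ) / c) / 2) + e (-((2 * k + 1) * ((a : ℂ) / c) / 2)))

lemma norm_dualCoeff_le (a c : ℕ) (k : ℤ) : ‖dualCoeff a c k‖ ≤ 2 := by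
  have h1 : ‖e ((2 * (k : ℂ) + 1) / 12)‖ = 1 := by
    have := norm_e_ofReal ((2 * k + 1) / 12); push_cast at this; exact this
  have h2 : ‖e ((2 * (k : ℂ) + 1) * ((a : ℂ) / c) / 2)‖ = 1 := by
    have := norm_e_ofReal ((2 * k + 1) * (a / c) / 2); push_cast at this; exact this
  have h3 : ‖e (-((2 * (k : ℂ) + 1) * ((a : ℂ) / c) / 2))‖ = 1 := by
    rw [e_neg, norm_inv, h2, inv_one]
  rw [dualCoeff, norm_mul, h1, one_mul]
  refine (norm_add_le _ _).trans ?_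
  rw [h2, h3]
  norm_num

lemma cpow_half_eight_mul_mul_cpow_neg_half {r : ℂ} (hr : 0 < r.re) :
    (8 * r) ^ (1 / 2 : ℂ) * r ^ (-(1 / 2) : ℂ) = Real.sqrt 8 := by
  have hr0 : r ≠ 0 := by rintro rfl; simp at hr
  have h8 : (8 * r) ^ (1 / 2 : ℂ) = Real.sqrt 8 * r ^ (1 / 2 : ℂ) := by
    rw [cpow_def_of_ne_zero (by simpa using hr0), cpow_def_of_ne_zero hr0]
    have hl := log_ofReal_mul (r := 8) (by norm_num) hr0
    push_cast at hl
    rw [hl, add_mul, Complex.exp_add]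
    congr 1
    rw [Real.sqrt_eq_rpow, ofReal_cpow (by norm_num), cpow_def_of_ne_zero (by norm_num),
      ofReal_log (by norm_num)]
    push_cast
    rfl
  rw [h8, mul_assoc, ← cpow_add _ _ hr0]
  simp

lemma thetaPiece_dual {c : ℕ} (hc : 0 < c) (w : ℝ) {τ : ℂ} (hτ : 0 < τ.im) :
    (∑' k : ℤ, (-1 : ℂ) ^ k
        * e (((dc c * w : ℝ) + (dc c : ℝ) * k) ^ 2 * (-1 / (16 * (dc c : ℂ) ^ 2 * τ))))
        * (-I * τ) ^ (-(1 / 2) : ℂ)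
      = Real.sqrt 8 * ∑' k : ℤ, e ((2 * k + 1) ^ 2 * τ) * e ((2 * k + 1) * w / 2) := by
  have hr : 0 < (-I * τ).re := by simpa using hτ
  have hτ0 : τ ≠ 0 := by rintro rfl; simp at hτ
  have hd : (dc c : ℂ) ≠ 0 := by exact_mod_cast (dc_pos hc).ne'
  have h1 : ∀ k : ℤ, e (((dc c * w : ℝ) + (dc c : ℝ) * k) ^ 2 * (-1 / (16 * (dc c : ℂ) ^ 2 * τ)))
      = cexp (-π * ((w : ℂ) + k) ^ 2 / (8 * (-I * τ))) := by
    intro k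
    unfold e
    congr 1
    push_cast
    have hI := I_ne_zero
    field_simp
    rw [I_sq]
    ring
  simp_rw [h1]
  rw [tsum_neg_one_pow_gaussian hr, mul_right_comm, cpow_half_eight_mul_mul_cpow_neg_half hr]
  congr 1
  refine tsum_congr fun k => ?_
  congr 1
  unfold e
  congr 1
  ring

lemma im_neg_one_div_pos {c : ℕ} (hc : 0 < c) {τ : ℂ} (hτ : 0 < τ.im) :
    0 < (-1 / (16 * (dc c : ℂ) ^ 2 * τ)).im := by
  have hd : (0 : ℝ) < dc c := by exact_mod_cast dc_pos hc
  have hτ0 : τ ≠ 0 := by rintro rfl; simp at hτ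
  have h : -1 / (16 * (dc c : ℂ) ^ 2 * τ) = ((1 / (16 * dc c ^ 2) : ℝ) : ℂ) * (-τ⁻¹) := by
    push_cast
    field_simp
  rw [h, im_ofReal_mul, neg_im, inv_im]
  have : 0 < normSq τ := normSq_pos.2 hτ0
  have h2 : -(-τ.im / normSq τ) = τ.im / normSq τ := by ring
  rw [h2]
  positivity

lemma summable_norm_e_odd_sq {τ : ℂ} (hτ : 0 < τ.im) :
    Summable fun k : ℤ => ‖e ((2 * k + 1) ^ 2 * τ)‖ := by
  have := summable_norm_e_quadratic 1 two_ne_zero hτ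
  refine this.congr fun k => ?_
  push_cast
  ring_nf

/-- The behaviour of `Θ_{a,c}` under inversion. -/
lemma Theta_dual (a : ℕ) {c : ℕ} (hc : 0 < c) {τ : ℂ} (hτ : 0 < τ.im) :
    Theta a c (-1 / (16 * (dc c : ℂ) ^ 2 * τ)) * (-I * τ) ^ (-(1 / 2) : ℂ)
      = Real.sqrt 8 * ∑' k : ℤ, dualCoeff a c k * e ((2 * k + 1) ^ 2 * τ) := by
  have hτ' := im_neg_one_div_pos hc hτ
  have hs : ∀ w : ℝ, Summable fun k : ℤ => e ((2 * k + 1) ^ 2 * τ) * e ((2 * k + 1) * w / 2) := by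
    intro w
    refine Summable.of_norm ?_
    refine (summable_norm_e_odd_sq hτ).congr fun k => ?_
    rw [norm_mul]
    have : ‖e ((2 * (k : ℂ) + 1) * w / 2)‖ = 1 := by
      have := norm_e_ofReal ((2 * k + 1) * w / 2); push_cast at this; exact this
    rw [this, mul_one]
  rw [Theta, funext (thetaTerm_eq a hc _), (summable_thetaPiece hc _ hτ').tsum_add
    (summable_thetaPiece hc _ hτ'), add_mul, thetaPiece_dual hc _ hτ, thetaPiece_dual hc _ hτ,
    ← mul_add, ← (hs _).tsum_add (hs _)]
  congr 1
  refine tsum_congr fun k => ?_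
  rw [dualCoeff, ← mul_add, mul_comm]
  congr 1
  rw [mul_add, ← e_add, ← e_add]
  push_cast
  congr 2 <;> ring

lemma thetaIntegrand_eq (a : ℕ) {c : ℕ} (hc : 0 < c) (z : ℍ) {t : ℝ} (ht : 0 < t) :
    thetaIntegrand a c z (-conj (z : ℂ) + I * t) * I
      = ∑' k : ℤ, (Real.sqrt 8 * I * (dualCoeff a c k * e (-((2 * k + 1) ^ 2 * conj (z : ℂ)))))
        * (Real.exp (-2 * π * ((2 * k + 1 : ℤ) : ℝ) ^ 2 * t)
          * (2 * z.im + t) ^ (-(3 / 2) : ℝ) : ℝ) := by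
  have hz := z.im_pos
  set τ : ℂ := -conj (z : ℂ) + I * t with hτdef
  have hτ : 0 < τ.im := by
    simp [hτdef]
    positivity
  have hden : (-I * (τ + z)) ^ (3 / 2 : ℂ) = (((2 * z.im + t) ^ (3 / 2 : ℝ) : ℝ) : ℂ) := by
    have h1 : -I * (τ + z) = ((2 * z.im + t : ℝ) : ℂ) := by
      rw [hτdef]
      apply Complex.ext
      · simp; ring
      · simp
    rw [h1, ofReal_cpow (by positivity)]
    push_cast
    rfl
  rw [thetaIntegrand, Theta_dual a hc hτ, hden, Real.rpow_neg (by positivity), ← tsum_mul_left,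
    div_eq_mul_inv, ← tsum_mul_right, ← tsum_mul_right]
  refine tsum_congr fun k => ?_
  have he : e ((2 * k + 1) ^ 2 * τ) = e (-((2 * k + 1) ^ 2 * conj (z : ℂ)))
      * (Real.exp (-2 * π * ((2 * k + 1 : ℤ) : ℝ) ^ 2 * t) : ℝ) := by
    have : (2 * (k : ℂ) + 1) ^ 2 * τ = -((2 * k + 1) ^ 2 * conj (z : ℂ))
        + (2 * k + 1) ^ 2 * (I * t) := by
      rw [hτdef]; ring
    rw [this, e_add]
    congr 1
    unfold e
    push_cast
    congr 1
    linear_combination (2 * π * (2 * (k : ℂ) + 1) ^ 2 * t) * I_sq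
  rw [he]
  push_cast
  ring

lemma norm_e_neg_odd_sq_mul_conj (k : ℤ) (z : ℂ) :
    ‖e (-((2 * k + 1) ^ 2 * conj z))‖ = Real.exp (-2 * π * (2 * k + 1) ^ 2 * z.im) := by
  rw [show -((2 * (k : ℂ) + 1) ^ 2 * conj z) = (((2 * k + 1) ^ 2 : ℝ) : ℂ) * (-conj z) by
    push_cast; ring, norm_e_ofReal_mul]
  simp

lemma summable_exp_odd_sq {y : ℝ} (hy : 0 < y) :
    Summable fun k : ℤ => Real.exp (-2 * π * (2 * k + 1) ^ 2 * y) := by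
  have := summable_norm_e_odd_sq (τ := I * y) (by simpa using hy)
  refine this.congr fun k => ?_
  rw [show (2 * (k : ℂ) + 1) ^ 2 * (I * y) = (((2 * k + 1) ^ 2 : ℝ) : ℂ) * (I * y) by
    push_cast; ring, norm_e_ofReal_mul]
  simp

lemma norm_thetaCoeff_le (a c : ℕ) (k : ℤ) (z : ℂ) :
    ‖(Real.sqrt 8 * I * (dualCoeff a c k * e (-((2 * k + 1) ^ 2 * conj z))) : ℂ)‖
      ≤ Real.sqrt 8 * 2 * Real.exp (-2 * π * (2 * k + 1) ^ 2 * z.im) := by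
  rw [norm_mul, norm_mul, norm_mul, Complex.norm_I, mul_one, norm_real,
    Real.norm_of_nonneg (Real.sqrt_nonneg _), norm_e_neg_odd_sq_mul_conj, ← mul_assoc]
  have := norm_dualCoeff_le a c k
  gcongr

lemma integrableOn_thetaIntegrand (a : ℕ) {c : ℕ} (hc : 0 < c) (z : ℍ) :
    IntegrableOn (fun t : ℝ => thetaIntegrand a c z (-conj (z : ℂ) + I * t) * I)
      (Set.Ioi 0) := by
  have hy := z.im_pos
  refine IntegrableOn.congr_fun ?_ (fun t ht => (thetaIntegrand_eq a hc z ht).symm)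
    measurableSet_Ioi
  have hsum := (summable_exp_odd_sq hy).mul_left (Real.sqrt 8 * 2)
  have hb : ∀ (k : ℤ) (t : ℝ), t ∈ Set.Ioi (0 : ℝ) →
      ‖(Real.sqrt 8 * I * (dualCoeff a c k * e (-((2 * k + 1) ^ 2 * conj (z : ℂ)))))
        * ((Real.exp (-2 * π * ((2 * k + 1 : ℤ) : ℝ) ^ 2 * t)
          * (2 * z.im + t) ^ (-(3 / 2) : ℝ) : ℝ) : ℂ)‖
      ≤ Real.sqrt 8 * 2 * Real.exp (-2 * π * (2 * k + 1) ^ 2 * z.im)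
        * (2 * z.im + t) ^ (-(3 / 2) : ℝ) := by
    intro k t ht
    have ht : (0 : ℝ) < t := ht
    rw [norm_mul, norm_real, Real.norm_of_nonneg (by positivity)]
    refine mul_le_mul (norm_thetaCoeff_le a c k z) ?_ (by positivity) (by positivity)
    refine mul_le_of_le_one_left (by positivity) ?_
    rw [Real.exp_le_one_iff]
    have : 0 ≤ 2 * π * ((2 * k + 1 : ℤ) : ℝ) ^ 2 * t := by have := Real.pi_pos; positivity
    linarith
  refine Integrable.mono' ((integrableOn_add_rpow hy
    (by norm_num : (-(3 / 2) : ℝ) < -1)).const_mul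
      (∑' k : ℤ, Real.sqrt 8 * 2 * Real.exp (-2 * π * (2 * k + 1) ^ 2 * z.im))) ?_ ?_
  · refine ContinuousOn.aestronglyMeasurable ?_ measurableSet_Ioi
    refine continuousOn_tsum (u := fun k : ℤ => Real.sqrt 8 * 2 *
      Real.exp (-2 * π * (2 * k + 1) ^ 2 * z.im) * (2 * z.im) ^ (-(3 / 2) : ℝ)) (fun k => ?_)
      (hsum.mul_right _) (fun k t ht => (hb k t ht).trans ?_)
    · refine continuousOn_const.mul (continuous_ofReal.comp_continuousOn ?_)
      refine ContinuousOn.mul (by fun_prop) ?_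
      refine ContinuousOn.rpow_const (by fun_prop) fun t ht => Or.inl ?_
      have ht : (0 : ℝ) < t := ht
      positivity
    · have ht : (0 : ℝ) < t := ht
      refine mul_le_mul_of_nonneg_left ?_ (by positivity)
      exact Real.rpow_le_rpow_of_nonpos (by positivity) (by linarith) (by norm_num)
  · refine (ae_restrict_iff' measurableSet_Ioi).2 (Filter.Eventually.of_forall fun t ht => ?_)
    rw [← tsum_mul_right]
    exact tsum_of_norm_bounded (hsum.mul_right _).hasSum fun k => hb k t ht

/-- The non-holomorphic part as a series over odd integers `2k + 1`. -/
theorem nonholPart_eq (a : ℕ) {c : ℕ} (hc : 0 < c) (z : ℍ) :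
    nonholPart a c z = -(Real.sqrt 8 / (32 * Real.sqrt 3 * π))
      * ∑' k : ℤ, dualCoeff a c k * e (-((2 * k + 1) ^ 2 * conj (z : ℂ)))
        * gammaFactor (2 * k + 1) z.im := by
  have hy := z.im_pos
  rw [nonholPart, setIntegral_congr_fun measurableSet_Ioi fun t ht => thetaIntegrand_eq a hc z ht]
  have hI : ∀ k : ℤ, IntegrableOn (fun t : ℝ =>
      ((Real.exp (-2 * π * ((2 * k + 1 : ℤ) : ℝ) ^ 2 * t)
          * (2 * z.im + t) ^ (-(3 / 2) : ℝ) : ℝ) : ℂ)) (Set.Ioi 0) := fun k =>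
    (integrableOn_gammaFactor (2 * k + 1) hy).ofReal
  have h := hasSum_integral_of_summable_integral_norm (μ := volume.restrict (Set.Ioi (0 : ℝ)))
    (F := fun (k : ℤ) (t : ℝ) =>
      (Real.sqrt 8 * I * (dualCoeff a c k * e (-((2 * k + 1) ^ 2 * conj (z : ℂ)))))
        * ((Real.exp (-2 * π * ((2 * k + 1 : ℤ) : ℝ) ^ 2 * t)
          * (2 * z.im + t) ^ (-(3 / 2) : ℝ) : ℝ) : ℂ))
    (fun k => (hI k).const_mul _) ?_
  · rw [← h.tsum_eq, ← tsum_mul_left, ← tsum_mul_left]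
    refine tsum_congr fun k => ?_
    rw [integral_const_mul, integral_complex_ofReal]
    have : ∫ t in Set.Ioi (0 : ℝ), Real.exp (-2 * π * ((2 * k + 1 : ℤ) : ℝ) ^ 2 * t)
        * (2 * z.im + t) ^ (-(3 / 2) : ℝ) = gammaFactor (2 * k + 1) z.im := rfl
    rw [this]
    linear_combination (Real.sqrt 8 / (32 * Real.sqrt 3 * π) * dualCoeff a c k
      * e (-((2 * k + 1) ^ 2 * conj (z : ℂ))) * gammaFactor (2 * k + 1) z.im : ℂ) * I_sq
  · refine Summable.of_nonneg_of_le (fun k => integral_nonneg fun _ => norm_nonneg _)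
      (fun k => ?_) (((summable_exp_odd_sq hy).mul_left (Real.sqrt 8 * 2)).mul_right
        (2 * (2 * z.im) ^ (-(1 / 2) : ℝ)))
    have hsplit : ∀ x y : ℂ, ‖x * y‖ = ‖x‖ * ‖y‖ := norm_mul
    simp_rw [hsplit (Real.sqrt 8 * I * _)]
    rw [integral_const_mul]
    refine mul_le_mul (norm_thetaCoeff_le a c k z) ?_ (integral_nonneg fun _ => norm_nonneg _)
      (by positivity)
    refine le_trans (le_of_eq ?_) (gammaFactor_le (2 * k + 1) hy)
    refine setIntegral_congr_fun measurableSet_Ioi fun t ht => ?_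
    have ht : (0 : ℝ) < t := ht
    change ‖((_ : ℝ) : ℂ)‖ = _
    rw [norm_real, Real.norm_of_nonneg (by positivity)]

/-! ### The lattice sum -/

/-- The point `24 λ z + μ + a/c` of the shifted lattice. -/
noncomputable def latticePoint (a c : ℕ) (z : ℂ) (p : ℤ × ℤ) : ℂ :=
  ((a : ℂ) / c + 24 * p.1 * z) + p.2

/-- The summand `(-1)^(λ+μ) e(36 λ² z) exp(-π W² / (16 y)) / W²`, where `W = 24 λ z + μ + a/c`. It
has absolute value `exp(-π |W|² / (16 y)) / |W|²`. -/
noncomputable def latticeTerm (a c : ℕ) (z : ℂ) (p : ℤ × ℤ) : ℂ :=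
  (-1) ^ p.1 * e (36 * p.1 ^ 2 * z) * ((-1) ^ p.2 *
    (cexp (-π * latticePoint a c z p ^ 2 / (16 * z.im)) / latticePoint a c z p ^ 2))

/-- A weight 2 Eisenstein-like series with Gaussian cut-off. -/
noncomputable def latticeSum (a c : ℕ) (z : ℂ) : ℂ := ∑' p : ℤ × ℤ, latticeTerm a c z p

lemma latticePoint_row_mem {a c : ℕ} (ha : 0 < a) (hac : a < c) {z : ℂ} (hz : 0 < z.im) (l : ℤ) :
    (a : ℂ) / c + 24 * l * z ∈ integerComplement := by
  rw [mem_integerComplement_iff]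
  rintro ⟨n, hn⟩
  have hu : (a : ℂ) / c = ((a / c : ℝ) : ℂ) := by push_cast; rfl
  have hl : l = 0 := by
    have := congrArg Complex.im hn
    rw [hu, show (24 : ℂ) * l * z = ((24 * l : ℝ) : ℂ) * z by push_cast; ring, add_im, ofReal_im,
      im_ofReal_mul, intCast_im] at this
    have h2 : (24 * (l : ℝ)) * z.im = 0 := by linarith
    rcases mul_eq_zero.1 h2 with h | h
    · have : (l : ℝ) = 0 := by linarith
      exact_mod_cast this
    · exact absurd h hz.ne'
  subst hl
  apply e_ratCast_ne_one ha hac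
  have : (a : ℂ) / c = n := by simpa using hn.symm
  rw [this, e_intCast]

lemma latticePoint_ne_zero {a c : ℕ} (ha : 0 < a) (hac : a < c) {z : ℂ} (hz : 0 < z.im)
    (p : ℤ × ℤ) : latticePoint a c z p ≠ 0 :=
  integerComplement_add_ne_zero (latticePoint_row_mem ha hac hz p.1) p.2

lemma latticePoint_im (a c : ℕ) (z : ℂ) (p : ℤ × ℤ) :
    (latticePoint a c z p).im = 24 * p.1 * z.im := by
  have hu : (a : ℂ) / c = ((a / c : ℝ) : ℂ) := by push_cast; rfl
  rw [latticePoint, hu, show (24 : ℂ) * p.1 * z = ((24 * p.1 : ℝ) : ℂ) * z by push_cast; ring,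
    add_im, add_im, ofReal_im, im_ofReal_mul, intCast_im]
  ring

/-- In the exponent, the factor `e(36 λ² z)` adds `2 (Im W)²` to `Re (W²) = (Re W)² - (Im W)²`,
which makes `|W|²`. -/
lemma norm_latticeTerm (a c : ℕ) {z : ℂ} (hz : 0 < z.im) (p : ℤ × ℤ) :
    ‖latticeTerm a c z p‖ = Real.exp (-(π * ‖latticePoint a c z p‖ ^ 2 / (16 * z.im)))
      / ‖latticePoint a c z p‖ ^ 2 := by
  set W := latticePoint a c z p with hW
  have hWi := latticePoint_im a c z p
  rw [← hW] at hWi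
  rw [latticeTerm, ← hW, norm_mul, norm_mul, norm_mul, norm_neg_one_zpow, norm_neg_one_zpow,
    one_mul, one_mul, norm_div, norm_pow, Complex.norm_exp,
    show 36 * (p.1 : ℂ) ^ 2 * z = ((36 * p.1 ^ 2 : ℝ) : ℂ) * z by push_cast; ring,
    norm_e_ofReal_mul, ← mul_div_assoc, ← Real.exp_add]
  congr 2
  have h1 : (-π * W ^ 2 / (16 * z.im)).re = -π * (W.re ^ 2 - W.im ^ 2) / (16 * z.im) := by
    rw [show -(π : ℂ) * W ^ 2 / (16 * z.im) = ((-π / (16 * z.im) : ℝ) : ℂ) * W ^ 2 by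
      push_cast; ring, re_ofReal_mul, pow_two W, mul_re]
    ring
  rw [h1, ← normSq_eq_norm_sq, normSq_apply, hWi]
  field_simp
  ring

lemma norm_latticeTerm_le {a c : ℕ} (ha : 0 < a) (hac : a < c) {z : ℂ} (hz : 0 < z.im)
    (p : ℤ × ℤ) :
    ‖latticeTerm a c z p‖ ≤ 16 * z.im / π * (‖latticePoint a c z p‖ ^ 4)⁻¹ := by
  have hW := norm_pos_iff.2 (latticePoint_ne_zero ha hac hz p)
  rw [norm_latticeTerm a c hz]
  set w := ‖latticePoint a c z p‖
  have hπ := Real.pi_pos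
  have hX : 0 < π * w ^ 2 / (16 * z.im) := by positivity
  have h1 : Real.exp (-(π * w ^ 2 / (16 * z.im))) ≤ (π * w ^ 2 / (16 * z.im))⁻¹ := by
    rw [Real.exp_neg]
    refine inv_anti₀ hX ?_
    linarith [Real.add_one_le_exp (π * w ^ 2 / (16 * z.im))]
  calc _ ≤ (π * w ^ 2 / (16 * z.im))⁻¹ / w ^ 2 := div_le_div_of_nonneg_right h1 (by positivity)
    _ = _ := by field_simp

lemma summable_latticeTerm {a c : ℕ} (ha : 0 < a) (hac : a < c) {z : ℂ} (hz : 0 < z.im) :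
    Summable (latticeTerm a c z) := by
  have hc : (c : ℂ) ≠ 0 := by
    have : c ≠ 0 := by omega
    exact_mod_cast this
  have hcZ : (c : ℤ) ≠ 0 := by exact_mod_cast hc
  set τ : ℍ := ⟨24 * z, by simpa using hz⟩ with hτ
  have h4 := (summable_prod_eisSummand (k := 4) (by norm_num) τ).norm
  have hinj : Function.Injective fun p : ℤ × ℤ => ((c : ℤ) * p.1, (c : ℤ) * p.2 + a) := by
    rintro ⟨l, m⟩ ⟨l', m'⟩ h
    simp only [Prod.mk.injEq, add_left_inj, mul_eq_mul_left_iff, hcZ, or_false] at h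
    exact Prod.ext h.1 h.2
  have h5 := (h4.comp_injective hinj).mul_left (16 * z.im / π * ‖(c : ℂ)‖ ^ 4)
  refine Summable.of_norm_bounded h5 fun p => (norm_latticeTerm_le ha hac hz p).trans
    (le_of_eq ?_)
  have hp : EisensteinSeries.eisSummand (4 : ℕ) ![(c : ℤ) * p.1, (c : ℤ) * p.2 + a] τ
      = (((c : ℂ) * latticePoint a c z p) ^ 4)⁻¹ := by
    rw [EisensteinSeries.eisSummand, zpow_neg, zpow_natCast]
    congr 2
    simp only [Matrix.cons_val_zero, Matrix.cons_val_one, hτ, latticePoint]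
    push_cast
    field_simp
    ring
  simp only [Function.comp_apply, hp, norm_inv, norm_pow, norm_mul]
  have : ‖(c : ℂ)‖ ≠ 0 := norm_ne_zero_iff.2 hc
  field_simp

/-! ### The completed generating function as a quotient of lattice sums -/

lemma cos_div_sin_sq (w : ℂ) :
    Complex.cos (π * w) / Complex.sin (π * w) ^ 2 = -2 * e (w / 2) * (1 + e w) / (1 - e w) ^ 2 := by
  have hs : e w = e (w / 2) ^ 2 := by rw [pow_two, ← e_add, add_halves]
  have hs0 := e_ne_zero (w / 2)
  have h1 : cexp (π * w * I) = e (w / 2) := by unfold e; ring_nf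
  have h2 : cexp (-(π * w) * I) = (e (w / 2))⁻¹ := by rw [← e_neg]; unfold e; ring_nf
  rw [Complex.cos, Complex.sin, h1, h2, hs]
  set s := e (w / 2)
  have h3 : s⁻¹ - s = (1 - s ^ 2) / s := by field_simp
  have h4 : ((s⁻¹ - s) * I / 2) ^ 2 = -((1 - s ^ 2) ^ 2 / (4 * s ^ 2)) := by
    rw [h3]
    linear_combination ((1 - s ^ 2) ^ 2 / s ^ 2 / 4) * I_sq
  rw [h4]
  by_cases h : 1 - s ^ 2 = 0
  · rw [h]
    simp
  · field_simp
    ring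

lemma simpleTerm_add_doubleTerm {a c : ℕ} (ha : 0 < a) (hac : a < c) {Q : ℂ} (hQ0 : Q ≠ 0)
    (hQ : ‖Q‖ < 1) (n : ℤ) :
    simpleTerm a c Q n + 2 * e ((a : ℂ) / c) * doubleTerm a c Q n
      = (-1) ^ (n + 1) * Q ^ (n * (3 * n + 1) / 2) * (1 + e ((a : ℂ) / c) * Q ^ n)
        / (1 - e ((a : ℂ) / c) * Q ^ n) ^ 2 := by
  have hd : 1 - e ((a : ℂ) / c) * Q ^ n ≠ 0 := by
    have := gap_mul_le_norm (norm_e_ratCast a c) hQ0 le_rfl hQ n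
    exact norm_pos_iff.1 ((mul_pos (gap_pos (e_ratCast_ne_one ha hac))
      (sub_pos.2 hQ)).trans_le this)
  have hexp : 3 * n * (n + 1) / 2 = n * (3 * n + 1) / 2 + n := by
    rw [show 3 * n * (n + 1) = n * (3 * n + 1) + n * 2 by ring,
      Int.add_mul_ediv_right _ _ two_ne_zero]
  rw [simpleTerm, doubleTerm, hexp, zpow_add₀ hQ0]
  field_simp
  ring

lemma two_mul_simple_exponent (n : ℤ) :
    (2 : ℂ) * ((n * (3 * n + 1) / 2 : ℤ) : ℂ) = n * (3 * n + 1) := by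
  have h : 2 ∣ n * (3 * n + 1) := by
    rcases Int.even_or_odd n with h | h
    · exact (even_iff_two_dvd.1 h).mul_right _
    · refine Dvd.dvd.mul_left ?_ _
      obtain ⟨k, rfl⟩ := h
      exact ⟨3 * k + 2, by ring⟩
  have := Int.mul_ediv_cancel' h
  exact_mod_cast this

lemma row_holomorphic {a c : ℕ} (ha : 0 < a) (hac : a < c) {z : ℂ} (hz : 0 < z.im) (l : ℤ) :
    (-1) ^ l * e (36 * l ^ 2 * z) * (π ^ 2 * Complex.cos (π * ((a : ℂ) / c + 24 * l * z))
        / Complex.sin (π * ((a : ℂ) / c + 24 * l * z)) ^ 2)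
      = 2 * π ^ 2 * e ((a : ℂ) / (2 * c)) * (simpleTerm a c (e z ^ 24) l
        + 2 * e ((a : ℂ) / c) * doubleTerm a c (e z ^ 24) l) := by
  have hQ0 : e z ^ 24 ≠ 0 := pow_ne_zero _ (e_ne_zero z)
  have hQ : ∀ n : ℤ, (e z ^ 24) ^ n = e (24 * n * z) := by
    intro n
    rw [← e_nat_mul, ← e_int_mul]
    push_cast
    ring_nf
  rw [simpleTerm_add_doubleTerm ha hac hQ0 (norm_e_pow_lt_one hz), mul_div_assoc, cos_div_sin_sq,
    hQ, hQ, e_add]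
  have h1 : e (36 * l ^ 2 * z) * e (((a : ℂ) / c + 24 * l * z) / 2)
      = e ((a : ℂ) / (2 * c)) * e (24 * ((l * (3 * l + 1) / 2 : ℤ) : ℂ) * z) := by
    rw [← e_add, ← e_add]
    congr 1
    linear_combination (-12 * z) * two_mul_simple_exponent l
  have h2 : (-1 : ℂ) ^ (l + 1) = -(-1) ^ l := by
    rw [zpow_add₀ (by norm_num), zpow_one]; ring
  rw [h2]
  linear_combination (-2 * (-1) ^ l * π ^ 2 * (1 + e ((a : ℂ) / c) * e (24 * l * z))
    / (1 - e ((a : ℂ) / c) * e (24 * l * z)) ^ 2) * h1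

lemma hasSum_row_holomorphic {a c : ℕ} (ha : 0 < a) (hac : a < c) (z : ℍ) :
    HasSum (fun l : ℤ => (-1) ^ l * e (36 * l ^ 2 * z)
        * (π ^ 2 * Complex.cos (π * ((a : ℂ) / c + 24 * l * z))
        / Complex.sin (π * ((a : ℂ) / c + 24 * l * z)) ^ 2))
      (4 * π ^ 2 * etaTheta z * holPart a c z) := by
  have hz := z.im_pos
  have hQ0 : e z ^ 24 ≠ 0 := pow_ne_zero _ (e_ne_zero z)
  have hQ := norm_e_pow_lt_one hz
  have h := (((summable_simpleTerm ha hac hQ0 hQ).hasSum.add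
    ((summable_doubleTerm ha hac hQ0 hQ).hasSum.mul_left (2 * e ((a : ℂ) / c)))).mul_left
      (2 * π ^ 2 * e ((a : ℂ) / (2 * c))))
  have hval : 4 * π ^ 2 * etaTheta z * holPart a c z = 2 * π ^ 2 * e ((a : ℂ) / (2 * c)) *
      (∑' n, simpleTerm a c (e z ^ 24) n
        + 2 * e ((a : ℂ) / c) * ∑' n, doubleTerm a c (e z ^ 24) n) := by
    rw [etaTheta_eq_mul_qPoch hz, holPart, R2]
    have h1 := qPoch_ne_zero hQ
    have h2 := e_ne_zero z
    have h3 : e (3 * (a : ℂ) / (2 * c)) = e ((a : ℂ) / (2 * c)) * e ((a : ℂ) / c) := by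
      rw [← e_add]
      congr 1
      ring
    rw [h3]
    field_simp
    ring
  rw [hval]
  exact h.congr_fun fun l => row_holomorphic ha hac hz l

/-- Summands of the double series of non-holomorphic contributions of the rows. -/
noncomputable def rowTail (a c : ℕ) (z : ℂ) (l k : ℤ) : ℂ :=
  (-1) ^ l * e (36 * l ^ 2 * z) * (e ((2 * k + 1) * ((a : ℂ) / c + 24 * l * z) / 2)
    * (Real.exp (-4 * π * (2 * k + 1) ^ 2 * z.im) * gammaFactor (2 * k + 1) z.im : ℝ))

/-- Completing the square: with `m = 2 k + 1`, one has `36 l² + 12 l m = (6 l + m)² - m²`. -/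
lemma rowTail_eq (a c : ℕ) (z : ℂ) (l k : ℤ) :
    rowTail a c z l k = (e ((2 * k + 1) * ((a : ℂ) / c) / 2) * e (-((2 * k + 1) ^ 2 * conj z))
      * gammaFactor (2 * k + 1) z.im) * ((-1) ^ l * e ((6 * l + (2 * k + 1 : ℤ)) ^ 2 * z)) := by
  have hconj : conj z = z - 2 * z.im * I := by
    apply Complex.ext
    · simp
    · simp; ring
  have h : e (36 * l ^ 2 * z) * (e ((2 * k + 1) * ((a : ℂ) / c + 24 * l * z) / 2)
      * (Real.exp (-4 * π * (2 * k + 1) ^ 2 * z.im) : ℝ))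
      = e ((2 * k + 1) * ((a : ℂ) / c) / 2) * e (-((2 * k + 1) ^ 2 * conj z))
        * e ((6 * l + (2 * k + 1 : ℤ)) ^ 2 * z) := by
    rw [hconj]
    unfold e
    push_cast
    rw [← Complex.exp_add, ← Complex.exp_add, ← Complex.exp_add, ← Complex.exp_add]
    congr 1
    linear_combination (-4 * π * (2 * (k : ℂ) + 1) ^ 2 * z.im) * I_sq
  rw [rowTail]
  push_cast at h ⊢
  linear_combination ((-1) ^ l * gammaFactor (2 * k + 1) z.im : ℂ) * h

lemma summable_rowTail (a c : ℕ) {z : ℂ} (hz : 0 < z.im) :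
    Summable fun p : ℤ × ℤ => rowTail a c z p.1 p.2 := by
  have hπ := Real.pi_pos
  have h1 : Summable fun l : ℤ => Real.exp (-24 * π * l ^ 2 * z.im) := by
    refine (summable_exp_linear_sub_sq (α := 24 * π * z.im) (by positivity) 0).congr fun l => ?_
    congr 1
    ring
  have h2 : Summable fun k : ℤ => Real.exp (-2 * π * (2 * k + 1) ^ 2 * (z.im / 2))
      * (2 * (2 * z.im) ^ (-(1 / 2) : ℝ)) := (summable_exp_odd_sq (half_pos hz)).mul_right _
  have h3 := h1.mul_of_nonneg h2 (fun _ => (Real.exp_pos _).le) (fun _ => by positivity)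
  refine Summable.of_norm_bounded h3 ?_
  rintro ⟨l, k⟩
  have hu : ‖e ((2 * (k : ℂ) + 1) * ((a : ℂ) / c) / 2)‖ = 1 := by
    have := norm_e_ofReal ((2 * k + 1) * (a / c) / 2); push_cast at this; exact this
  have hg : ‖e ((6 * (l : ℂ) + (2 * k + 1 : ℤ)) ^ 2 * z)‖
      = Real.exp (-2 * π * (6 * l + (2 * k + 1)) ^ 2 * z.im) := by
    rw [← norm_e_ofReal_mul]
    push_cast
    rfl
  rw [rowTail_eq, norm_mul, norm_mul, norm_mul, norm_mul, hu, hg, norm_neg_one_zpow,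
    norm_e_neg_odd_sq_mul_conj, norm_real, Real.norm_of_nonneg (gammaFactor_nonneg _ hz), one_mul,
    one_mul, mul_right_comm, ← Real.exp_add, ← mul_assoc, ← Real.exp_add]
  refine mul_le_mul (Real.exp_le_exp.2 ?_) (gammaFactor_le _ hz) (gammaFactor_nonneg _ hz)
    (Real.exp_pos _).le
  -- `(6 l + m)² + m² - (12 l² + m² / 2) = 3 (4 l + m)² / 2` with `m = 2 k + 1`
  have h4 : 0 ≤ π * z.im * (4 * l + (2 * k + 1)) ^ 2 := by positivity
  nlinarith

lemma summable_e_odd_mul_gammaFactor {z : ℂ} (hz : 0 < z.im) (s : ℝ) :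
    Summable fun k : ℤ => e ((2 * k + 1) * s)
      * (e (-((2 * k + 1) ^ 2 * conj z)) * gammaFactor (2 * k + 1) z.im) := by
  refine Summable.of_norm_bounded ((summable_exp_odd_sq hz).mul_right
    (2 * (2 * z.im) ^ (-(1 / 2) : ℝ))) fun k => ?_
  have hu : ‖e ((2 * (k : ℂ) + 1) * s)‖ = 1 := by
    have := norm_e_ofReal ((2 * k + 1) * s); push_cast at this; exact this
  rw [norm_mul, norm_mul, hu, one_mul, norm_e_neg_odd_sq_mul_conj, norm_real,
    Real.norm_of_nonneg (gammaFactor_nonneg _ hz)]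
  exact mul_le_mul_of_nonneg_left (gammaFactor_le _ hz) (Real.exp_pos _).le

lemma shiftedEta_two_mul_add_one (k : ℤ) (z : ℂ) :
    shiftedEta (2 * k + 1) z
      = (e ((2 * k + 1) / 12) + e (-((2 * k + 1) / 12))) / Real.sqrt 3 * etaTheta z := by
  have e1 : cexp (π * ((2 * k + 1 : ℤ) : ℂ) / 6 * I) = e ((2 * k + 1) / 12) := by
    unfold e; push_cast; ring_nf
  have e2 : cexp (-(π * ((2 * k + 1 : ℤ) : ℂ) / 6) * I) = e (-((2 * k + 1) / 12)) := by
    unfold e; push_cast; ring_nf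
  rw [shiftedEta_of_odd (m := 2 * k + 1) ⟨k, rfl⟩ z, Complex.cos, e1, e2]
  ring

lemma gammaFactor_neg (m : ℤ) (y : ℝ) : gammaFactor (-m) y = gammaFactor m y := by
  simp [gammaFactor]

/-- The substitution `2 k + 1 ↦ -(2 k + 1)`. -/
lemma tsum_e_odd_mul_gammaFactor_neg (z : ℂ) (s : ℝ) :
    ∑' k : ℤ, e ((2 * k + 1) * s)
      * (e (-((2 * k + 1) ^ 2 * conj z)) * gammaFactor (2 * k + 1) z.im)
      = ∑' k : ℤ, e ((2 * k + 1) * (-s : ℝ))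
        * (e (-((2 * k + 1) ^ 2 * conj z)) * gammaFactor (2 * k + 1) z.im) := by
  rw [← (Equiv.subLeft (-1 : ℤ)).tsum_eq]
  refine tsum_congr fun k => ?_
  simp only [Equiv.subLeft_apply]
  have hg : gammaFactor (2 * (-1 - k) + 1) z.im = gammaFactor (2 * k + 1) z.im := by
    rw [show 2 * (-1 - k) + 1 = -(2 * k + 1) by ring, gammaFactor_neg]
  have h1 : (2 * ((-1 - k : ℤ) : ℂ) + 1) * s = (2 * k + 1) * (-s : ℝ) := by push_cast; ring
  have h2 : (2 * ((-1 - k : ℤ) : ℂ) + 1) ^ 2 = (2 * k + 1) ^ 2 := by push_cast; ring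
  rw [hg, h1, h2]

/-- Summation over the rows `l` first produces `η(24 z)`, by `shiftedEta_of_odd`. -/
lemma tsum_rowTail_left (a c : ℕ) (z : ℂ) (k : ℤ) :
    ∑' l : ℤ, rowTail a c z l k
      = etaTheta z / Real.sqrt 3 * (e ((2 * k + 1) * (1 / 12 + a / c / 2 : ℝ))
          * (e (-((2 * k + 1) ^ 2 * conj z)) * gammaFactor (2 * k + 1) z.im)
        + e ((2 * k + 1) * (-(1 / 12 - a / c / 2) : ℝ))
          * (e (-((2 * k + 1) ^ 2 * conj z)) * gammaFactor (2 * k + 1) z.im)) := by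
  have e1 : e ((2 * k + 1) * (1 / 12 + a / c / 2 : ℝ))
      = e ((2 * k + 1) * ((a : ℂ) / c) / 2) * e ((2 * k + 1) / 12) := by
    rw [← e_add]
    congr 1
    push_cast
    ring
  have e2 : e ((2 * k + 1) * (-(1 / 12 - a / c / 2) : ℝ))
      = e ((2 * k + 1) * ((a : ℂ) / c) / 2) * e (-((2 * k + 1) / 12)) := by
    rw [← e_add]
    congr 1
    push_cast
    ring
  have h := shiftedEta_two_mul_add_one k z
  rw [shiftedEta] at h
  rw [tsum_congr fun l => rowTail_eq a c z l k, tsum_mul_left, h, e1, e2]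
  ring

lemma dualCoeff_eq (a c : ℕ) (k : ℤ) :
    dualCoeff a c k = e ((2 * k + 1) * (1 / 12 + a / c / 2 : ℝ))
      + e ((2 * k + 1) * (1 / 12 - a / c / 2 : ℝ)) := by
  rw [dualCoeff, mul_add, ← e_add, ← e_add]
  congr 2
  · push_cast
    ring
  · push_cast
    ring

lemma tsum_rowTail (a c : ℕ) {z : ℂ} (hz : 0 < z.im) :
    ∑' l : ℤ, ∑' k : ℤ, rowTail a c z l k = etaTheta z / Real.sqrt 3 *
      ∑' k : ℤ, dualCoeff a c k * e (-((2 * k + 1) ^ 2 * conj z))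
        * gammaFactor (2 * k + 1) z.im := by
  have h1 := summable_e_odd_mul_gammaFactor hz (1 / 12 + a / c / 2)
  have h2 := summable_e_odd_mul_gammaFactor hz (1 / 12 - a / c / 2)
  have h3 := summable_e_odd_mul_gammaFactor hz (-(1 / 12 - a / c / 2))
  have hcomm : ∑' l : ℤ, ∑' k : ℤ, rowTail a c z l k = ∑' k : ℤ, ∑' l : ℤ, rowTail a c z l k :=
    (Summable.tsum_comm (f := rowTail a c z) (summable_rowTail a c hz)).symm
  rw [hcomm, tsum_congr (tsum_rowTail_left a c z), tsum_mul_left, h1.tsum_add h3,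
    ← tsum_e_odd_mul_gammaFactor_neg z, ← h1.tsum_add h2]
  congr 1
  refine tsum_congr fun k => ?_
  rw [dualCoeff_eq]
  ring

/-- The completed generating function is a quotient of the lattice sum by the theta series of
`η(24 z)`. -/
theorem latticeSum_eq {a c : ℕ} (ha : 0 < a) (hac : a < c) (z : ℍ) :
    latticeSum a c z = 4 * π ^ 2 * etaTheta z * completed a c z := by
  have hz := z.im_pos
  have hs := summable_latticeTerm ha hac hz
  have hrow : ∀ l : ℤ, ∑' m : ℤ, latticeTerm a c z (l, m)
      = (-1) ^ l * e (36 * l ^ 2 * z) * (π ^ 2 * Complex.cos (π * ((a : ℂ) / c + 24 * l * z))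
        / Complex.sin (π * ((a : ℂ) / c + 24 * l * z)) ^ 2)
        - π / Real.sqrt 8 * ∑' k : ℤ, rowTail a c z l k := by
    intro l
    simp only [latticeTerm, latticePoint, rowTail]
    rw [tsum_mul_left, tsum_mul_left, coe_im, tsum_row hz (latticePoint_row_mem ha hac hz l)]
    ring
  rw [latticeSum, hs.tsum_prod]
  simp_rw [hrow]
  have hB := ((summable_rowTail a c hz).prod).mul_left (π / Real.sqrt 8 : ℂ)
  have hA := hasSum_row_holomorphic ha hac z
  rw [hA.summable.tsum_sub hB, hA.tsum_eq, tsum_mul_left, tsum_rowTail a c hz, completed,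
    nonholPart_eq a (by omega) z, coe_im]
  have h3 : (Real.sqrt 3 : ℂ) ≠ 0 := by
    rw [Ne, ofReal_eq_zero]; positivity
  have h8 : (Real.sqrt 8 : ℂ) ≠ 0 := by
    rw [Ne, ofReal_eq_zero]; positivity
  have h88 : (Real.sqrt 8 : ℂ) ^ 2 = 8 := by
    rw [← ofReal_pow, Real.sq_sqrt (by norm_num)]; norm_num
  have hπ : (π : ℂ) ≠ 0 := by exact_mod_cast Real.pi_ne_zero
  generalize (∑' k : ℤ, dualCoeff a c k * e (-((2 * k + 1) ^ 2 * conj (z : ℂ)))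
    * gammaFactor (2 * k + 1) z.im) = T
  field_simp
  linear_combination (4 * T * etaTheta z) * h88

/-! ### Modularity of the lattice sum -/

/-- The form of the summand that only involves `W` through `|W|²` and `W²`. -/
lemma latticeTerm_eq (a c : ℕ) {z : ℂ} (hz : 0 < z.im) (p : ℤ × ℤ) :
    latticeTerm a c z p
      = e ((p.1 + p.2 - 3 * p.1 * p.2 - 3 * p.1 * ((a : ℂ) / c)) / 2)
        * ((Real.exp (-(π * ‖latticePoint a c z p‖ ^ 2 / (16 * z.im))) : ℝ)
          / latticePoint a c z p ^ 2) := by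
  have hWi := latticePoint_im a c z p
  have hW : latticePoint a c z p = ((a : ℂ) / c + 24 * p.1 * z) + p.2 := rfl
  set W := latticePoint a c z p
  have hn : ((‖W‖ ^ 2 : ℝ) : ℂ) = W ^ 2 - 48 * p.1 * z.im * I * W := by
    have h1 : ((‖W‖ ^ 2 : ℝ) : ℂ) = W * conj W := by
      rw [mul_conj, normSq_eq_norm_sq]
    have h2 : conj W = W - 2 * W.im * I := by
      apply Complex.ext
      · simp
      · simp; ring
    rw [h1, h2, hWi]
    push_cast
    ring
  have hy : (z.im : ℂ) ≠ 0 := by exact_mod_cast hz.ne'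
  have key : cexp (-π * W ^ 2 / (16 * z.im))
      = e (-(3 * p.1 * W) / 2) * (Real.exp (-(π * ‖W‖ ^ 2 / (16 * z.im))) : ℝ) := by
    have h : ((-(π * ‖W‖ ^ 2 / (16 * z.im)) : ℝ) : ℂ)
        = -(π * (W ^ 2 - 48 * p.1 * z.im * I * W) / (16 * z.im)) := by
      rw [← hn]
      push_cast
      ring
    rw [ofReal_exp, h]
    unfold e
    rw [← Complex.exp_add]
    congr 1
    field_simp
    ring
  have hph : e ((p.1 + p.2 - 3 * p.1 * p.2 - 3 * p.1 * ((a : ℂ) / c)) / 2)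
      = (-1) ^ p.1 * (-1) ^ p.2 * (e (36 * p.1 ^ 2 * z) * e (-(3 * p.1 * W) / 2)) := by
    rw [← e_intCast_div_two, ← e_intCast_div_two, ← e_add, ← e_add, ← e_add, hW]
    congr 1
    ring
  rw [latticeTerm, key, hph]
  ring

/-- The cocycle computation for the lattice points: the lattice point of index `p` at the
transformed point is the one of index `q` at `z`, divided by the automorphy factor. -/
lemma latticePoint_moebius {a c : ℕ} {α β γ δ : ℤ} {z : ℂ} (hj : (γ : ℂ) * z + δ ≠ 0)
    {p q : ℤ × ℤ} (h1 : (24 * q.1 : ℂ) = 24 * α * p.1 + γ * p.2 + γ * ((a : ℂ) / c))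
    (h2 : (q.2 : ℂ) = 24 * β * p.1 + δ * p.2 + (δ - 1) * ((a : ℂ) / c)) :
    latticePoint a c ((α * z + β) / (γ * z + δ)) p
      = latticePoint a c z q / (γ * z + δ) := by
  simp only [latticePoint]
  rw [h1, h2, eq_div_iff hj]
  linear_combination (24 * p.1 : ℂ) * div_mul_cancel₀ ((α : ℂ) * z + β) hj

/-- The phase `e((λ + μ - 3 λ μ - 3 λ u) / 2)` is unchanged because the index moves by even integers
`2 A`, `2 B` with `3 A u` an integer. -/
lemma latticeTerm_moebius {a c : ℕ} {α β γ δ : ℤ} (hdet : α * δ - β * γ = 1) {z : ℂ}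
    (hz : 0 < z.im) (hj : (γ : ℂ) * z + δ ≠ 0) {p q : ℤ × ℤ}
    (h1 : (24 * q.1 : ℂ) = 24 * α * p.1 + γ * p.2 + γ * ((a : ℂ) / c))
    (h2 : (q.2 : ℂ) = 24 * β * p.1 + δ * p.2 + (δ - 1) * ((a : ℂ) / c))
    {A B C : ℤ} (hA : q.1 = p.1 + 2 * A) (hB : q.2 = p.2 + 2 * B)
    (hC : 3 * (A : ℂ) * ((a : ℂ) / c) = C) :
    latticeTerm a c ((α * z + β) / (γ * z + δ)) p = (γ * z + δ) ^ 2 * latticeTerm a c z q := by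
  have hz' := im_moebius_pos hdet hz
  rw [latticeTerm_eq a c hz', latticeTerm_eq a c hz, latticePoint_moebius hj h1 h2,
    im_moebius hdet, norm_div, normSq_eq_norm_sq]
  have hph : e ((q.1 + q.2 - 3 * q.1 * q.2 - 3 * q.1 * ((a : ℂ) / c)) / 2)
      = e ((p.1 + p.2 - 3 * p.1 * p.2 - 3 * p.1 * ((a : ℂ) / c)) / 2) := by
    rw [← e_add_intCast ((p.1 + p.2 - 3 * p.1 * p.2 - 3 * p.1 * ((a : ℂ) / c)) / 2)
      (A + B - 3 * (p.1 * B + A * p.2 + 2 * A * B) - C), hA, hB]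
    congr 1
    push_cast
    rw [← hC]
    ring
  have hjn : ‖(γ : ℂ) * z + δ‖ ≠ 0 := norm_ne_zero_iff.2 hj
  have hexp : π * (‖latticePoint a c z q‖ / ‖(γ : ℂ) * z + δ‖) ^ 2
      / (16 * (z.im / ‖(γ : ℂ) * z + δ‖ ^ 2)) = π * ‖latticePoint a c z q‖ ^ 2 / (16 * z.im) := by
    field_simp
  rw [hph, hexp, div_pow]
  field_simp

/-- The affine bijection of `ℤ²` with matrix `(α, h; b, δ)` of determinant one. -/
def affineEquiv (α h b δ s t : ℤ) (hdet : α * δ - b * h = 1) : ℤ × ℤ ≃ ℤ × ℤ where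
  toFun p := (α * p.1 + h * p.2 + s, b * p.1 + δ * p.2 + t)
  invFun q := (δ * (q.1 - s) - h * (q.2 - t), α * (q.2 - t) - b * (q.1 - s))
  left_inv p := by
    ext
    · linear_combination p.1 * hdet
    · linear_combination p.2 * hdet
  right_inv q := by
    ext
    · linear_combination (q.1 - s) * hdet
    · linear_combination (q.2 - t) * hdet

/-- The lattice sum has weight 2: an element of `Γ₁(96 d_c²)` permutes the points of the shifted
lattice and preserves the phases of the summands. -/
theorem latticeSum_moebius (a : ℕ) {c : ℕ} (hc : 0 < c) {α β γ δ : ℤ} (hdet : α * δ - β * γ = 1)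
    (hα : (96 * (dc c : ℤ) ^ 2) ∣ α - 1) (hγ : (96 * (dc c : ℤ) ^ 2) ∣ γ)
    (hδ : (96 * (dc c : ℤ) ^ 2) ∣ δ - 1) {z : ℂ} (hz : 0 < z.im) :
    latticeSum a c ((α * z + β) / (γ * z + δ)) = (γ * z + δ) ^ 2 * latticeSum a c z := by
  obtain ⟨D, hD⟩ := dvd_dc c
  obtain ⟨r, hr⟩ := hα
  obtain ⟨g, hg⟩ := hγ
  obtain ⟨s, hs⟩ := hδ
  have hc0 : (c : ℂ) ≠ 0 := by exact_mod_cast hc.ne'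
  have hj : (γ : ℂ) * z + δ ≠ 0 := by
    refine linear_ne_zero ?_ hz
    by_contra h
    push Not at h
    rw [h.1, h.2] at hdet
    simp at hdet
  have hα' : α = 1 + 96 * (c * D) ^ 2 * r := by
    rw [hD] at hr; push_cast at hr; linear_combination hr
  have hδ' : δ = 1 + 96 * (c * D) ^ 2 * s := by
    rw [hD] at hs; push_cast at hs; linear_combination hs
  have hγ' : γ = 24 * (4 * (c * D) ^ 2 * g) := by
    rw [hD] at hg; push_cast at hg; linear_combination hg
  set σ := affineEquiv α (4 * (c * D) ^ 2 * g) (24 * β) δ (4 * (c * D) * D * g * a)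
    (96 * (c * D) * D * s * a) (by rw [← hdet, hγ']; ring) with hσ
  rw [latticeSum, latticeSum, ← σ.tsum_eq (latticeTerm a c z), ← tsum_mul_left]
  refine tsum_congr fun p => ?_
  refine latticeTerm_moebius hdet hz hj ?_ ?_
    (A := 48 * (c * D) ^ 2 * r * p.1 + 2 * (c * D) ^ 2 * g * p.2 + 2 * (c * D) * D * g * a)
    (B := 12 * β * p.1 + 48 * (c * D) ^ 2 * s * p.2 + 48 * (c * D) * D * s * a)
    (C := 3 * a * (48 * c * D ^ 2 * r * p.1 + 2 * c * D ^ 2 * g * p.2 + 2 * D ^ 2 * g * a)) ?_ ?_ ?_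
  · simp only [hσ, affineEquiv, Equiv.coe_fn_mk]
    rw [hγ']
    push_cast
    field_simp
  · simp only [hσ, affineEquiv, Equiv.coe_fn_mk]
    rw [hδ']
    push_cast
    field_simp
    ring
  · simp only [hσ, affineEquiv, Equiv.coe_fn_mk]
    rw [hα']
    ring
  · simp only [hσ, affineEquiv, Equiv.coe_fn_mk]
    rw [hδ']
    ring
  · push_cast
    field_simp

/-! ### The transformation law of the completed function -/

lemma etaTheta_ne_zero {z : ℂ} (hz : 0 < z.im) : etaTheta z ≠ 0 := by
  rw [etaTheta_eq_mul_qPoch hz]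
  exact mul_ne_zero (e_ne_zero z) (qPoch_ne_zero (norm_e_pow_lt_one hz))

lemma shimuraSymbol_trichotomy (c d : ℤ) :
    shimuraSymbol c d = 0 ∨ shimuraSymbol c d = 1 ∨ shimuraSymbol c d = -1 := by
  unfold shimuraSymbol
  have := jacobiSym.trichotomy c d.natAbs
  split_ifs <;> omega

lemma entries_of_mem_Gamma1 {N : ℕ} {A : SL(2, ℤ)} (hA : A ∈ CongruenceSubgroup.Gamma1 N) :
    (N : ℤ) ∣ A 0 0 - 1 ∧ (N : ℤ) ∣ A 1 0 ∧ (N : ℤ) ∣ A 1 1 - 1 := by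
  rw [CongruenceSubgroup.Gamma1_mem] at hA
  obtain ⟨h1, h2, h3⟩ := hA
  refine ⟨?_, ?_, ?_⟩
  · rw [← ZMod.intCast_zmod_eq_zero_iff_dvd]; push_cast; rw [h1, sub_self]
  · rw [← ZMod.intCast_zmod_eq_zero_iff_dvd]; exact h3
  · rw [← ZMod.intCast_zmod_eq_zero_iff_dvd]; push_cast; rw [h2, sub_self]

/-- The quotient of the weight 2 law of the lattice sum by the weight `1/2` law of `η(24 z)`. -/
lemma completed_smul {a c : ℕ} (ha : 0 < a) (hac : a < c) {A : SL(2, ℤ)}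
    (hA : A ∈ CongruenceSubgroup.Gamma1 (96 * dc c ^ 2)) (z : ℍ) :
    completed a c (A • z) = ((shimuraSymbol (A 1 0) (A 1 1) : ℤ) : ℂ) ^ (3 : ℤ)
      * ((A 1 0 : ℂ) * (z : ℂ) + (A 1 1 : ℂ)) ^ ((3 : ℂ) / 2) * completed a c z := by
  have hz := z.im_pos
  obtain ⟨h1, h2, h3⟩ := entries_of_mem_Gamma1 hA
  push_cast at h1 h2 h3
  have hdet : A 0 0 * A 1 1 - A 0 1 * A 1 0 = 1 := by
    have := A.det_coe
    rwa [Matrix.det_fin_two] at this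
  have h3456 : (3456 : ℤ) ∣ 96 * (dc c : ℤ) ^ 2 := by
    obtain ⟨k, hk⟩ := six_dvd_dc c
    exact ⟨k ^ 2, by rw [hk]; push_cast; ring⟩
  have hL := latticeSum_moebius a (ha.trans hac) hdet h1 h2 h3 hz
  have hE := etaTheta_moebius hdet (h3456.trans h2) (h3456.trans h1) (h3456.trans h3) hz
  have hcoe : ((A • z : ℍ) : ℂ) = ((A 0 0 : ℂ) * z + A 0 1) / (A 1 0 * z + A 1 1) := by
    rw [UpperHalfPlane.coe_specialLinearGroup_apply]
    simp
  rw [← hcoe] at hL hE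
  have hj : (A 1 0 : ℂ) * z + A 1 1 ≠ 0 := by
    refine linear_ne_zero ?_ hz
    by_contra h
    push Not at h
    rw [h.1, h.2] at hdet
    simp at hdet
  have hE0 := etaTheta_ne_zero (A • z).im_pos
  have hE1 := etaTheta_ne_zero hz
  -- the symbol cannot vanish, since `η(24 z)` has no zeros
  have hs : ((shimuraSymbol (A 1 0) (A 1 1) : ℤ) : ℂ) ^ 2 = 1 := by
    rcases shimuraSymbol_trichotomy (A 1 0) (A 1 1) with h | h | h
    · rw [hE, h] at hE0
      simp at hE0
    · rw [h]; simp
    · rw [h]; simp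
  have hpow : ((A 1 0 : ℂ) * z + A 1 1) ^ 2 = ((A 1 0 : ℂ) * z + A 1 1) ^ ((3 : ℂ) / 2)
      * ((A 1 0 : ℂ) * z + A 1 1) ^ ((1 : ℂ) / 2) := by
    rw [← cpow_add _ _ hj, ← cpow_natCast]
    norm_num
  rw [latticeSum_eq ha hac, latticeSum_eq ha hac, hE, hpow] at hL
  have hπ : (π : ℂ) ≠ 0 := by exact_mod_cast Real.pi_ne_zero
  have hhalf : ((A 1 0 : ℂ) * z + A 1 1) ^ ((1 : ℂ) / 2) ≠ 0 := by
    rw [Ne, cpow_eq_zero_iff]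
    exact fun h => hj h.1
  have hX : 4 * π ^ 2 * ((A 1 0 : ℂ) * z + A 1 1) ^ ((1 : ℂ) / 2) * etaTheta z ≠ 0 := by
    exact mul_ne_zero (mul_ne_zero (mul_ne_zero (by norm_num) (pow_ne_zero 2 hπ)) hhalf) hE1
  refine mul_left_cancel₀ hX ?_
  rw [zpow_ofNat]
  linear_combination (shimuraSymbol (A 1 0) (A 1 1) : ℂ) * hL
    - (4 * π ^ 2 * ((A 1 0 : ℂ) * z + A 1 1) ^ ((1 : ℂ) / 2) * etaTheta z
      * (completed a c (A • z) + shimuraSymbol (A 1 0) (A 1 1) *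
        ((A 1 0 : ℂ) * z + A 1 1) ^ ((3 : ℂ) / 2) * completed a c z)) * hs

lemma Gamma1_le_Gamma0_four (c : ℕ) :
    CongruenceSubgroup.Gamma1 (96 * dc c ^ 2) ≤ CongruenceSubgroup.Gamma0 4 := by
  intro A hA
  obtain ⟨-, h2, -⟩ := entries_of_mem_Gamma1 hA
  rw [CongruenceSubgroup.Gamma0_mem, ZMod.intCast_zmod_eq_zero_iff_dvd]
  refine Dvd.dvd.trans ⟨24 * (dc c : ℤ) ^ 2, ?_⟩ h2
  push_cast
  ring

lemma epsilon_of_mem_Gamma1 {c : ℕ} {A : SL(2, ℤ)}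
    (hA : A ∈ CongruenceSubgroup.Gamma1 (96 * dc c ^ 2)) : epsilon (A 1 1) = 1 := by
  obtain ⟨-, -, ⟨k, hk⟩⟩ := entries_of_mem_Gamma1 hA
  rw [epsilon, if_pos]
  push_cast at hk
  have : A 1 1 = 1 + 4 * (24 * (dc c : ℤ) ^ 2 * k) := by linear_combination hk
  omega

/-! ### Calculus of the non-holomorphic series -/

lemma integrableOn_exp_mul_rpow (m : ℤ) {y : ℝ} (hy : 0 < y) :
    IntegrableOn (fun s : ℝ => Real.exp (-2 * π * m ^ 2 * s) * s ^ (-(3 / 2) : ℝ))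
      (Set.Ioi y) := by
  refine Integrable.mono' (integrableOn_Ioi_rpow_of_lt (by norm_num : (-(3 / 2) : ℝ) < -1) hy) ?_ ?_
  · refine ContinuousOn.aestronglyMeasurable ?_ measurableSet_Ioi
    refine ContinuousOn.mul (by fun_prop) ?_
    exact ContinuousOn.rpow_const continuousOn_id fun t ht => Or.inl (hy.trans ht).ne'
  · refine (ae_restrict_iff' measurableSet_Ioi).2 (Filter.Eventually.of_forall fun t ht => ?_)
    have ht : 0 < t := hy.trans ht
    rw [Real.norm_of_nonneg (by positivity)]
    refine mul_le_of_le_one_left (by positivity) ?_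
    rw [Real.exp_le_one_iff]
    have : 0 ≤ 2 * π * (m : ℝ) ^ 2 * t := by have := Real.pi_pos; positivity
    linarith

lemma gammaFactor_eq (m : ℤ) (y : ℝ) :
    gammaFactor m y = Real.exp (4 * π * m ^ 2 * y)
      * ∫ s in Set.Ioi (2 * y), Real.exp (-2 * π * m ^ 2 * s) * s ^ (-(3 / 2) : ℝ) := by
  have h := (measurePreserving_add_left (volume : Measure ℝ) (2 * y)).setIntegral_preimage_emb
    (measurableEmbedding_addLeft (2 * y))
    (fun s : ℝ => Real.exp (-2 * π * m ^ 2 * s) * s ^ (-(3 / 2) : ℝ)) (Set.Ioi (2 * y))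
  have hpre : (fun t : ℝ => 2 * y + t) ⁻¹' Set.Ioi (2 * y) = Set.Ioi 0 := by
    ext t; simp
  rw [hpre] at h
  rw [← h, ← integral_const_mul, gammaFactor]
  refine setIntegral_congr_fun measurableSet_Ioi fun t _ => ?_
  rw [← mul_assoc, ← Real.exp_add]
  ring_nf

/-- The derivative comes from the form `exp(4 π m² y) ∫_{2y}^∞ exp(-2 π m² s) s^(-3/2) ds`. -/
lemma hasDerivAt_gammaFactor (m : ℤ) {y : ℝ} (hy : 0 < y) :
    HasDerivAt (gammaFactor m)
      (4 * π * m ^ 2 * gammaFactor m y - 2 * (2 * y) ^ (-(3 / 2) : ℝ)) y := by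
  set f : ℝ → ℝ := fun s => Real.exp (-2 * π * m ^ 2 * s) * s ^ (-(3 / 2) : ℝ) with hf
  have hfi : ∀ x : ℝ, 0 < x → IntegrableOn f (Set.Ioi x) := fun x hx =>
    integrableOn_exp_mul_rpow m hx
  have hcont : ∀ x : ℝ, 0 < x → ContinuousAt f x := fun x hx =>
    ContinuousAt.mul (by fun_prop) (continuousAt_id.rpow_const (Or.inl hx.ne'))
  have htail : HasDerivAt (fun x => ∫ s in Set.Ioi x, f s) (-f (2 * y)) (2 * y) := by
    have hii : IntervalIntegrable f volume y (2 * y) := by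
      refine ContinuousOn.intervalIntegrable fun x hx => (hcont x ?_).continuousWithinAt
      rw [Set.uIcc_of_le (by linarith)] at hx
      exact hy.trans_le hx.1
    have h1 := (intervalIntegral.integral_hasDerivAt_right hii
      (ContinuousAt.stronglyMeasurableAtFilter isOpen_Ioi (fun x hx => hcont x hx) (2 * y)
        (by simpa using hy)) (hcont _ (by linarith))).const_sub (∫ s in Set.Ioi y, f s)
    refine h1.congr_of_eventuallyEq ?_
    filter_upwards [lt_mem_nhds (show y < 2 * y by linarith)] with x hx
    rw [← intervalIntegral.integral_Ioi_sub_Ioi (hfi y hy) hx.le]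
    ring
  have h2 : HasDerivAt (fun y : ℝ => 2 * y) 2 y := by simpa using (hasDerivAt_id y).const_mul 2
  have h3 : HasDerivAt (fun y : ℝ => Real.exp (4 * π * m ^ 2 * y))
      (Real.exp (4 * π * m ^ 2 * y) * (4 * π * m ^ 2)) y := by
    have := ((hasDerivAt_id y).const_mul (4 * π * (m : ℝ) ^ 2)).exp
    simpa using this
  have h4 := h3.mul (HasDerivAt.comp y htail h2)
  have h5 : gammaFactor m = (fun y : ℝ => Real.exp (4 * π * m ^ 2 * y))
      * ((fun x => ∫ s in Set.Ioi x, f s) ∘ fun y : ℝ => 2 * y) :=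
    funext fun y => gammaFactor_eq m y
  rw [h5]
  refine h4.congr_deriv ?_
  have h6 : Real.exp (4 * π * m ^ 2 * y) * Real.exp (-2 * π * m ^ 2 * (2 * y)) = 1 := by
    rw [← Real.exp_add, ← Real.exp_zero]
    ring_nf
  simp only [Pi.mul_apply, Function.comp_apply, hf]
  linear_combination (-2 * (2 * y) ^ (-(3 / 2) : ℝ)) * h6

/-- Coefficient sequences indexed by the odd integers `2k + 1`, of at most polynomial growth. -/
def PolyGrowth (a : ℤ → ℂ) : Prop :=
  ∃ (C : ℝ) (p : ℕ), ∀ k : ℤ, ‖a k‖ ≤ C * ((2 * (k : ℝ) + 1) ^ 2) ^ p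

/-- Coefficients of the holomorphic derivative of `∑ a_k e(-(2k+1)² z)`. -/
noncomputable def derivCoeff (a : ℤ → ℂ) (k : ℤ) : ℂ := -2 * π * I * (2 * k + 1) ^ 2 * a k

lemma PolyGrowth.derivCoeff {a : ℤ → ℂ} (ha : PolyGrowth a) : PolyGrowth (derivCoeff a) := by
  obtain ⟨C, p, h⟩ := ha
  refine ⟨2 * π * C, p + 1, fun k => ?_⟩
  have h1 : TwistedRank.derivCoeff a k
      = ((-2 * π * (2 * k + 1) ^ 2 : ℝ) : ℂ) * (I * a k) := by
    rw [TwistedRank.derivCoeff]; push_cast; ring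
  have h2 : |(-2 * π * (2 * (k : ℝ) + 1) ^ 2 : ℝ)| = 2 * π * (2 * (k : ℝ) + 1) ^ 2 := by
    rw [abs_of_nonpos]
    · ring
    · have : 0 ≤ π * (2 * (k : ℝ) + 1) ^ 2 := by have := Real.pi_pos; positivity
      linarith
  rw [h1, norm_mul, norm_mul, Complex.norm_I, one_mul, norm_real, Real.norm_eq_abs, h2]
  calc _ ≤ 2 * π * (2 * (k : ℝ) + 1) ^ 2 * (C * ((2 * (k : ℝ) + 1) ^ 2) ^ p) := by
        refine mul_le_mul_of_nonneg_left (h k) ?_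
        have := Real.pi_pos
        positivity
    _ = _ := by ring

lemma polyGrowth_dualCoeff (a c : ℕ) (s : ℂ) : PolyGrowth fun k => s * dualCoeff a c k := by
  refine ⟨‖s‖ * 2, 0, fun k => ?_⟩
  rw [norm_mul, pow_zero, mul_one]
  exact mul_le_mul_of_nonneg_left (norm_dualCoeff_le a c k) (norm_nonneg _)

lemma PolyGrowth.summable {a : ℤ → ℂ} (ha : PolyGrowth a) {ε : ℝ} (hε : 0 < ε) :
    Summable fun k : ℤ => ‖a k‖ * Real.exp (-2 * π * (2 * k + 1) ^ 2 * ε) := by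
  obtain ⟨C, p, h⟩ := ha
  have hπ := Real.pi_pos
  have hC : 0 ≤ C := by
    have := (norm_nonneg _).trans (h 0)
    simpa using this
  refine Summable.of_nonneg_of_le (fun k => by positivity) (fun k => ?_)
    ((summable_exp_odd_sq (half_pos hε)).mul_left (C * (p.factorial / (π * ε) ^ p)))
  set x := (2 * (k : ℝ) + 1) ^ 2 with hx
  have hx0 : 0 ≤ x := by positivity
  have h1 := Real.pow_div_factorial_le_exp (π * ε * x) (by positivity) p
  have h2 : x ^ p ≤ p.factorial / (π * ε) ^ p * Real.exp (π * ε * x) := by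
    rw [mul_pow, div_le_iff₀ (by positivity)] at h1
    rw [div_mul_eq_mul_div, le_div_iff₀ (by positivity)]
    linarith
  calc ‖a k‖ * Real.exp (-2 * π * x * ε)
      ≤ C * (p.factorial / (π * ε) ^ p * Real.exp (π * ε * x)) * Real.exp (-2 * π * x * ε) := by
        refine mul_le_mul_of_nonneg_right ((h k).trans ?_) (Real.exp_pos _).le
        exact mul_le_mul_of_nonneg_left h2 hC
    _ = C * (p.factorial / (π * ε) ^ p)
        * (Real.exp (π * ε * x) * Real.exp (-2 * π * x * ε)) := by ring
    _ = _ := by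
        rw [← Real.exp_add]
        congr 2
        ring

/-- The antiholomorphic series `∑ a_k e(-(2k+1)² z̄)`. -/
noncomputable def antiholSeries (a : ℤ → ℂ) (z : ℂ) : ℂ :=
  ∑' k : ℤ, a k * e (-((2 * k + 1) ^ 2 * conj z))

/-- The series `∑ a_k e(-(2k+1)² z̄) K_{2k+1}(y)`, with `K` the incomplete Gamma factor. -/
noncomputable def nonholSeries (a : ℤ → ℂ) (z : ℂ) : ℂ :=
  ∑' k : ℤ, a k * e (-((2 * k + 1) ^ 2 * conj z)) * gammaFactor (2 * k + 1) z.im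

/-- The differential `dz̄` on `ℂ`. -/
noncomputable def dzBar : ℂ →L[ℝ] ℂ := conjCLE.toContinuousLinearMap

/-- The differential `dy` on `ℂ`, with complex values. -/
noncomputable def dy : ℂ →L[ℝ] ℂ := ofRealCLM.comp imCLM

lemma dzBar_apply (v : ℂ) : dzBar v = conj v := rfl

lemma dy_apply (v : ℂ) : dy v = v.im := rfl

/-- The differential of `v` is `dz̄ = dz - 2 i dy`. -/
lemma dzBar_eq : dzBar = 1 - (2 * I) • dy := by
  ext v
  simp only [dzBar_apply, sub_apply, smul_apply, dy_apply,
    one_apply_eq_self, smul_eq_mul]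
  apply Complex.ext
  · simp
  · simp; ring

lemma hasFDerivAt_antihol_exp (s : ℂ) (z : ℂ) :
    HasFDerivAt (fun z => e (-(s * conj z))) ((-2 * π * I * s * e (-(s * conj z))) • dzBar) z := by
  have h1 : HasFDerivAt (fun z : ℂ => conj z) dzBar z := dzBar.hasFDerivAt
  have h2 : HasDerivAt (fun w : ℂ => e (-(s * w))) (-2 * π * I * s * e (-(s * conj z)))
      (conj z) := by
    have h : HasDerivAt (fun w : ℂ => e (-(s * w)))
        (cexp (2 * π * I * -(s * conj z)) * (2 * π * I * -(s * 1))) (conj z) :=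
      ((((hasDerivAt_id (conj z)).const_mul s).neg).const_mul (2 * π * I)).cexp
    refine h.congr_deriv ?_
    unfold e
    ring
  have h3 := (h2.hasFDerivAt.restrictScalars ℝ).comp z h1
  refine h3.congr_fderiv ?_
  ext v
  simp [dzBar_apply]
  ring

lemma isOpen_im_gt (ε : ℝ) : IsOpen {z : ℂ | ε < z.im} :=
  isOpen_lt continuous_const Complex.continuous_im

lemma summable_antiholSeries {a : ℤ → ℂ} (ha : PolyGrowth a) {z : ℂ} (hz : 0 < z.im) :
    Summable fun k : ℤ => a k * e (-((2 * k + 1) ^ 2 * conj z)) := by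
  refine Summable.of_norm ((ha.summable hz).congr fun k => ?_)
  rw [norm_mul, norm_e_neg_odd_sq_mul_conj]

lemma summable_nonholSeries {a : ℤ → ℂ} (ha : PolyGrowth a) {z : ℂ} (hz : 0 < z.im) :
    Summable fun k : ℤ => a k * e (-((2 * k + 1) ^ 2 * conj z)) * gammaFactor (2 * k + 1) z.im := by
  refine Summable.of_norm_bounded ((ha.summable hz).mul_right (2 * (2 * z.im) ^ (-(1 / 2) : ℝ)))
    fun k => ?_
  rw [norm_mul, norm_mul, norm_e_neg_odd_sq_mul_conj, norm_real,
    Real.norm_of_nonneg (gammaFactor_nonneg _ hz)]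
  exact mul_le_mul_of_nonneg_left (gammaFactor_le _ hz) (by positivity)

lemma hasFDerivAt_antiholSeries {a : ℤ → ℂ} (ha : PolyGrowth a) {z : ℂ} (hz : 0 < z.im) :
    HasFDerivAt (antiholSeries a) (antiholSeries (derivCoeff a) z • dzBar) z := by
  have hε := half_pos hz
  have hu := (ha.derivCoeff.summable hε).mul_right ‖dzBar‖
  have h := hasFDerivAt_tsum_of_isPreconnected (𝕜 := ℝ) hu (isOpen_im_gt (z.im / 2))
    (convex_halfSpace_im_gt (z.im / 2)).isPreconnected
    (f := fun (k : ℤ) z => a k * e (-((2 * k + 1) ^ 2 * conj z)))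
    (f' := fun (k : ℤ) z => (derivCoeff a k * e (-((2 * k + 1) ^ 2 * conj z))) • dzBar)
    (fun k w _ => ?_) (fun k w hw => ?_) (half_lt_self hz) (summable_antiholSeries ha hz)
    (half_lt_self hz)
  · refine h.congr_fderiv ?_
    exact ((summable_antiholSeries ha.derivCoeff hz).hasSum.smul_const dzBar).tsum_eq
  · refine ((hasFDerivAt_antihol_exp _ w).const_mul (a k)).congr_fderiv ?_
    rw [smul_smul, derivCoeff]
    ring_nf
  · rw [norm_smul, norm_mul, norm_e_neg_odd_sq_mul_conj]
    refine mul_le_mul_of_nonneg_right (mul_le_mul_of_nonneg_left (Real.exp_le_exp.2 ?_)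
      (norm_nonneg _)) (norm_nonneg _)
    have hw : z.im / 2 < w.im := hw
    have h2 : 0 ≤ 2 * π * (2 * (k : ℝ) + 1) ^ 2 := by have := Real.pi_pos; positivity
    nlinarith

/-- The real factor `-2 (2y)^(-3/2)` occurring in the `∂/∂z̄`-derivative. -/
noncomputable def edgeFactor (z : ℂ) : ℂ := ((-2 * (2 * z.im) ^ (-(3 / 2) : ℝ) : ℝ) : ℂ)

/-- Since `dz̄ = dz - 2 i dy`, the derivative of the exponential has a `dy`-term, which cancels
the part proportional to `m²` in the derivative of the incomplete gamma factor; only the boundary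
term of the integral remains along `dy`. -/
lemma hasFDerivAt_nonholTerm (k : ℤ) {z : ℂ} (hz : 0 < z.im) :
    HasFDerivAt (fun z : ℂ => e (-((2 * k + 1) ^ 2 * conj z)) * gammaFactor (2 * k + 1) z.im)
      ((-2 * π * I * (2 * k + 1) ^ 2 * e (-((2 * k + 1) ^ 2 * conj z))
          * gammaFactor (2 * k + 1) z.im) • (1 : ℂ →L[ℝ] ℂ)
        + (edgeFactor z * e (-((2 * k + 1) ^ 2 * conj z))) • dy) z := by
  have h1 := hasFDerivAt_antihol_exp ((2 * (k : ℂ) + 1) ^ 2) z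
  have h2 := (hasDerivAt_gammaFactor (2 * k + 1) hz).hasFDerivAt.comp z imCLM.hasFDerivAt
  have h3 := ofRealCLM.hasFDerivAt.comp z h2
  have h4 := h1.mul h3
  refine h4.congr_fderiv ?_
  rw [dzBar_eq]
  ext v
  simp [dy_apply, edgeFactor]
  ring_nf
  rw [I_sq]
  ring

lemma hasFDerivAt_nonholSeries {a : ℤ → ℂ} (ha : PolyGrowth a) {z : ℂ} (hz : 0 < z.im) :
    HasFDerivAt (nonholSeries a) (nonholSeries (derivCoeff a) z • (1 : ℂ →L[ℝ] ℂ)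
      + (edgeFactor z * antiholSeries a z) • dy) z := by
  have hε := half_pos hz
  have hu := (((ha.derivCoeff.summable hε).mul_right (2 * z.im ^ (-(1 / 2) : ℝ))).mul_right
    ‖(1 : ℂ →L[ℝ] ℂ)‖).add (((ha.summable hε).mul_right (2 * z.im ^ (-(3 / 2) : ℝ))).mul_right ‖dy‖)
  have h := hasFDerivAt_tsum_of_isPreconnected (𝕜 := ℝ) hu (isOpen_im_gt (z.im / 2))
    (convex_halfSpace_im_gt (z.im / 2)).isPreconnected
    (f := fun (k : ℤ) z => a k * e (-((2 * k + 1) ^ 2 * conj z)) * gammaFactor (2 * k + 1) z.im)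
    (f' := fun (k : ℤ) z => (derivCoeff a k * e (-((2 * k + 1) ^ 2 * conj z))
        * gammaFactor (2 * k + 1) z.im) • (1 : ℂ →L[ℝ] ℂ)
        + (edgeFactor z * (a k * e (-((2 * k + 1) ^ 2 * conj z)))) • dy)
    (fun k w hw => ?_) (fun k w hw => ?_) (half_lt_self hz) (summable_nonholSeries ha hz)
    (half_lt_self hz)
  · refine h.congr_fderiv ?_
    exact (((summable_nonholSeries ha.derivCoeff hz).hasSum.smul_const _).add
      (((summable_antiholSeries ha hz).hasSum.mul_left _).smul_const _)).tsum_eq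
  · have hw : 0 < w.im := hε.trans hw
    have h2 := (hasFDerivAt_nonholTerm k hw).const_mul (a k)
    simp_rw [← mul_assoc] at h2
    refine h2.congr_fderiv ?_
    rw [smul_add, smul_smul, smul_smul, derivCoeff]
    ring_nf
  · have hw : z.im / 2 < w.im := hw
    have hw0 : 0 < w.im := hε.trans hw
    have hexp : Real.exp (-2 * π * (2 * k + 1) ^ 2 * w.im)
        ≤ Real.exp (-2 * π * (2 * k + 1) ^ 2 * (z.im / 2)) := by
      refine Real.exp_le_exp.2 ?_
      have h2 : 0 ≤ 2 * π * (2 * (k : ℝ) + 1) ^ 2 := by have := Real.pi_pos; positivity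
      nlinarith
    refine (norm_add_le _ _).trans (add_le_add ?_ ?_)
    · rw [norm_smul, norm_mul, norm_mul, norm_e_neg_odd_sq_mul_conj, norm_real,
        Real.norm_of_nonneg (gammaFactor_nonneg _ hw0)]
      refine mul_le_mul_of_nonneg_right (mul_le_mul (mul_le_mul_of_nonneg_left hexp
        (norm_nonneg _)) ((gammaFactor_le _ hw0).trans ?_) (gammaFactor_nonneg _ hw0)
        (by positivity)) (norm_nonneg _)
      exact mul_le_mul_of_nonneg_left
        (Real.rpow_le_rpow_of_nonpos hz (by linarith) (by norm_num)) two_pos.le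
    · rw [norm_smul, norm_mul, norm_mul, norm_e_neg_odd_sq_mul_conj, edgeFactor, norm_real,
        mul_comm ‖_‖ (_ * _)]
      refine mul_le_mul_of_nonneg_right (mul_le_mul (mul_le_mul_of_nonneg_left hexp
        (norm_nonneg _)) ?_ (norm_nonneg _) (by positivity)) (norm_nonneg _)
      rw [norm_mul, norm_neg, Real.norm_of_nonneg (by positivity : (0 : ℝ) ≤ 2),
        Real.norm_of_nonneg (by positivity)]
      exact mul_le_mul_of_nonneg_left
        (Real.rpow_le_rpow_of_nonpos hz (by linarith) (by norm_num)) two_pos.le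

lemma contDiffOn_edgeFactor {n : ℕ∞ω} : ContDiffOn ℝ n edgeFactor {z : ℂ | 0 < z.im} := by
  refine ofRealCLM.contDiff.comp_contDiffOn ?_
  refine contDiffOn_const.mul ?_
  refine ContDiffOn.rpow_const_of_ne ?_ fun z hz => ?_
  · exact contDiffOn_const.mul imCLM.contDiff.contDiffOn
  · have hz : 0 < z.im := hz
    positivity

lemma contDiffOn_antiholSeries {a : ℤ → ℂ} (ha : PolyGrowth a) (n : ℕ) :
    ContDiffOn ℝ n (antiholSeries a) {z : ℂ | 0 < z.im} := by
  induction n generalizing a with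
  | zero => exact contDiffOn_zero.2 fun z hz =>
      (hasFDerivAt_antiholSeries ha hz).continuousAt.continuousWithinAt
  | succ n ih =>
    push_cast
    refine (contDiffOn_succ_iff_fderiv_of_isOpen (isOpen_im_gt 0)).2 ⟨fun z hz =>
      (hasFDerivAt_antiholSeries ha hz).differentiableAt.differentiableWithinAt, by simp, ?_⟩
    refine ((ih ha.derivCoeff).smul (contDiffOn_const (c := dzBar))).congr fun z hz => ?_
    exact (hasFDerivAt_antiholSeries ha hz).fderiv

/-- The class of these series is closed under differentiation, up to `y^(-3/2)` times
antiholomorphic series; this gives all orders of differentiability by induction. -/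
lemma contDiffOn_nonholSeries {a : ℤ → ℂ} (ha : PolyGrowth a) (n : ℕ) :
    ContDiffOn ℝ n (nonholSeries a) {z : ℂ | 0 < z.im} := by
  induction n generalizing a with
  | zero => exact contDiffOn_zero.2 fun z hz =>
      (hasFDerivAt_nonholSeries ha hz).continuousAt.continuousWithinAt
  | succ n ih =>
    push_cast
    refine (contDiffOn_succ_iff_fderiv_of_isOpen (isOpen_im_gt 0)).2 ⟨fun z hz =>
      (hasFDerivAt_nonholSeries ha hz).differentiableAt.differentiableWithinAt, by simp, ?_⟩
    refine (((ih ha.derivCoeff).smul (contDiffOn_const (c := (1 : ℂ →L[ℝ] ℂ)))).add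
      ((contDiffOn_edgeFactor.mul (contDiffOn_antiholSeries ha n)).smul
        (contDiffOn_const (c := dy)))).congr fun z hz => ?_
    exact (hasFDerivAt_nonholSeries ha hz).fderiv

/-! ### Smoothness and harmonicity -/

lemma hasFDerivAt_hol_add_nonhol {h : ℂ → ℂ} (hh : DifferentiableOn ℂ h {z : ℂ | 0 < z.im})
    {a : ℤ → ℂ} (ha : PolyGrowth a) {z : ℂ} (hz : 0 < z.im) :
    HasFDerivAt (fun z => h z + nonholSeries a z)
      ((deriv h z + nonholSeries (derivCoeff a) z) • (1 : ℂ →L[ℝ] ℂ)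
        + (edgeFactor z * antiholSeries a z) • dy) z := by
  have h1 := ((hh.differentiableAt ((isOpen_im_gt 0).mem_nhds hz)).hasDerivAt).complexToReal_fderiv
  refine (h1.add (hasFDerivAt_nonholSeries ha hz)).congr_fderiv ?_
  ext v
  simp
  ring

lemma hasFDerivAt_edgeFactor {z : ℂ} (hz : 0 < z.im) :
    HasFDerivAt edgeFactor (((6 * (2 * z.im) ^ (-(5 / 2) : ℝ) : ℝ) : ℂ) • dy) z := by
  have h2 : HasDerivAt (fun y : ℝ => -2 * (2 * y) ^ (-(3 / 2) : ℝ))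
      (6 * (2 * z.im) ^ (-(5 / 2) : ℝ)) z.im := by
    have h : HasDerivAt (fun y : ℝ => -2 * (2 * y) ^ (-(3 / 2) : ℝ))
        (-2 * (2 * 1 * -(3 / 2) * (2 * z.im) ^ (-(3 / 2) - 1 : ℝ))) z.im :=
      (((hasDerivAt_id z.im).const_mul 2).rpow_const (p := -(3 / 2))
        (Or.inl (by simpa using hz.ne'))).const_mul (-2)
    refine h.congr_deriv ?_
    norm_num
    ring
  have h3 := ofRealCLM.hasFDerivAt.comp z (h2.hasFDerivAt.comp z imCLM.hasFDerivAt)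
  refine h3.congr_fderiv ?_
  ext v
  simp [dy_apply]
  ring

/-- The sum of a holomorphic function and a series `∑ a_k e(-(2k+1)² z̄) K_{2k+1}(y)` is
annihilated by the weight `3/2` Laplacian: its `∂/∂z̄`-derivative is `y^(-3/2)` times an
antiholomorphic function. -/
theorem hypLaplacian_hol_add_nonhol {h : ℂ → ℂ}
    (hh : DifferentiableOn ℂ h {z : ℂ | 0 < z.im}) {a : ℤ → ℂ} (ha : PolyGrowth a) {f : ℂ → ℂ}
    (hf : ∀ z : ℂ, 0 < z.im → f z = h z + nonholSeries a z) {z : ℂ} (hz : 0 < z.im) :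
    hypLaplacian (3 / 2) f z = 0 := by
  have hU := isOpen_im_gt 0
  have hev : ∀ {F G : ℂ → ℂ}, (∀ w : ℂ, 0 < w.im → F w = G w) → ∀ {w : ℂ}, 0 < w.im →
      F =ᶠ[nhds w] G := fun h w hw => Filter.eventuallyEq_of_mem (hU.mem_nhds hw) h
  have hfd : ∀ w : ℂ, 0 < w.im → fderiv ℝ f w
      = (deriv h w + nonholSeries (derivCoeff a) w) • (1 : ℂ →L[ℝ] ℂ)
        + (edgeFactor w * antiholSeries a w) • dy := fun w hw =>
    ((hasFDerivAt_hol_add_nonhol hh ha hw).congr_of_eventuallyEq (hev hf hw)).fderiv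
  have hX : ∀ w : ℂ, 0 < w.im →
      partialX f w = deriv h w + nonholSeries (derivCoeff a) w := by
    intro w hw
    rw [partialX, hfd w hw]
    simp [dy_apply]
  have hY : ∀ w : ℂ, 0 < w.im →
      partialY f w = I * (deriv h w + nonholSeries (derivCoeff a) w)
        + edgeFactor w * antiholSeries a w := by
    intro w hw
    rw [partialY, hfd w hw]
    simp [dy_apply]
    ring
  have hP := hasFDerivAt_hol_add_nonhol (hh.deriv hU) ha.derivCoeff hz
  have hB := (hasFDerivAt_edgeFactor hz).mul (hasFDerivAt_antiholSeries ha hz)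
  have hXX : partialX (partialX f) z
      = deriv (deriv h) z + nonholSeries (derivCoeff (derivCoeff a)) z := by
    rw [partialX, (hP.congr_of_eventuallyEq (hev hX hz)).fderiv]
    simp [dy_apply]
  have hYY : partialY (partialY f) z
      = I * (I * (deriv (deriv h) z + nonholSeries (derivCoeff (derivCoeff a)) z)
          + edgeFactor z * antiholSeries (derivCoeff a) z)
        + (edgeFactor z * (antiholSeries (derivCoeff a) z * -I)
          + antiholSeries a z * ((6 * (2 * z.im) ^ (-(5 / 2) : ℝ) : ℝ) : ℂ)) := by
    have := ((hP.const_mul I).add hB).congr_of_eventuallyEq (hev hY hz)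
    rw [partialY, this.fderiv]
    simp [dy_apply, dzBar_apply]
    ring
  have hpow : (2 * z.im) ^ (-(3 / 2) : ℝ) = (2 * z.im) * (2 * z.im) ^ (-(5 / 2) : ℝ) := by
    rw [← Real.rpow_one_add' (by positivity) (by norm_num)]
    norm_num
  rw [hypLaplacian, hXX, hYY, hX z hz, hY z hz, edgeFactor, hpow]
  push_cast
  have hI3 : I ^ 3 = -I := by rw [pow_succ, I_sq, neg_one_mul]
  ring_nf
  simp only [I_sq, hI3]
  ring

lemma completed_ofComplex (a : ℕ) {c : ℕ} (hc : 0 < c) {z : ℂ} (hz : 0 < z.im) :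
    (completed a c ∘ ofComplex) z = (e z)⁻¹ * R2 a c (e z ^ 24)
      + nonholSeries (fun k => -(Real.sqrt 8 / (32 * Real.sqrt 3 * π)) * dualCoeff a c k) z := by
  have h : ((ofComplex z : ℍ) : ℂ) = z := by rw [ofComplex_apply_of_im_pos hz]
  have h2 : (ofComplex z).im = z.im := by rw [← coe_im, h]
  rw [Function.comp_apply, completed, holPart, nonholPart_eq a hc, h, h2, nonholSeries,
    ← tsum_mul_left]
  congr 1
  refine tsum_congr fun k => ?_
  ring

lemma contDiffOn_completed {a c : ℕ} (ha : 0 < a) (hac : a < c) :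
    ContDiffOn ℝ ∞ (completed a c ∘ ofComplex) {z : ℂ | 0 < z.im} := by
  refine ContDiffOn.congr ?_ fun z hz => completed_ofComplex a (ha.trans hac) hz
  refine ContDiffOn.add ?_ (contDiffOn_infty.2 fun n =>
    contDiffOn_nonholSeries (polyGrowth_dualCoeff a c _) n)
  exact ((differentiableOn_holPart ha hac).contDiffOn (isOpen_im_gt 0)).restrict_scalars ℝ

lemma hypLaplacian_completed {a c : ℕ} (ha : 0 < a) (hac : a < c) (z : ℍ) :
    hypLaplacian (3 / 2) (completed a c ∘ ofComplex) z = 0 :=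
  hypLaplacian_hol_add_nonhol (differentiableOn_holPart ha hac) (polyGrowth_dualCoeff a c _)
    (fun _ hw => completed_ofComplex a (ha.trans hac) hw) z.im_pos

/-! ### Growth at the cusps -/

lemma one_sub_exp_neg_inv_le {x : ℝ} (hx : 0 < x) :
    (1 - Real.exp (-x))⁻¹ ≤ Real.exp (1 / x) := by
  have h1 : Real.exp (-x) ≤ (1 + x)⁻¹ := by
    rw [Real.exp_neg]
    exact inv_anti₀ (by linarith) (by linarith [Real.add_one_le_exp x])
  have h2 : x / (1 + x) ≤ 1 - Real.exp (-x) := by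
    have : x / (1 + x) = 1 - (1 + x)⁻¹ := by field_simp; ring
    linarith
  calc (1 - Real.exp (-x))⁻¹ ≤ (x / (1 + x))⁻¹ := inv_anti₀ (by positivity) h2
    _ = 1 / x + 1 := by field_simp
    _ ≤ _ := Real.add_one_le_exp _

lemma exp_neg_div_one_sub_le {x : ℝ} (hx : 0 < x) :
    Real.exp (-x) / (1 - Real.exp (-x)) ≤ 1 / x := by
  have h1 : Real.exp (-x) < 1 := Real.exp_lt_one_iff.2 (by linarith)
  have h2 : Real.exp (-x) * Real.exp x = 1 := by rw [← Real.exp_add]; simp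
  rw [div_le_div_iff₀ (by linarith) hx]
  nlinarith [Real.add_one_le_exp x, Real.exp_pos (-x)]

lemma norm_nonholPart_le (a : ℕ) {c : ℕ} (hc : 0 < c) :
    ∃ K : ℝ, 0 ≤ K ∧ ∀ z : ℍ, ‖nonholPart a c z‖ ≤ K * Real.exp (1 / z.im) := by
  set s : ℂ := -(Real.sqrt 8 / (32 * Real.sqrt 3 * π)) with hs
  refine ⟨‖s‖ * 8, by positivity, fun z => ?_⟩
  have hy := z.im_pos
  have hπ := Real.pi_pos
  set x := 2 * π * z.im with hx
  have hx0 : 0 < x := by positivity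
  have hr1 : Real.exp (-x) < 1 := Real.exp_lt_one_iff.2 (by linarith)
  have hS := ((hasSum_pow_natAbs (Real.exp_pos (-x)).le hr1).mul_left 2).mul_right
    (2 * (2 * z.im) ^ (-(1 / 2) : ℝ))
  have hb : ‖∑' k : ℤ, dualCoeff a c k * e (-((2 * k + 1) ^ 2 * conj (z : ℂ)))
      * gammaFactor (2 * k + 1) z.im‖ ≤ 2 * ((1 + Real.exp (-x)) / (1 - Real.exp (-x)))
        * (2 * (2 * z.im) ^ (-(1 / 2) : ℝ)) := by
    refine tsum_of_norm_bounded hS fun k => ?_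
    rw [norm_mul, norm_mul, norm_e_neg_odd_sq_mul_conj, norm_real,
      Real.norm_of_nonneg (gammaFactor_nonneg _ hy)]
    refine mul_le_mul (mul_le_mul (norm_dualCoeff_le a c k) ?_ (Real.exp_pos _).le two_pos.le)
      (gammaFactor_le _ hy) (gammaFactor_nonneg _ hy) (by positivity)
    rw [← Real.exp_nat_mul]
    refine Real.exp_le_exp.2 ?_
    have h1 : |k| ≤ (2 * k + 1) ^ 2 := abs_le.2 ⟨by nlinarith, by nlinarith⟩
    have h2 : (k.natAbs : ℝ) ≤ (2 * k + 1) ^ 2 := by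
      rw [Nat.cast_natAbs]
      exact_mod_cast h1
    rw [coe_im, hx]
    have h3 := mul_le_mul_of_nonneg_left h2 hx0.le
    rw [hx] at h3
    linarith
  have h1 : (1 + Real.exp (-x)) / (1 - Real.exp (-x)) ≤ 2 * Real.exp (1 / x) := by
    rw [div_eq_mul_inv]
    exact mul_le_mul (by linarith) (one_sub_exp_neg_inv_le hx0)
      (inv_nonneg.2 (by linarith)) two_pos.le
  have h2 : (2 * z.im) ^ (-(1 / 2) : ℝ) ≤ Real.exp (1 / (2 * z.im)) := by
    have h3 : (2 * z.im) ^ (-(1 / 2) : ℝ) = Real.sqrt (1 / (2 * z.im)) := by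
      rw [Real.sqrt_eq_rpow, Real.rpow_neg (by positivity), ← Real.inv_rpow (by positivity),
        one_div (2 * z.im)]
    have h4 : 0 < 1 / (2 * z.im) := by positivity
    rw [h3]
    refine le_trans ?_ (Real.add_one_le_exp _)
    rw [Real.sqrt_le_left (by positivity)]
    nlinarith
  rw [nonholPart_eq a hc, norm_mul]
  calc _ ≤ ‖s‖ * (2 * (2 * Real.exp (1 / x)) * (2 * Real.exp (1 / (2 * z.im)))) := by
        refine mul_le_mul_of_nonneg_left (hb.trans ?_) (norm_nonneg _)
        gcongr
    _ = ‖s‖ * 8 * Real.exp (1 / x + 1 / (2 * z.im)) := by rw [Real.exp_add]; ring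
    _ ≤ _ := by
        refine mul_le_mul_of_nonneg_left (Real.exp_le_exp.2 ?_) (by positivity)
        have : 1 / x ≤ 1 / (2 * z.im) := by
          refine one_div_le_one_div_of_le (by positivity) ?_
          rw [hx]
          nlinarith [Real.pi_gt_three]
        have h5 : 1 / (2 * z.im) + 1 / (2 * z.im) = 1 / z.im := by field_simp; norm_num
        linarith

lemma norm_holPart_le {a c : ℕ} (ha : 0 < a) (hac : a < c) :
    ∃ K C : ℝ, 0 ≤ K ∧ 0 ≤ C ∧ ∀ z : ℍ,
      ‖holPart a c z‖ ≤ K * Real.exp (C * (z.im + 1 / z.im)) := by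
  have hg := gap_pos (e_ratCast_ne_one ha hac)
  set g := gap (e ((a : ℂ) / c))
  set S : ℝ := ∑' k : ℕ, 1 / ((k : ℝ) + 1) ^ 2 with hS
  have hS0 : 0 ≤ S := tsum_nonneg fun k => by positivity
  have hπ := Real.pi_pos
  refine ⟨4 / g ^ 2, 50 * π + S + 3, by positivity, by positivity, fun z => ?_⟩
  have hy := z.im_pos
  set x := 48 * π * z.im with hx
  have hx0 : 0 < x := by positivity
  have hQ : ‖e z ^ 24‖ = Real.exp (-x) := by
    rw [norm_pow, norm_e, ← Real.exp_nat_mul, coe_im, hx]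
    push_cast
    ring_nf
  have hr1 : Real.exp (-x) < 1 := Real.exp_lt_one_iff.2 (by linarith)
  have hinv := one_sub_exp_neg_inv_le hx0
  have hP : ‖qPoch (e z ^ 24)‖⁻¹ ≤ Real.exp (S * (1 / x)) := by
    have h1 := exp_le_norm_qPoch (norm_e_pow_lt_one hy)
    rw [hQ, Real.exp_neg] at h1
    refine (inv_le_of_inv_le₀ (Real.exp_pos _) h1).trans (Real.exp_le_exp.2 ?_)
    exact mul_le_mul_of_nonneg_left (exp_neg_div_one_sub_le hx0) hS0
  have hR := norm_R2_le ha hac (pow_ne_zero 24 (e_ne_zero z)) (norm_e_pow_lt_one hy)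
  rw [hQ] at hR
  have hE : ‖(e (z : ℂ))⁻¹‖ = Real.exp (2 * π * z.im) := by
    rw [norm_inv, norm_e, ← Real.exp_neg, coe_im]
    ring_nf
  have hpos : 0 ≤ (1 - Real.exp (-x))⁻¹ := inv_nonneg.2 (by linarith)
  rw [holPart, norm_mul, hE]
  calc Real.exp (2 * π * z.im) * ‖R2 a c (e z ^ 24)‖
      ≤ Real.exp (2 * π * z.im) * (2 * Real.exp (S * (1 / x)) *
        ((Real.exp (-x))⁻¹ * (2 * (1 - Real.exp (-x))⁻¹) * (g⁻¹ * (1 - Real.exp (-x))⁻¹) ^ 2)) := by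
        refine mul_le_mul_of_nonneg_left (hR.trans ?_) (Real.exp_pos _).le
        rw [div_eq_mul_inv, ← inv_pow, mul_inv, div_eq_mul_inv 2]
        refine mul_le_mul_of_nonneg_right (mul_le_mul_of_nonneg_left hP two_pos.le) ?_
        positivity
    _ ≤ Real.exp (2 * π * z.im) * (2 * Real.exp (S * (1 / x)) *
        (Real.exp x * (2 * Real.exp (1 / x)) * (g⁻¹ * Real.exp (1 / x)) ^ 2)) := by
        rw [← Real.exp_neg, neg_neg]
        gcongr
    _ = 4 / g ^ 2 * Real.exp (2 * π * z.im + x + (S + 3) * (1 / x)) := by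
        rw [show 2 * π * z.im + x + (S + 3) * (1 / x)
          = 2 * π * z.im + x + S * (1 / x) + 1 / x + 1 / x + 1 / x by ring, Real.exp_add,
          Real.exp_add, Real.exp_add, Real.exp_add, Real.exp_add]
        field_simp
        norm_num
    _ ≤ _ := by
        refine mul_le_mul_of_nonneg_left (Real.exp_le_exp.2 ?_) (by positivity)
        have h1 : 1 / x ≤ 1 / z.im := by
          refine one_div_le_one_div_of_le hy ?_
          rw [hx]
          nlinarith [Real.pi_gt_three]
        have h2 : (S + 3) * (1 / x) ≤ (S + 3) * (1 / z.im) :=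
          mul_le_mul_of_nonneg_left h1 (by positivity)
        have h3 : 0 ≤ 50 * π * (1 / z.im) := by positivity
        have h4 : 0 ≤ (S + 3) * z.im := by positivity
        rw [hx] at h2 ⊢
        nlinarith

lemma norm_completed_le {a c : ℕ} (ha : 0 < a) (hac : a < c) :
    ∃ K C : ℝ, 0 ≤ K ∧ 0 ≤ C ∧ ∀ z : ℍ,
      ‖completed a c z‖ ≤ K * Real.exp (C * (z.im + 1 / z.im)) := by
  obtain ⟨K₁, C, hK₁, hC, h1⟩ := norm_holPart_le ha hac
  obtain ⟨K₂, hK₂, h2⟩ := norm_nonholPart_le a (ha.trans hac)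
  refine ⟨K₁ + K₂, C + 1, by positivity, by positivity, fun z => ?_⟩
  have hy := z.im_pos
  have hi : 0 < 1 / z.im := by positivity
  refine (norm_add_le _ _).trans ?_
  rw [add_mul]
  refine add_le_add ((h1 z).trans ?_) ((h2 z).trans ?_)
  · refine mul_le_mul_of_nonneg_left (Real.exp_le_exp.2 ?_) hK₁
    nlinarith
  · refine mul_le_mul_of_nonneg_left (Real.exp_le_exp.2 ?_) hK₂
    have : 0 ≤ C * (z.im + 1 / z.im) := by positivity
    linarith

lemma norm_cpow_three_halves (w : ℂ) (hw : w ≠ 0) : ‖w ^ ((3 : ℂ) / 2)‖ = ‖w‖ ^ (3 / 2 : ℝ) := by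
  rw [show (3 : ℂ) / 2 = ((3 / 2 : ℝ) : ℂ) by push_cast; rfl, norm_cpow_of_ne_zero hw]
  simp

lemma im_specialLinearGroup_smul (A : SL(2, ℤ)) (z : ℍ) :
    (A • z).im = z.im / ‖(A 1 0 : ℂ) * z + A 1 1‖ ^ 2 := by
  have hdet : A 0 0 * A 1 1 - A 0 1 * A 1 0 = 1 := by
    have := A.det_coe
    rwa [Matrix.det_fin_two] at this
  have hcoe : ((A • z : ℍ) : ℂ) = ((A 0 0 : ℂ) * z + A 0 1) / (A 1 0 * z + A 1 1) := by
    rw [UpperHalfPlane.coe_specialLinearGroup_apply]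
    simp
  rw [← coe_im, hcoe, im_moebius hdet, normSq_eq_norm_sq, coe_im]

lemma bottom_row_ne_zero (A : SL(2, ℤ)) (z : ℍ) : (A 1 0 : ℂ) * z + A 1 1 ≠ 0 := by
  have hdet : A 0 0 * A 1 1 - A 0 1 * A 1 0 = 1 := by
    have := A.det_coe
    rwa [Matrix.det_fin_two] at this
  refine linear_ne_zero ?_ z.im_pos
  by_contra h
  push Not at h
  rw [h.1, h.2] at hdet
  simp at hdet

/-- The function `|M(z)| y^(3/4)`, invariant under `Γ₁(96 d_c²)`. -/
noncomputable def petersson (a c : ℕ) (z : ℍ) : ℝ := ‖completed a c z‖ * z.im ^ (3 / 4 : ℝ)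

lemma im_smul_rpow (A : SL(2, ℤ)) (z : ℍ) :
    ‖(A 1 0 : ℂ) * z + A 1 1‖ ^ (3 / 2 : ℝ) * (A • z).im ^ (3 / 4 : ℝ) = z.im ^ (3 / 4 : ℝ) := by
  have hj := norm_pos_iff.2 (bottom_row_ne_zero A z)
  rw [im_specialLinearGroup_smul, Real.div_rpow z.im_pos.le (by positivity),
    ← Real.rpow_natCast ‖_‖ 2, ← Real.rpow_mul hj.le]
  norm_num
  field_simp

lemma petersson_smul_le {a c : ℕ} (ha : 0 < a) (hac : a < c) {B : SL(2, ℤ)}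
    (hB : B ∈ CongruenceSubgroup.Gamma1 (96 * dc c ^ 2)) (z : ℍ) :
    petersson a c (B • z) ≤ petersson a c z := by
  have hs : ‖((shimuraSymbol (B 1 0) (B 1 1) : ℤ) : ℂ) ^ (3 : ℤ)‖ ≤ 1 := by
    rcases shimuraSymbol_trichotomy (B 1 0) (B 1 1) with h | h | h <;> rw [h] <;> simp
  rw [petersson, petersson, completed_smul ha hac hB, norm_mul, norm_mul,
    norm_cpow_three_halves _ (bottom_row_ne_zero B z), ← im_smul_rpow B z]
  have h0 : 0 ≤ ‖(B 1 0 : ℂ) * z + B 1 1‖ ^ (3 / 2 : ℝ) * ‖completed a c z‖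
      * (B • z).im ^ (3 / 4 : ℝ) := by
    have := (B • z).im_pos
    positivity
  calc _ = ‖((shimuraSymbol (B 1 0) (B 1 1) : ℤ) : ℂ) ^ (3 : ℤ)‖
        * (‖(B 1 0 : ℂ) * z + B 1 1‖ ^ (3 / 2 : ℝ) * ‖completed a c z‖
          * (B • z).im ^ (3 / 4 : ℝ)) := by ring
    _ ≤ _ := mul_le_of_le_one_left h0 hs
    _ = _ := by ring

/-- Translation by multiples of the level does not increase `|M(Az)| Im(Az)^(3/4)`. -/
lemma petersson_translate {a c : ℕ} (ha : 0 < a) (hac : a < c) (A : SL(2, ℤ)) (n : ℤ) (z : ℍ) :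
    petersson a c (A • z)
      ≤ petersson a c (A • (ModularGroup.T ^ (((96 * dc c ^ 2 : ℕ) : ℤ) * n) • z)) := by
  set N : ℕ := 96 * dc c ^ 2 with hN
  have hT : ModularGroup.T ^ ((N : ℤ) * n) ∈ CongruenceSubgroup.Gamma N := by
    have := CongruenceSubgroup.ModularGroup_T_pow_mem_Gamma N (N * n) (dvd_mul_right _ _)
    simpa using this
  have hB : A * (ModularGroup.T ^ ((N : ℤ) * n))⁻¹ * A⁻¹ ∈ CongruenceSubgroup.Gamma1 N := by
    have h := (CongruenceSubgroup.Gamma_normal N).conj_mem _ (inv_mem hT) A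
    rw [CongruenceSubgroup.Gamma_mem] at h
    rw [CongruenceSubgroup.Gamma1_mem]
    exact ⟨h.1, h.2.2.2, h.2.2.1⟩
  have h := petersson_smul_le ha hac hB (A • (ModularGroup.T ^ ((N : ℤ) * n) • z))
  rwa [smul_smul, smul_smul, smul_smul, inv_mul_cancel_right, mul_assoc, inv_mul_cancel, mul_one,
    mul_smul] at h

lemma norm_slash_eq (a c : ℕ) (A : SL(2, ℤ)) (z : ℍ) :
    ‖((A 1 0 : ℂ) * (z : ℂ) + (A 1 1 : ℂ)) ^ (-((3 : ℂ) / 2)) * completed a c (A • z)‖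
      = z.im ^ (-(3 / 4) : ℝ) * petersson a c (A • z) := by
  have hj := norm_pos_iff.2 (bottom_row_ne_zero A z)
  have hj' : 0 < ‖(A 1 0 : ℂ) * z + A 1 1‖ ^ (3 / 2 : ℝ) := Real.rpow_pos_of_pos hj _
  have hy := Real.rpow_pos_of_pos z.im_pos (3 / 4)
  have h := im_smul_rpow A z
  rw [norm_mul, cpow_neg, norm_inv, norm_cpow_three_halves _ (bottom_row_ne_zero A z), petersson,
    Real.rpow_neg z.im_pos.le]
  field_simp
  rw [← h]
  ring

lemma norm_bottom_row_sq (A : SL(2, ℤ)) (z : ℍ) :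
    ‖(A 1 0 : ℂ) * z + A 1 1‖ ^ 2
      = ((A 1 0 : ℝ) * z.re + A 1 1) ^ 2 + ((A 1 0 : ℝ) * z.im) ^ 2 := by
  rw [← normSq_eq_norm_sq, normSq_apply]
  simp
  ring

/-- The translate `w` of `z` with `0 ≤ Re w ≤ N` has the same imaginary part and `|γ w + δ|²` is
between `1` and a multiple of `y²`, so that the crude bound for `M` at `A w` is exponential in
`y`. -/
lemma growth_completed {a c : ℕ} (ha : 0 < a) (hac : a < c) (A : SL(2, ℤ)) :
    ∃ C : ℝ, (fun z : ℍ => ((A 1 0 : ℂ) * (z : ℂ) + (A 1 1 : ℂ)) ^ (-((3 : ℂ) / 2))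
      * completed a c (A • z)) =O[atImInfty] fun z : ℍ => Real.exp (C * z.im) := by
  obtain ⟨K, C, hK, hC, hM⟩ := norm_completed_le ha hac
  set N : ℕ := 96 * dc c ^ 2 with hN
  have hN0 : (0 : ℝ) < N := by
    have := dc_pos (ha.trans hac)
    have : 0 < N := by positivity
    exact_mod_cast this
  set D : ℝ := (|(A 1 0 : ℝ)| * N + |(A 1 1 : ℝ)|) ^ 2 + (A 1 0 : ℝ) ^ 2 with hD
  refine ⟨C * (1 + D), Asymptotics.IsBigO.of_bound K ?_⟩
  refine (atImInfty_mem _).2 ⟨1, fun z hz => ?_⟩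
  change ‖_‖ ≤ K * ‖Real.exp (C * (1 + D) * z.im)‖
  rw [Real.norm_of_nonneg (Real.exp_pos _).le, norm_slash_eq]
  have hy := z.im_pos
  set n : ℤ := -⌊z.re / N⌋ with hn
  set w : ℍ := ModularGroup.T ^ (((N : ℕ) : ℤ) * n) • z with hw
  have hwc : (w : ℂ) = z + ((N * n : ℝ) : ℂ) := by
    rw [hw, UpperHalfPlane.modular_T_zpow_smul, UpperHalfPlane.coe_vadd]
    push_cast
    ring
  have hwim : w.im = z.im := by
    rw [← coe_im, hwc, add_im, ofReal_im, add_zero, coe_im]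
  have hwre : |w.re| ≤ N := by
    have h1 : w.re = z.re + N * n := by
      rw [← coe_re, hwc, add_re, ofReal_re, coe_re]
    have h2 : w.re = N * Int.fract (z.re / N) := by
      rw [h1, hn, Int.fract]
      push_cast
      field_simp
      ring
    rw [h2, abs_of_nonneg (mul_nonneg hN0.le (Int.fract_nonneg _))]
    exact mul_le_of_le_one_right hN0.le (Int.fract_lt_one _).le
  have hle := petersson_translate ha hac A n z
  rw [← hN, ← hw] at hle
  -- bounds for the imaginary part of `A w`
  have hj := norm_bottom_row_sq A w
  set J := ‖(A 1 0 : ℂ) * w + A 1 1‖ ^ 2 with hJ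
  have him : (A • w).im = z.im / J := by rw [im_specialLinearGroup_smul, hwim]
  have hJ1 : 1 ≤ J := by
    rw [hj, hwim]
    by_cases h0 : A 1 0 = 0
    · have hdet : A 0 0 * A 1 1 - A 0 1 * A 1 0 = 1 := by
        have := A.det_coe
        rwa [Matrix.det_fin_two] at this
      rw [h0, mul_zero, sub_zero] at hdet
      have h1 : A 1 1 ≠ 0 := by
        rintro h1
        rw [h1] at hdet
        simp at hdet
      have h2 : 1 ≤ (A 1 1) ^ 2 := by
        have := Int.one_le_abs h1
        rw [← sq_abs]
        nlinarith
      have h3 : (1 : ℝ) ≤ (A 1 1 : ℝ) ^ 2 := by exact_mod_cast h2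
      rw [h0]
      simpa using h3
    · have h2 : 1 ≤ (A 1 0) ^ 2 := by
        have := Int.one_le_abs h0
        rw [← sq_abs]
        nlinarith
      have h3 : (1 : ℝ) ≤ (A 1 0 : ℝ) ^ 2 := by exact_mod_cast h2
      have h4 : (1 : ℝ) ≤ ((A 1 0 : ℝ) * z.im) ^ 2 := by
        rw [mul_pow]
        have : 1 ≤ z.im ^ 2 := one_le_pow₀ hz
        nlinarith
      nlinarith [sq_nonneg ((A 1 0 : ℝ) * w.re + A 1 1)]
  have hJ2 : J ≤ D * z.im ^ 2 := by
    rw [hj, hwim, hD]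
    have h1 : |(A 1 0 : ℝ) * w.re + A 1 1| ≤ |(A 1 0 : ℝ)| * N + |(A 1 1 : ℝ)| := by
      refine (abs_add_le _ _).trans (add_le_add ?_ le_rfl)
      rw [abs_mul]
      exact mul_le_mul_of_nonneg_left hwre (abs_nonneg _)
    have h2 : ((A 1 0 : ℝ) * w.re + A 1 1) ^ 2 ≤ (|(A 1 0 : ℝ)| * N + |(A 1 1 : ℝ)|) ^ 2 := by
      rw [← sq_abs]
      exact pow_le_pow_left₀ (abs_nonneg _) h1 2
    have h3 : 1 ≤ z.im ^ 2 := one_le_pow₀ hz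
    have h4 : 0 ≤ (|(A 1 0 : ℝ)| * N + |(A 1 1 : ℝ)|) ^ 2 := by positivity
    nlinarith
  have hJ0 : 0 < J := by linarith
  have him_le : (A • w).im ≤ z.im := by
    rw [him]
    exact div_le_self hy.le hJ1
  have hexp : (A • w).im + 1 / (A • w).im ≤ (1 + D) * z.im := by
    have : 1 / (A • w).im ≤ D * z.im := by
      rw [him, one_div_div, div_le_iff₀ hy]
      linarith [hJ2]
    linarith
  calc z.im ^ (-(3 / 4) : ℝ) * petersson a c (A • z)
      ≤ z.im ^ (-(3 / 4) : ℝ) * (K * Real.exp (C * ((A • w).im + 1 / (A • w).im))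
        * z.im ^ (3 / 4 : ℝ)) := by
        refine mul_le_mul_of_nonneg_left (hle.trans ?_) (by positivity)
        have := (A • w).im_pos
        exact mul_le_mul (hM _) (Real.rpow_le_rpow this.le him_le (by norm_num)) (by positivity)
          (by positivity)
    _ = K * Real.exp (C * ((A • w).im + 1 / (A • w).im)) := by
        have h1 : z.im ^ (-(3 / 4) : ℝ) * z.im ^ (3 / 4 : ℝ) = 1 := by
          rw [← Real.rpow_add hy]
          norm_num
        linear_combination (K * Real.exp (C * ((A • w).im + 1 / (A • w).im))) * h1
    _ ≤ K * Real.exp (C * (1 + D) * z.im) := by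
        refine mul_le_mul_of_nonneg_left (Real.exp_le_exp.2 ?_) hK
        rw [mul_assoc]
        exact mul_le_mul_of_nonneg_left hexp hC

end TwistedRank

theorem theorem4p1 (a c : ℕ) (ha : 0 < a) (hac : a < c) (hcop : Nat.Coprime a c) :
    (∀ z : ℍ,
      Summable (TwistedRank.simpleTerm a c (TwistedRank.e z ^ 24)) ∧
      Summable (TwistedRank.doubleTerm a c (TwistedRank.e z ^ 24)) ∧
      Summable (TwistedRank.thetaTerm a c z) ∧
      IntegrableOn
        (fun t : ℝ => TwistedRank.thetaIntegrand a c z (-conj (z : ℂ) + I * t) * I)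
        (Set.Ioi 0)) ∧
    TwistedRank.IsHarmonicWeakMaassForm 3 (1 : DirichletCharacter ℂ 1)
      (CongruenceSubgroup.Gamma1 (96 * TwistedRank.dc c ^ 2))
      (TwistedRank.completed a c) := by
  have hc : 0 < c := ha.trans hac
  refine ⟨fun z => ⟨?_, ?_, TwistedRank.summable_thetaTerm a hc z.im_pos,
    TwistedRank.integrableOn_thetaIntegrand a hc z⟩, ?_⟩
  · exact TwistedRank.summable_simpleTerm ha hac (pow_ne_zero _ (TwistedRank.e_ne_zero z))
      (TwistedRank.norm_e_pow_lt_one z.im_pos)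
  · exact TwistedRank.summable_doubleTerm ha hac (pow_ne_zero _ (TwistedRank.e_ne_zero z))
      (TwistedRank.norm_e_pow_lt_one z.im_pos)
  · refine ⟨by decide, TwistedRank.Gamma1_le_Gamma0_four c,
      TwistedRank.contDiffOn_completed ha hac, fun A hA z => ?_, fun z => ?_, fun A => ?_⟩
    · rw [TwistedRank.epsilon_of_mem_Gamma1 hA, MulChar.one_apply (isUnit_of_subsingleton _),
        TwistedRank.completed_smul ha hac hA]
      simp
    · simpa using TwistedRank.hypLaplacian_completed ha hac z
    · simpa using TwistedRank.growth_completed ha hac A
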